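/- Notation. A frieze is an array of shifted rows: a row of zeros, then a row of ones, then rows of positive integers, such that every diamond of entries $b$ (top), $a$ (left), $d$ (right), $c$ (bottom) satisfies $ad-bc=1$. Either the rows of positive integers go on for ever (an infinite frieze), or after finitely many of them (possibly none) a second row of ones and a second row of zeros follow and the array stops (a finite frieze). The row directly below the first row of ones is the quiddity row $(a_i)_{i\in\mathbb Z}$. If it has period $n\ge 1$ (not necessarily the shortest period), the frieze is called periodic with quiddity sequence $(a_1,\dots,a_n)$. For $n\ge1$, $m\ge 0$ let $A_{n,m}$ be an annulus with $n$ marked points $1,\dots,n$ in this order on the outer boundary circle and $m$ marked points on the inner one; fix a meridian, i.e. a non-contractible simple closed curve in the interior. A finite arc is a curve joining marked points that has no self-intersections (its endpoints may coincide), runs in the interior of the annulus apart from its endpoints, and is neither contractible nor homotopic to a boundary segment, taken up to orientation and up to homotopy (equivalently, isotopy) fixing the endpoints. An asymptotic arc is a curve without self-intersections that starts at a marked point and spirals infinitely often, in one of the two directions, towards the meridian from its side of it, taken up to deformation fixing its starting point. Two arcs are compatible if they have representatives that do not intersect except possibly in endpoints. A triangulation of $A_{n,m}$ is a maximal collection of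 pairwise compatible (finite or asymptotic) arcs. Its outer quiddity sequence is $(a_1,\dots,a_n)$, where $a_i$ is the number of triangles incident with a lift of the outer marked point $i$ in the induced triangulation of the universal cover (an infinite strip; lifts of asymptotic arcs are considered to end in limit points at the two ends of the strip). **Theorem.** Let $\mathcal F$ be a periodic frieze with quiddity sequence $(a_1,\dots,a_n)$, $n\ge 1$. Then $\mathcal F$ is finite, or there are an integer $m\ge 0$ and a triangulation of $A_{n,m}$ whose outer quiddity sequence is $(a_1,\dots,a_n)$. -/

import Mathlib

/-! ### Friezes -/

/-- A frieze of positive integers, finite or infinite.  Below the row of zeros (entries `(i, i-2)`)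
and the row of ones (entries `(i, i-1)`) there are `width` rows of positive integers, the
`k`-th of which (counted from `0`) consists of the entries `(i, i+k)`.  If `width = ⊤` the frieze is
infinite; if `width` is a natural number `w`, these rows are followed by a second row of ones
and a second row of zeros, and the array stops there (values of `entry` at positions outside the
array carry no meaning).  Every diamond contained in the array satisfies the unimodular rule. -/
structure Frieze where
  width : ℕ∞
  entry : ℤ → ℤ → ℤ
  top_zero : ∀ i : ℤ, entry i (i - 2) = 0
  top_one : ∀ i : ℤ, entry i (i - 1) = 1
  pos : ∀ (i : ℤ) (k : ℕ), (k : ℕ∞) < width → 0 < entry i (i + k)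
  bottom_one : ∀ (i : ℤ) (w : ℕ), width = (w : ℕ∞) → entry i (i + w) = 1
  bottom_zero : ∀ (i : ℤ) (w : ℕ), width = (w : ℕ∞) → entry i (i + w + 1) = 0
  /-- The diamond with corners `(i,j)`, `(i+1,j)`, `(i,j+1)`, `(i+1,j+1)`, where `j = i - 1 + k`. -/
  unimodular : ∀ (i : ℤ) (k : ℕ), (k : ℕ∞) ≤ width + 1 →
    entry i (i - 1 + k) * entry (i + 1) (i - 1 + k + 1)
      - entry (i + 1) (i - 1 + k) * entry i (i - 1 + k + 1) = 1

namespace Frieze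

/-- The frieze has finitely many rows. -/
def IsFinite (F : Frieze) : Prop := F.width ≠ ⊤

/-- `F` is `n`-periodic with quiddity sequence `(a_1, …, a_n)`: its quiddity row (the row right below
the first row of ones) is the `n`-periodic repetition of this tuple.  The tuple is indexed by
`Fin n`, so that `a i` is the member `a_{i+1}`. -/
def HasQuidditySequence (F : Frieze) {n : ℕ} (a : Fin n → ℕ) : Prop :=
  ∀ (i : Fin n) (k : ℤ),
    F.entry ((i : ℤ) + 1 + k * n) ((i : ℤ) + 1 + k * n) = (a i : ℤ)

end Frieze

namespace AnnulusTriangulation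

/-! ### The annulus, its universal cover and its marked points -/

/-- The annulus, as a cylinder of height `1`; height `0` is the outer boundary circle, height `1`
the inner one. -/
abbrev Annulus : Type := UnitAddCircle × unitInterval

/-- The universal cover of the annulus: an infinite strip of height `1`. -/
abbrev Strip : Type := ℝ × unitInterval

/-- The covering map, wrapping the strip around the cylinder. -/
def cover : C(Strip, Annulus) where
  toFun p := ((p.1 : UnitAddCircle), p.2)
  continuous_toFun :=
    ((AddCircle.continuous_mk' (1 : ℝ)).comp continuous_fst).prodMk continuous_snd

/-- The marked points of the strip on the lower boundary (for `n` marked points on the outer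
boundary circle). -/
noncomputable def outerPoint (n : ℕ) (k : ℤ) : Strip := ((k : ℝ) / n, 0)

/-- The marked points of the strip on the upper boundary (for `m > 0` marked points on the inner
boundary circle). -/
noncomputable def innerPoint (m : ℕ) (k : ℤ) : Strip := ((k : ℝ) / m, 1)

/-- The `n` marked points on the outer and `m` marked points on the inner boundary of `A_{n,m}`. -/
def IsMarked (n m : ℕ) (p : Annulus) : Prop :=
  (0 < n ∧ ∃ k : ℤ, p = cover (outerPoint n k)) ∨ (0 < m ∧ ∃ k : ℤ, p = cover (innerPoint m k))

/-- The boundary segment of the outer boundary from the `k`-th marked point to the next one. -/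
noncomputable def outerSegment (n : ℕ) (k : ℤ) : C(unitInterval, Annulus) where
  toFun t := cover (((k : ℝ) + (t : ℝ)) / n, 0)
  continuous_toFun := by fun_prop

/-- The boundary segment of the inner boundary from the `k`-th marked point to the next one. -/
noncomputable def innerSegment (m : ℕ) (k : ℤ) : C(unitInterval, Annulus) where
  toFun t := cover (((k : ℝ) + (t : ℝ)) / m, 1)
  continuous_toFun := by fun_prop

/-! ### Finite arcs -/

/-- The same curve, run through backwards. -/
def reverse (γ : C(unitInterval, Annulus)) : C(unitInterval, Annulus) where
  toFun t := γ (unitInterval.symm t)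
  continuous_toFun := by fun_prop

/-- Two curves agree up to homotopy fixing the endpoints and up to orientation.  (For the simple
curves used below, homotopy and isotopy fixing the endpoints are the same relation.) -/
def SameClass (γ δ : C(unitInterval, Annulus)) : Prop :=
  γ.HomotopicRel δ {0, 1} ∨ (reverse γ).HomotopicRel δ {0, 1}

theorem reverse_reverse (γ : C(unitInterval, Annulus)) : reverse (reverse γ) = γ := by
  ext t <;> simp [reverse]

theorem reverse_homotopicRel {γ δ : C(unitInterval, Annulus)} (h : γ.HomotopicRel δ {0, 1}) :
    (reverse γ).HomotopicRel (reverse δ) {0, 1} := by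
  obtain ⟨H⟩ := h
  refine ⟨⟨⟨⟨fun p => H (p.1, unitInterval.symm p.2), by fun_prop⟩, fun x => ?_, fun x => ?_⟩,
    fun t x hx => ?_⟩⟩
  · simp [reverse]
  · simp [reverse]
  · have hs : unitInterval.symm x ∈ ({0, 1} : Set unitInterval) := by
      rcases hx with rfl | rfl <;> simp
    simpa [reverse] using H.eq_fst t hs

theorem sameClass_equivalence : Equivalence SameClass where
  refl γ := Or.inl (.refl γ)
  symm := by
    rintro γ δ (h | h)
    · exact Or.inl h.symm
    · right
      have := reverse_homotopicRel h.symm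
      rwa [reverse_reverse] at this
  trans := by
    rintro γ δ ε (h | h) (k | k)
    · exact Or.inl (h.trans k)
    · exact Or.inr ((reverse_homotopicRel h).trans k)
    · exact Or.inr (h.trans k)
    · left
      have := reverse_homotopicRel h
      rw [reverse_reverse] at this
      exact this.trans k

/-- A curve in `A_{n,m}` that represents a finite arc: its endpoints are marked points, it runs in
the interior of the annulus otherwise, it has no self-intersections (but the endpoints
may coincide), it is not contractible, and it is not a boundary segment up to homotopy. -/
structure IsArcCurve (n m : ℕ) (γ : C(unitInterval, Annulus)) : Prop where
  marked_zero : IsMarked n m (γ 0)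
  marked_one : IsMarked n m (γ 1)
  interior : ∀ t ∈ Set.Ioo (0 : unitInterval) 1, (γ t).2 ∈ Set.Ioo (0 : unitInterval) 1
  simple : Set.InjOn γ (Set.Ioo 0 1)
  not_contractible : ¬ γ.HomotopicRel (ContinuousMap.const unitInterval (γ 0)) {0, 1}
  not_outerSegment : ∀ k : ℤ, 0 < n → ¬ SameClass γ (outerSegment n k)
  not_innerSegment : ∀ k : ℤ, 0 < m → ¬ SameClass γ (innerSegment m k)

/-- The curves representing finite arcs, considered up to homotopy and orientation. -/
def finiteArcSetoid (n m : ℕ) : Setoid {γ : C(unitInterval, Annulus) // IsArcCurve n m γ} where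
  r γ δ := SameClass γ.1 δ.1
  iseqv := ⟨fun γ => sameClass_equivalence.refl γ.1, fun h => sameClass_equivalence.symm h,
    fun h k => sameClass_equivalence.trans h k⟩

/-- The finite arcs of `A_{n,m}`. -/
abbrev FiniteArc (n m : ℕ) : Type := Quotient (finiteArcSetoid n m)

/-! ### Asymptotic arcs -/

/-- The two directions in which a curve can wind around the meridian. -/
inductive Direction
  | right
  | left

/-- The end of the real line in the given direction. -/
def Direction.toFilter : Direction → Filter ℝ
  | .right => Filter.atTop
  | .left => Filter.atBot

/-- The height of the meridian `z`, the closed curve in the middle of the annulus. -/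
noncomputable def meridian : unitInterval := ⟨1 / 2, by norm_num, by norm_num⟩

/-- A curve `ρ` in the strip which, in the annulus, approaches the meridian while winding around it
infinitely often in direction `d`. -/
def StripSpirals (d : Direction) (ρ : C(NNReal, Strip)) : Prop :=
  Filter.Tendsto (fun t => (ρ t).1) Filter.atTop d.toFilter ∧
    Filter.Tendsto (fun t => (ρ t).2) Filter.atTop (nhds meridian)

/-- A curve in the annulus which approaches the meridian while winding around it infinitely often in
direction `d`. -/
def Spirals (d : Direction) (γ : C(NNReal, Annulus)) : Prop :=
  ∃ ρ : C(NNReal, Strip), cover.comp ρ = γ ∧ StripSpirals d ρ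

/-- A curve in `A_{n,m}` that represents an asymptotic arc with direction `d`: it starts at a marked
point, then stays strictly between that boundary circle and the meridian, has no
self-intersections, and spirals towards the meridian. -/
structure IsAsymptoticCurve (n m : ℕ) (d : Direction) (γ : C(NNReal, Annulus)) : Prop where
  marked_zero : IsMarked n m (γ 0)
  interior : ∀ t : NNReal, 0 < t →
    ((γ 0).2 = 0 ∧ (γ t).2 ∈ Set.Ioo 0 meridian) ∨ ((γ 0).2 = 1 ∧ (γ t).2 ∈ Set.Ioo meridian 1)
  simple : Function.Injective γ
  spirals : Spirals d γ

/-- The curves representing asymptotic arcs with direction `d`, considered up to deformation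
through curves that start at the same point and spiral in direction `d` towards the meridian. -/
def asymptoticArcSetoid (n m : ℕ) (d : Direction) :
    Setoid {γ : C(NNReal, Annulus) // IsAsymptoticCurve n m d γ} where
  r γ δ := γ.1.HomotopicWith δ.1 (fun h => h 0 = γ.1 0 ∧ Spirals d h)
  iseqv := by
    have start : ∀ γ δ : {γ : C(NNReal, Annulus) // IsAsymptoticCurve n m d γ},
        γ.1.HomotopicWith δ.1 (fun h => h 0 = γ.1 0 ∧ Spirals d h) → δ.1 0 = γ.1 0 := by
      rintro γ δ ⟨H⟩
      have := (H.prop 1).1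
      rwa [ContinuousMap.Homotopy.curry_one] at this
    refine ⟨fun γ => .refl _ ⟨rfl, γ.2.spirals⟩, fun {γ δ} h => ?_, fun {γ δ ε} h k => ?_⟩
    · have e := start γ δ h
      rw [← e] at h
      exact h.symm
    · have e := start γ δ h
      rw [e] at k
      exact h.trans k

/-- The asymptotic arcs of `A_{n,m}` with direction `d`; on each of the two boundaries, one of the
directions gives the Prüfer arcs and the other one gives the adic arcs. -/
abbrev AsymptoticArc (n m : ℕ) (d : Direction) : Type := Quotient (asymptoticArcSetoid n m d)

/-! ### Arcs, compatibility and triangulations -/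

/-- The arcs of `A_{n,m}`: the finite arcs together with the asymptotic arcs. -/
inductive Arc (n m : ℕ)
  | finite (α : FiniteArc n m)
  | asymptotic (d : Direction) (α : AsymptoticArc n m d)

/-- `IsTrace α S` says that some curve representing the arc `α` traces out the set `S`, apart from its
endpoints. -/
def IsTrace {n m : ℕ} : Arc n m → Set Annulus → Prop
  | .finite α, S => ∃ γ : {γ : C(unitInterval, Annulus) // IsArcCurve n m γ},
      Quotient.mk (finiteArcSetoid n m) γ = α ∧ S = γ.1 '' Set.Ioo 0 1
  | .asymptotic d α, S => ∃ γ : {γ : C(NNReal, Annulus) // IsAsymptoticCurve n m d γ},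
      Quotient.mk (asymptoticArcSetoid n m d) γ = α ∧ S = γ.1 '' Set.Ioi 0

/-- Two arcs are compatible if they have representatives that do not intersect (common endpoints
are allowed). -/
def Compatible {n m : ℕ} (α β : Arc n m) : Prop :=
  ∃ S S' : Set Annulus, IsTrace α S ∧ IsTrace β S' ∧ Disjoint S S'

/-- A triangulation of `A_{n,m}` is a maximal collection of pairwise compatible arcs. -/
def IsTriangulation {n m : ℕ} (T : Set (Arc n m)) : Prop :=
  Maximal (fun S : Set (Arc n m) => S.Pairwise Compatible) T

/-! ### The induced triangulation of the universal cover -/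

/-- The vertices of triangles in the universal cover: the marked points of the lower and the upper
boundary, and the limit points at the two ends of the strip, towards which lifts of
asymptotic arcs run. -/
inductive Vertex
  | outer (k : ℤ)
  | inner (k : ℤ)
  | limit (d : Direction)

/-- `p` and `q` are the endpoints of a lift of a finite arc of `T`. -/
def LiftJoins {n m : ℕ} (T : Set (Arc n m)) (p q : Strip) : Prop :=
  ∃ (c : C(unitInterval, Strip)) (h : IsArcCurve n m (cover.comp c)),
    c 0 = p ∧ c 1 = q ∧ Arc.finite (Quotient.mk (finiteArcSetoid n m) ⟨cover.comp c, h⟩) ∈ T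

/-- Some lift of an asymptotic arc of `T` starts at `p` and runs off in direction `d`. -/
def LiftEscapes {n m : ℕ} (T : Set (Arc n m)) (p : Strip) (d : Direction) : Prop :=
  ∃ (ρ : C(NNReal, Strip)) (h : IsAsymptoticCurve n m d (cover.comp ρ)),
    ρ 0 = p ∧
      Arc.asymptotic d (Quotient.mk (asymptoticArcSetoid n m d) ⟨cover.comp ρ, h⟩) ∈ T

/-- There is an edge between two vertices: a lift of an arc of `T` or a boundary segment. -/
inductive Edge {n m : ℕ} (T : Set (Arc n m)) : Vertex → Vertex → Prop
  | outer_outer (k l : ℤ) : LiftJoins T (outerPoint n k) (outerPoint n l) →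
      Edge T (.outer k) (.outer l)
  | inner_inner (k l : ℤ) : 0 < m → LiftJoins T (innerPoint m k) (innerPoint m l) →
      Edge T (.inner k) (.inner l)
  | outer_inner (k l : ℤ) : 0 < m → LiftJoins T (outerPoint n k) (innerPoint m l) →
      Edge T (.outer k) (.inner l)
  | outer_limit (k : ℤ) (d : Direction) : LiftEscapes T (outerPoint n k) d →
      Edge T (.outer k) (.limit d)
  | inner_limit (k : ℤ) (d : Direction) : 0 < m → LiftEscapes T (innerPoint m k) d →
      Edge T (.inner k) (.limit d)
  | outer_segment (k : ℤ) : Edge T (.outer k) (.outer (k + 1))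
  | inner_segment (k : ℤ) : 0 < m → Edge T (.inner k) (.inner (k + 1))

/-- The triangles of the induced triangulation of the universal cover, given by their vertices: three
distinct vertices, any two of which are joined by an edge.  (All vertices lie on the
boundary of the strip and the edges do not cross, so three such edges bound a region of
the triangulation, and every region arises in this way.) -/
def IsTriangle {n m : ℕ} (T : Set (Arc n m)) (Δ : Finset Vertex) : Prop :=
  Δ.card = 3 ∧ ∀ u ∈ Δ, ∀ v ∈ Δ, u ≠ v → Edge T u v ∨ Edge T v u

/-- `(a_1, …, a_n)` is the outer quiddity sequence of `T`: in the universal cover, exactly `a_i`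
triangles are incident with the `i`-th vertex of the lower boundary. -/
def IsQuiddityOf {n m : ℕ} (a : Fin n → ℕ) (T : Set (Arc n m)) : Prop :=
  ∀ i : Fin n,
    Set.encard {Δ : Finset Vertex | IsTriangle T Δ ∧ Vertex.outer (i : ℕ) ∈ Δ} = (a i : ℕ∞)

/-- `(a_1, …, a_n)` can be realized in the annulus `A_{n,m}`. -/
def RealizableIn {n : ℕ} (a : Fin n → ℕ) (m : ℕ) : Prop :=
  ∃ T : Set (Arc n m), IsTriangulation T ∧ IsQuiddityOf a T

end AnnulusTriangulation

/-! Only infinite friezes need work. Write L(i,j) for the entry at the chord from i to j of a half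
plane polygon with vertex set ℤ. The diamond rule yields a linear recurrence along diagonals, and
hence the Ptolemy relation L(i,k)L(j,l) = L(i,j)L(k,l) + L(i,l)L(j,k). By positivity, chords with
entry 1 never cross (`noncrossing`), each of them is a boundary segment or the long side of a
triangle of such chords (`exists_split`), and by periodicity their length is at most n. The vertices
over which no such chord passes are called skeletal; they exist.

Around a vertex k, Ptolemy turns the entries between its neighbours into differences of labels:
L(k+1,j) for a neighbour j to the right, L(i,k+1) for a neighbour i to the left. Labels run from 0
at k+1 to L(k-1,k+1), the quiddity entry, at k-1, and neighbours are adjacent exactly when their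
labels are consecutive. The outer neighbours take all labels except those strictly between the
labels of the extreme ones, `last k` and `first k`. The difference `gap k` of these two is 1 at a
non-skeletal vertex, where nothing is missing, and at least 2 at a skeletal one. The missing `gap k
- 1` labels are supplied by consecutive inner points: `height` sums up `gap k - 2` over skeletal
vertices, its growth over a period is m, and a skeletal k is joined to the inner points from `height
k` to `height (k + 1)`. If m = 0, each skeletal vertex lacks one label, and a spiral to the right
fills it. So the number of triangles at k is its quiddity entry.

For the topology, the strip is viewed as the Klein model of the hyperbolic plane, where crossing of
chords is a sign condition on determinants. Chords that do not cross have disjoint geodesics, which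
project to disjoint simple curves in the annulus. Conversely, paths in the disc with linked
endpoints meet (`exists_meet`), so an arc compatible with all chosen arcs has a lift that crosses no
chord; such a pair of vertices is itself a chord (`chord_of_not_crosses`), which is maximality. -/

/-! ### Unimodular patterns of positive integers -/

/-- The entries of an infinite periodic frieze, indexed by the pairs of vertices `i ≤ j` of a
half plane polygon, so that `L i j` belongs to the chord from `i` to `j`. -/
structure PeriodicPattern where
  n : ℕ
  n_pos : 0 < n
  L : ℤ → ℤ → ℤ
  diag : ∀ i, L i i = 0
  succ : ∀ i, L i (i + 1) = 1
  pos : ∀ i j, i < j → 0 < L i j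
  period : ∀ i j, i ≤ j → L (i + n) (j + n) = L i j
  ptolemy : ∀ i j k l, i ≤ j → j ≤ k → k ≤ l →
    L i k * L j l = L i j * L k l + L i l * L j k

namespace PeriodicPattern

variable (P : PeriodicPattern)

/-- Both terms on the right of the Ptolemy relation are at least 1, whereas the left side would be
1. -/
theorem noncrossing {i j k l : ℤ} (hij : i < j) (hjk : j < k) (hkl : k < l)
    (h1 : P.L i k = 1) (h2 : P.L j l = 1) : False := by
  have h := P.ptolemy i j k l hij.le hjk.le hkl.le
  have a := P.pos i j hij
  have b := P.pos k l hkl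
  have c := P.pos i l (by lia)
  have d := P.pos j k hjk
  rw [h1, h2] at h
  nlinarith [mul_pos a b, mul_pos c d]

/-- A chord with entry `1` is the long side of a triangle of such chords. -/
theorem exists_split {i j : ℤ} (hij : i + 2 ≤ j) (h : P.L i j = 1) :
    ∃ k, i < k ∧ k < j ∧ P.L i k = 1 ∧ P.L k j = 1 := by
  -- The third vertex is sought where `L k j` first drops to `L i k` or below; such k exist because
  -- k = j gives 0 ≤ 1.
  obtain ⟨k, ⟨hik, hkj, hk⟩, hmin⟩ :=
    Int.exists_least_of_bdd (P := fun k => i < k ∧ k ≤ j ∧ P.L k j ≤ P.L i k)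
      ⟨i, fun z hz => hz.1.le⟩ ⟨j, by lia, le_rfl, by rw [P.diag, h]; norm_num⟩
  have hX := P.pos i k hik
  rcases eq_or_lt_of_le (show i + 1 ≤ k by lia) with rfl | hlt
  · have := P.pos (i + 1) j (by lia)
    rw [P.succ] at hk
    exact ⟨i + 1, by lia, by lia, P.succ i, by lia⟩
  · have hy := P.pos i (k - 1) (by lia)
    have hY : P.L i (k - 1) < P.L (k - 1) j := by
      by_contra hcon
      have := hmin (k - 1) ⟨by lia, by lia, by lia⟩
      lia
    have hp := P.ptolemy i (k - 1) k j (by lia) (by lia) hkj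
    have hs : P.L (k - 1) k = 1 := by simpa using P.succ (k - 1)
    rw [h, hs] at hp
    -- Ptolemy reads XY = yZ + 1 with X = `L i k`, Y = `L (k - 1) j`, y = `L i (k - 1)` ≤ Y - 1 and
    -- Z = `L k j` ≤ X, so X ≤ 1.
    have hX1 : P.L i k = 1 := by nlinarith
    rcases eq_or_lt_of_le hkj with rfl | hkj'
    · rw [P.diag] at hp
      nlinarith
    · have := P.pos k j hkj'
      exact ⟨k, hik, hkj', hX1, by lia⟩

/-- A vertex is skeletal if no chord with entry `1` passes over it. -/
def Skeletal (k : ℤ) : Prop := ∀ i j, i < k → k < j → P.L i j ≠ 1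

/-- A longer chord would cross its own translate by one period. -/
theorem length_le {i j : ℤ} (h : P.L i j = 1) (hij : i < j) : j ≤ i + P.n := by
  by_contra hcon
  have hn := P.n_pos
  exact P.noncrossing (i := i) (j := i + P.n) (k := j) (l := j + P.n) (by lia) (by lia) (by lia) h
    (by rw [P.period _ _ hij.le, h])

/-- Splitting a chord over k gives a shorter chord over k, unless the third vertex is k itself; the
descent must end there. -/
theorem exists_triangle_over {k : ℤ} (hk : ¬ P.Skeletal k) :
    ∃ i j, i < k ∧ k < j ∧ P.L i j = 1 ∧ P.L i k = 1 ∧ P.L k j = 1 := by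
  simp only [Skeletal, not_forall, not_not] at hk
  obtain ⟨i, j, hi, hj, h⟩ := hk
  induction hN : (j - i).toNat using Nat.strong_induction_on generalizing i j with
  | _ N ih =>
    obtain ⟨k', h1, h2, h3, h4⟩ := P.exists_split (by lia) h
    rcases lt_trichotomy k' k with hlt | rfl | hgt
    · exact ih _ (by lia) k' j hlt hj h4 rfl
    · exact ⟨i, j, hi, hj, h, h3, h4⟩
    · exact ih _ (by lia) i k' hi hgt h3 rfl

theorem skeletal_of_period {k : ℤ} (hk : P.Skeletal k) : P.Skeletal (k + P.n) := by
  intro i j hi hj h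
  refine hk (i - P.n) (j - P.n) (by lia) (by lia) ?_
  rw [← P.period _ _ (by lia)]
  simpa using h

theorem skeletal_of_period' {k : ℤ} (hk : P.Skeletal (k + P.n)) : P.Skeletal k := by
  intro i j hi hj h
  refine hk (i + P.n) (j + P.n) (by lia) (by lia) ?_
  rw [P.period _ _ (by lia), h]

theorem skeletal_add_mul (k : ℤ) (t : ℕ) : P.Skeletal (k + t * P.n) ↔ P.Skeletal k := by
  induction t with
  | zero => simp
  | succ t ih =>
    rw [← ih, show k + ((t + 1 : ℕ) : ℤ) * P.n = k + t * P.n + P.n by push_cast; ring]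
    exact ⟨P.skeletal_of_period', P.skeletal_of_period⟩

/-- The left end of a longest chord with entry 1 is skeletal: a chord over it is too short to reach
the right end as well, so it would cross the longest one. -/
theorem exists_skeletal : ∃ k, P.Skeletal k := by
  obtain ⟨l, ⟨hl, i, hi⟩, hmax⟩ :=
    Int.exists_greatest_of_bdd (P := fun l => 0 < l ∧ ∃ i, P.L i (i + l) = 1)
      ⟨P.n, fun z hz => by
        obtain ⟨h, i, hi⟩ := hz
        have := P.length_le hi (by lia)
        lia⟩ ⟨1, one_pos, 0, P.succ 0⟩
  refine ⟨i, fun i' j' h1 h2 h => ?_⟩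
  have hlt : j' < i + l := by
    have := hmax (j' - i') ⟨by lia, i', by simpa using h⟩
    lia
  exact P.noncrossing h1 h2 hlt h hi

theorem exists_skeletal_gt (k : ℤ) : ∃ s, k < s ∧ P.Skeletal s := by
  obtain ⟨s, hs⟩ := P.exists_skeletal
  refine ⟨s + ((k - s).toNat + 1 : ℕ) * P.n, ?_, (P.skeletal_add_mul _ _).2 hs⟩
  have := P.n_pos
  have h1 : ((k - s).toNat : ℤ) ≥ k - s := Int.self_le_toNat _
  push_cast
  nlinarith

theorem exists_skeletal_lt (k : ℤ) : ∃ s, s < k ∧ P.Skeletal s := by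
  obtain ⟨s, hs⟩ := P.exists_skeletal
  refine ⟨s - ((s - k).toNat + 1 : ℕ) * P.n, ?_,
    (P.skeletal_add_mul _ ((s - k).toNat + 1)).1 (by simpa using hs)⟩
  have := P.n_pos
  have h1 : ((s - k).toNat : ℤ) ≥ s - k := Int.self_le_toNat _
  push_cast
  nlinarith

/-! ### The fan of a vertex -/

/-- This and the next two lemmas are Ptolemy relations with the side from k to k + 1. With the label
`L (k + 1) j` for right neighbours and `L i (k + 1)` for left neighbours, the entry between two
neighbours of k is the difference of their labels. -/
theorem right_right {k j j' : ℤ} (hj : k < j) (hjj : j ≤ j') (h : P.L k j = 1)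
    (h' : P.L k j' = 1) : P.L j j' = P.L (k + 1) j' - P.L (k + 1) j := by
  have := P.ptolemy k (k + 1) j j' (by lia) (by lia) hjj
  rw [h, h', P.succ] at this
  lia

theorem left_left {k i i' : ℤ} (hi : i' < k) (hii : i ≤ i') (h : P.L i k = 1)
    (h' : P.L i' k = 1) : P.L i i' = P.L i' (k + 1) - P.L i (k + 1) := by
  have := P.ptolemy i i' k (k + 1) hii (by lia) (by lia)
  rw [h, h', P.succ] at this
  lia

theorem left_right {k i j : ℤ} (hi : i < k) (hj : k < j) (h : P.L i k = 1)
    (h' : P.L k j = 1) : P.L i j = P.L i (k + 1) - P.L (k + 1) j := by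
  have := P.ptolemy i k (k + 1) j (by lia) (by lia) (by lia)
  rw [h, h', P.succ] at this
  lia

/-- The last neighbour of a vertex to the right. -/
theorem exists_last (k : ℤ) :
    ∃ j, (k < j ∧ P.L k j = 1) ∧ ∀ j', k < j' → P.L k j' = 1 → j' ≤ j := by
  obtain ⟨j, hj, hmax⟩ := Int.exists_greatest_of_bdd (P := fun j => k < j ∧ P.L k j = 1)
    ⟨k + P.n, fun z hz => P.length_le hz.2 hz.1⟩ ⟨k + 1, by lia, P.succ k⟩
  exact ⟨j, hj, fun j' h1 h2 => hmax j' ⟨h1, h2⟩⟩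

/-- The last neighbour of a vertex to the left. -/
theorem exists_first (k : ℤ) :
    ∃ i, (i < k ∧ P.L i k = 1) ∧ ∀ i', i' < k → P.L i' k = 1 → i ≤ i' := by
  obtain ⟨j, hj, hmin⟩ := Int.exists_least_of_bdd (P := fun j => j < k ∧ P.L j k = 1)
    ⟨k - P.n, fun z hz => by have := P.length_le hz.2 hz.1; lia⟩
    ⟨k - 1, by lia, by simpa using P.succ (k - 1)⟩
  exact ⟨j, hj, fun j' h1 h2 => hmin j' ⟨h1, h2⟩⟩

noncomputable def last (k : ℤ) : ℤ := (P.exists_last k).choose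
noncomputable def first (k : ℤ) : ℤ := (P.exists_first k).choose

theorem lt_last (k : ℤ) : k < P.last k := (P.exists_last k).choose_spec.1.1
theorem L_last (k : ℤ) : P.L k (P.last k) = 1 := (P.exists_last k).choose_spec.1.2
theorem le_last {k j : ℤ} (h : k < j) (h' : P.L k j = 1) : j ≤ P.last k :=
  (P.exists_last k).choose_spec.2 j h h'
theorem first_lt (k : ℤ) : P.first k < k := (P.exists_first k).choose_spec.1.1
theorem L_first (k : ℤ) : P.L (P.first k) k = 1 := (P.exists_first k).choose_spec.1.2
theorem first_le {k i : ℤ} (h : i < k) (h' : P.L i k = 1) : P.first k ≤ i :=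
  (P.exists_first k).choose_spec.2 i h h'

theorem last_period (k : ℤ) : P.last (k + P.n) = P.last k + P.n := by
  apply le_antisymm
  · have := P.le_last (k := k) (j := P.last (k + P.n) - P.n)
      (by have := P.lt_last (k + P.n); lia)
      (by
        rw [← P.period _ _ (by have := P.lt_last (k + P.n); lia)]
        simpa using P.L_last (k + P.n))
    lia
  · refine P.le_last (by have := P.lt_last k; lia) ?_
    rw [P.period _ _ (P.lt_last k).le, P.L_last]

theorem first_period (k : ℤ) : P.first (k + P.n) = P.first k + P.n := by
  apply le_antisymm
  · refine P.first_le (by have := P.first_lt k; lia) ?_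
    rw [P.period _ _ (P.first_lt k).le, P.L_first]
  · have := P.first_le (k := k) (i := P.first (k + P.n) - P.n)
      (by have := P.first_lt (k + P.n); lia)
      (by
        rw [← P.period _ _ (by have := P.first_lt (k + P.n); lia)]
        simpa using P.L_first (k + P.n))
    lia

/-- Every label up to that of a right neighbour is the label of a right neighbour. -/
theorem exists_right_label {k j : ℤ} (hj : k < j) (h : P.L k j = 1) {t : ℤ} (ht : 0 ≤ t)
    (htj : t ≤ P.L (k + 1) j) : ∃ j', k < j' ∧ P.L k j' = 1 ∧ P.L (k + 1) j' = t := by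
  induction hN : (j - k).toNat using Nat.strong_induction_on generalizing j with
  | _ N ih =>
    rcases eq_or_lt_of_le htj with rfl | hlt
    · exact ⟨j, hj, h, rfl⟩
    · rcases eq_or_lt_of_le (show k + 1 ≤ j by lia) with rfl | hkj
      · rw [P.diag] at hlt
        lia
      -- The third vertex of the triangle under the chord is a neighbour with label smaller by
      -- exactly 1, as the entry between it and j is 1.
      · obtain ⟨j', h1, h2, h3, h4⟩ := P.exists_split (by lia) h
        have := P.right_right h1 h2.le h3 h
        exact ih _ (by lia) h1 h3 (by lia) rfl

theorem exists_left_label {k i : ℤ} (hi : i < k) (h : P.L i k = 1) {t : ℤ}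
    (ht : t ≤ P.L (k - 1) (k + 1)) (hti : P.L i (k + 1) ≤ t) :
    ∃ i', i' < k ∧ P.L i' k = 1 ∧ P.L i' (k + 1) = t := by
  induction hN : (k - i).toNat using Nat.strong_induction_on generalizing i with
  | _ N ih =>
    rcases eq_or_lt_of_le hti with rfl | hlt
    · exact ⟨i, hi, h, rfl⟩
    · rcases eq_or_lt_of_le (show i ≤ k - 1 by lia) with rfl | hkj
      · lia
      · obtain ⟨i', h1, h2, h3, h4⟩ := P.exists_split (by lia) h
        have := P.left_left h2 h1.le h h4
        exact ih _ (by lia) h2 h4 (by lia) rfl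

/-- The number of triangles at a vertex that have not been cut off by chords with entry `1`. -/
noncomputable def gap (k : ℤ) : ℤ := P.L (P.first k) (P.last k)

/-- The gap is the difference of the labels of the two extreme neighbours, so `gap k - 1` labels
between them are not taken by outer neighbours. -/
theorem gap_eq (k : ℤ) : P.gap k = P.L (P.first k) (k + 1) - P.L (k + 1) (P.last k) :=
  P.left_right (P.first_lt k) (P.lt_last k) (P.L_first k) (P.L_last k)

theorem gap_pos (k : ℤ) : 0 < P.gap k :=
  P.pos _ _ ((P.first_lt k).trans (P.lt_last k))

theorem two_le_gap {k : ℤ} (hk : P.Skeletal k) : 2 ≤ P.gap k := by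
  have h1 := P.gap_pos k
  have h2 : P.gap k ≠ 1 := hk _ _ (P.first_lt k) (P.lt_last k)
  lia

/-- Neighbours beyond the corners of the triangle over k would cross its long side, so the extreme
neighbours are these corners. -/
theorem gap_eq_one {k : ℤ} (hk : ¬ P.Skeletal k) : P.gap k = 1 := by
  obtain ⟨i, j, hi, hj, h, h1, h2⟩ := P.exists_triangle_over hk
  have hl : P.last k = j := by
    refine le_antisymm ?_ (P.le_last hj h2)
    by_contra hcon
    exact P.noncrossing hi hj (not_le.1 hcon) h (P.L_last k)
  have hf : P.first k = i := by
    refine le_antisymm (P.first_le hi h1) ?_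
    by_contra hcon
    exact P.noncrossing (not_le.1 hcon) hi hj (P.L_first k) h
  rw [gap, hl, hf, h]

theorem gap_period (k : ℤ) : P.gap (k + P.n) = P.gap k := by
  rw [gap, gap, first_period, last_period, P.period _ _ ((P.first_lt k).trans (P.lt_last k)).le]

theorem skeletal_last {k : ℤ} (hk : P.Skeletal k) : P.Skeletal (P.last k) := by
  intro i j hi hj h
  rcases lt_trichotomy i k with hlt | rfl | hgt
  · exact hk i j hlt ((P.lt_last k).trans hj) h
  · exact absurd (P.le_last ((P.lt_last i).trans hj) h) (by lia)
  · exact P.noncrossing hgt hi hj (P.L_last k) h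

theorem skeletal_first {k : ℤ} (hk : P.Skeletal k) : P.Skeletal (P.first k) := by
  intro i j hi hj h
  rcases lt_trichotomy k j with hlt | rfl | hgt
  · exact hk i j (hi.trans (P.first_lt k)) hlt h
  · exact absurd (P.first_le (hi.trans (P.first_lt k)) h) (by lia)
  · exact P.noncrossing hi hj hgt h (P.L_first k)

theorem not_skeletal_of_lt_last {k j : ℤ} (hj : k < j) (hl : j < P.last k) : ¬ P.Skeletal j :=
  fun h => h _ _ hj hl (P.L_last k)

theorem not_skeletal_of_first_lt {k j : ℤ} (hj : j < k) (hl : P.first k < j) : ¬ P.Skeletal j :=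
  fun h => h _ _ hl hj (P.L_first k)

/-- A chord over non-skeletal vertices only which is not crossed by a chord with entry `1` has
entry `1` itself. -/
theorem eq_one_of_noncrossing {i j : ℤ} (hij : i < j) (hsk : ∀ k, i < k → k < j → ¬ P.Skeletal k)
    (h1 : ∀ k l, i < k → k < j → j < l → P.L k l ≠ 1)
    (h2 : ∀ k l, k < i → i < l → l < j → P.L k l ≠ 1) : P.L i j = 1 := by
  -- Take the last neighbour p of i up to j. If p < j, the triangle over p has a side excluded by
  -- `h1` or `h2`, or gives a later neighbour, or crosses the chord from i to p.
  obtain ⟨p, ⟨⟨hip, hpj⟩, hp⟩, hmax⟩ :=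
    Int.exists_greatest_of_bdd (P := fun p => (i < p ∧ p ≤ j) ∧ P.L i p = 1)
      ⟨j, fun z hz => hz.1.2⟩ ⟨i + 1, ⟨by lia, by lia⟩, P.succ i⟩
  rcases eq_or_lt_of_le hpj with rfl | hlt
  · exact hp
  obtain ⟨s, t, hs, ht, hst, hsp, hpt⟩ := P.exists_triangle_over (hsk p hip hlt)
  rcases lt_trichotomy s i with hsi | rfl | hsi
  · exact absurd hsp (h2 s p hsi hip hlt)
  · by_cases htj : t ≤ j
    · exact absurd (hmax t ⟨⟨by lia, htj⟩, hst⟩) (by lia)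
    · exact absurd hpt (h1 p t hip hlt (by lia))
  · exact (P.noncrossing hsi hs ht hp hst).elim

/-! ### Heights -/

open Classical in
/-- The number of triangles at the vertex with an edge on the opposite boundary. -/
noncomputable def weight (k : ℤ) : ℤ := if P.Skeletal k then P.gap k - 2 else 0

theorem weight_nonneg (k : ℤ) : 0 ≤ P.weight k := by
  unfold weight
  split_ifs with h
  · have := P.two_le_gap h
    lia
  · rfl

theorem weight_period (k : ℤ) : P.weight (k + P.n) = P.weight k := by
  unfold weight
  by_cases h : P.Skeletal k
  · rw [if_pos (P.skeletal_of_period h), if_pos h, P.gap_period]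
  · rw [if_neg fun h' => h (P.skeletal_of_period' h'), if_neg h]

/-- A primitive of `weight` that vanishes at 0; the second sum serves negative k. The interval from
`height k` to `height (k + 1)` has `gap k - 1` integers for skeletal k. -/
noncomputable def height (k : ℤ) : ℤ :=
  ∑ i ∈ Finset.Ico 0 k, P.weight i - ∑ i ∈ Finset.Ico k 0, P.weight i

theorem height_succ (k : ℤ) : P.height (k + 1) = P.height k + P.weight k := by
  unfold height
  rcases le_or_gt 0 k with h | h
  · have e : Finset.Ico 0 (k + 1) = insert k (Finset.Ico 0 k) := by ext; simp; lia
    rw [e, Finset.sum_insert (by simp), Finset.Ico_eq_empty (by lia : ¬ k + 1 < 0),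
      Finset.Ico_eq_empty (by lia : ¬ k < 0)]
    simp [add_comm]
  · have e : Finset.Ico k 0 = insert k (Finset.Ico (k + 1) 0) := by ext; simp; lia
    rw [e, Finset.sum_insert (by simp), Finset.Ico_eq_empty (by lia : ¬ (0 : ℤ) < k + 1),
      Finset.Ico_eq_empty (by lia : ¬ 0 < k)]
    simp

theorem height_mono : Monotone P.height :=
  monotone_int_of_le_succ fun k => by rw [height_succ]; have := P.weight_nonneg k; lia

/-- The number of marked points needed on the opposite boundary. -/
noncomputable def total : ℕ := (P.height P.n).toNat

theorem height_zero : P.height 0 = 0 := by simp [height]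

theorem coe_total : (P.total : ℤ) = P.height P.n := by
  rw [total, Int.toNat_of_nonneg]
  rw [← P.height_zero]
  exact P.height_mono (by lia)

theorem height_period (k : ℤ) : P.height (k + P.n) = P.height k + P.total := by
  induction k using Int.induction_on with
  | zero => rw [P.coe_total, P.height_zero]; simp
  | succ k ih =>
    rw [show (k : ℤ) + 1 + P.n = (k + P.n) + 1 by ring, height_succ, height_succ, ih, weight_period]
    ring
  | pred k ih =>
    have h1 := P.height_succ (-k - 1)
    have h2 := P.height_succ (-k - 1 + P.n)
    rw [weight_period, show -(k : ℤ) - 1 + P.n + 1 = -k + P.n by ring] at h2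
    rw [show -(k : ℤ) - 1 + 1 = -k by ring] at h1
    lia

/-- If no inner points are needed, every skeletal vertex has gap 2, so exactly one label is missing
there. -/
theorem weight_eq_zero (h : P.total = 0) (k : ℤ) : P.weight k = 0 := by
  have h1 := P.height_period k
  have h2 := P.height_mono (show k + 1 ≤ k + P.n by have := P.n_pos; lia)
  rw [h1, height_succ, h] at h2
  have := P.weight_nonneg k
  push_cast at h2
  lia

theorem height_add_mul (k : ℤ) (t : ℕ) : P.height (k + t * P.n) = P.height k + t * P.total := by
  induction t with
  | zero => simp
  | succ t ih =>
    rw [show k + ((t + 1 : ℕ) : ℤ) * P.n = k + t * P.n + P.n by push_cast; ring, height_period, ih]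
    push_cast
    ring

theorem height_eq_of_not_skeletal {i j : ℤ} (hij : i ≤ j)
    (h : ∀ k, i ≤ k → k < j → ¬ P.Skeletal k) : P.height j = P.height i := by
  induction j, hij using Int.leInduction with
  | base => rfl
  | succ j hij ih =>
    rw [height_succ, ih (fun k h1 h2 => h k h1 (by lia)), weight, if_neg (h j hij (by lia))]
    simp

theorem exists_skeletal_of_lt_height {k l : ℤ} (h : l < P.height k) :
    ∃ s, s < k ∧ P.Skeletal s ∧ l < P.height (s + 1) := by
  obtain ⟨s, ⟨hs, hsk⟩, hmax⟩ := Int.exists_greatest_of_bdd (P := fun s => s < k ∧ P.Skeletal s)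
    ⟨k, fun z hz => hz.1.le⟩ (P.exists_skeletal_lt k)
  refine ⟨s, hs, hsk, ?_⟩
  rwa [← P.height_eq_of_not_skeletal (show s + 1 ≤ k by lia)]
  intro z h1 h2 h3
  have := hmax z ⟨h2, h3⟩
  lia

theorem exists_skeletal_of_height_lt {k l : ℤ} (h : P.height (k + 1) < l) :
    ∃ s, k < s ∧ P.Skeletal s ∧ P.height s < l := by
  obtain ⟨s, ⟨hs, hsk⟩, hmin⟩ := Int.exists_least_of_bdd (P := fun s => k < s ∧ P.Skeletal s)
    ⟨k, fun z hz => hz.1.le⟩ (P.exists_skeletal_gt k)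
  refine ⟨s, hs, hsk, ?_⟩
  rwa [P.height_eq_of_not_skeletal (show k + 1 ≤ s by lia)]
  intro z h1 h2 h3
  have := hmin z ⟨by lia, h3⟩
  lia

/-- The largest k with `height k ≤ l` has positive weight and hence is skeletal. So every inner
point will be the end of a chord from the outer boundary. -/
theorem exists_skeletal_height (h : 0 < P.total) (l : ℤ) :
    ∃ k, P.Skeletal k ∧ P.height k ≤ l ∧ l ≤ P.height (k + 1) := by
  have hb : P.height (-(((-l).toNat : ℕ) : ℤ) * P.n) ≤ l := by
    have := P.height_add_mul (-(((-l).toNat : ℕ) : ℤ) * P.n) (-l).toNat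
    rw [show -(((-l).toNat : ℕ) : ℤ) * P.n + ((-l).toNat : ℕ) * P.n = 0 by ring, height_zero] at this
    have h1 : (((-l).toNat : ℕ) : ℤ) ≥ -l := Int.self_le_toNat _
    nlinarith
  have ht : l < P.height (((l.toNat + 1 : ℕ) : ℤ) * P.n) := by
    have := P.height_add_mul 0 (l.toNat + 1)
    rw [zero_add, height_zero] at this
    rw [this]
    have h1 : ((l.toNat : ℕ) : ℤ) ≥ l := Int.self_le_toNat _
    push_cast
    nlinarith
  obtain ⟨k, hk, hmax⟩ := Int.exists_greatest_of_bdd (P := fun k => P.height k ≤ l)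
    ⟨((l.toNat + 1 : ℕ) : ℤ) * P.n, fun z hz => by
      by_contra hcon
      exact absurd (P.height_mono (not_le.1 hcon).le) (by lia)⟩ ⟨_, hb⟩
  have hk1 : l < P.height (k + 1) := by
    by_contra hcon
    have := hmax (k + 1) (by lia)
    lia
  refine ⟨k, ?_, hk, hk1.le⟩
  by_contra hsk
  rw [height_succ, weight, if_neg hsk] at hk1
  lia

end PeriodicPattern

/-! ### The pattern of an infinite periodic frieze -/

namespace Frieze

/-- The entry of the frieze at the chord from vertex `i` to vertex `j`. -/
def chord (F : Frieze) (i j : ℤ) : ℤ := F.entry (i + 2) j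

variable {F : Frieze}

theorem chord_self (i : ℤ) : F.chord i i = 0 := by
  simpa [chord] using F.top_zero (i + 2)

theorem chord_succ (i : ℤ) : F.chord i (i + 1) = 1 := by
  have := F.top_one (i + 2)
  rwa [show i + 2 - 1 = i + 1 by ring] at this

theorem chord_pos (hF : F.width = ⊤) {i j : ℤ} (hij : i < j) : 0 < F.chord i j := by
  rcases eq_or_lt_of_le (show i + 1 ≤ j by lia) with rfl | h
  · rw [chord_succ]; exact one_pos
  · obtain ⟨k, hk⟩ := Int.eq_ofNat_of_zero_le (show 0 ≤ j - (i + 2) by lia)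
    obtain rfl : j = i + 2 + k := by lia
    exact F.pos (i + 2) k (by rw [hF]; exact ENat.natCast_lt_top k)

theorem chord_unimodular (hF : F.width = ⊤) {p q : ℤ} (hpq : p < q) :
    F.chord p q * F.chord (p + 1) (q + 1) - F.chord (p + 1) q * F.chord p (q + 1) = 1 := by
  obtain ⟨k, hk⟩ := Int.eq_ofNat_of_zero_le (show 0 ≤ q - (p + 1) by lia)
  obtain rfl : q = p + 1 + k := by lia
  have := F.unimodular (p + 2) k (by rw [hF]; simp)
  rw [show p + 2 - 1 + (k : ℤ) = p + 1 + k by ring] at this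
  rw [chord, chord, chord, chord, show p + 1 + 2 = p + 2 + 1 by ring]
  exact this

/-- Downward induction on p. The diamonds at (p, q - 1) and (p, q) share the positive entry `chord
(p + 1) q`, which can be cancelled once the recurrence is known for p + 1. The coefficient does not
depend on p. -/
theorem chord_rec (hF : F.width = ⊤) {p q : ℤ} (hpq : p < q) :
    F.chord p (q + 1) = F.chord (q - 1) (q + 1) * F.chord p q - F.chord p (q - 1) := by
  induction hN : (q - p).toNat generalizing p with
  | zero => lia
  | succ N ih =>
    rcases eq_or_lt_of_le (show p ≤ q - 1 by lia) with rfl | h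
    · have := F.chord_succ (q - 1)
      rw [sub_add_cancel] at this
      rw [this, chord_self]
      ring
    · have h1 := ih (p := p + 1) (by lia) (by lia)
      have h2 := chord_unimodular hF hpq
      have h3 := chord_unimodular hF (p := p) (q := q - 1) h
      rw [sub_add_cancel] at h3
      have h4 := chord_pos hF (show p + 1 < q by lia)
      apply mul_left_cancel₀ h4.ne'
      rw [h1] at h2
      linear_combination h3 - h2

/-- By the recurrence, the minor does not change from k to k + 1; at k = j it is `chord i j`. -/
theorem chord_minor (hF : F.width = ⊤) {i j k : ℤ} (hij : i ≤ j) (hjk : j ≤ k) :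
    F.chord i k * F.chord j (k + 1) - F.chord i (k + 1) * F.chord j k = F.chord i j := by
  induction k, hjk using Int.leInduction with
  | base => rw [chord_self, chord_succ]; ring
  | succ k hjk ih =>
    have h1 := chord_rec hF (show i < k + 1 by lia)
    have h2 := chord_rec hF (show j < k + 1 by lia)
    rw [add_sub_cancel_right] at h1 h2
    rw [h1, h2]
    linear_combination ih

/-- As functions of l both sides obey the same second-order recurrence, so l = k and l = k + 1
suffice; the latter is `chord_minor`. -/
theorem chord_ptolemy (hF : F.width = ⊤) {i j k l : ℤ} (hij : i ≤ j) (hjk : j ≤ k) (hkl : k ≤ l) :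
    F.chord i k * F.chord j l = F.chord i j * F.chord k l + F.chord i l * F.chord j k := by
  suffices H : (F.chord i k * F.chord j l = F.chord i j * F.chord k l + F.chord i l * F.chord j k) ∧
      F.chord i k * F.chord j (l + 1) =
        F.chord i j * F.chord k (l + 1) + F.chord i (l + 1) * F.chord j k from H.1
  induction l, hkl using Int.leInduction with
  | base =>
    rw [chord_self, chord_succ]
    exact ⟨by ring, by linear_combination chord_minor hF hij hjk⟩
  | succ l hkl ih =>
    refine ⟨ih.2, ?_⟩
    have h1 := chord_rec hF (show i < l + 1 by lia)
    have h2 := chord_rec hF (show j < l + 1 by lia)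
    have h3 := chord_rec hF (show k < l + 1 by lia)
    rw [add_sub_cancel_right] at h1 h2 h3
    rw [h1, h2, h3]
    linear_combination F.chord l (l + 1 + 1) * ih.2 - ih.1

theorem quiddity_period {n : ℕ} (hn : 0 < n) {a : Fin n → ℕ} (h : F.HasQuidditySequence a) (k : ℤ) :
    F.chord (k + n - 1) (k + n + 1) = F.chord (k - 1) (k + 1) := by
  have hlt : (k % n).toNat < n := by
    have := Int.emod_lt_of_pos k (show (0 : ℤ) < n by lia)
    have := Int.emod_nonneg k (show (n : ℤ) ≠ 0 by lia)
    lia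
  have h1 := h ⟨_, hlt⟩ (k / n)
  have h2 := h ⟨_, hlt⟩ (k / n + 1)
  have e : ((k % n).toNat : ℤ) = k % n := Int.toNat_of_nonneg (Int.emod_nonneg k (by lia))
  have e' := Int.emod_add_mul_ediv k n
  simp only at h1 h2
  rw [show (((k % n).toNat : ℕ) : ℤ) + 1 + k / n * n = k + 1 by rw [e]; linear_combination e'] at h1
  rw [show (((k % n).toNat : ℕ) : ℤ) + 1 + (k / n + 1) * n = k + n + 1 by
    rw [e]; linear_combination e'] at h2
  rw [chord, chord, show k + n - 1 + 2 = k + n + 1 by ring, show k - 1 + 2 = k + 1 by ring, h1, h2]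

/-- A diagonal and its translate have the same two initial values and the same recurrence, whose
coefficients are periodic. -/
theorem chord_period (hF : F.width = ⊤) {n : ℕ} (hn : 0 < n) {a : Fin n → ℕ}
    (h : F.HasQuidditySequence a) {i j : ℤ} (hij : i ≤ j) :
    F.chord (i + n) (j + n) = F.chord i j := by
  suffices H : F.chord (i + n) (j + n) = F.chord i j ∧
      F.chord (i + n) (j + 1 + n) = F.chord i (j + 1) from H.1
  induction j, hij using Int.leInduction with
  | base =>
    rw [chord_self, chord_self, chord_succ, show i + 1 + (n : ℤ) = i + n + 1 by ring, chord_succ]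
    exact ⟨rfl, rfl⟩
  | succ j hij ih =>
    refine ⟨ih.2, ?_⟩
    have h1 := chord_rec hF (show i < j + 1 by lia)
    have h2 := chord_rec hF (show i + n < j + 1 + n by lia)
    have h3 := quiddity_period hn h (j + 1)
    rw [h3, show j + 1 + (n : ℤ) - 1 = j + n by ring, ih.1, ih.2] at h2
    rw [show j + 1 + 1 + (n : ℤ) = j + 1 + n + 1 by ring, h1, h2]
    simp

/-- The pattern of an infinite periodic frieze. -/
def pattern (F : Frieze) (hF : F.width = ⊤) {n : ℕ} (hn : 0 < n) {a : Fin n → ℕ}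
    (h : F.HasQuidditySequence a) : PeriodicPattern where
  n := n
  n_pos := hn
  L := F.chord
  diag := chord_self
  succ := chord_succ
  pos _ _ := chord_pos hF
  period _ _ := chord_period hF hn h
  ptolemy _ _ _ _ := chord_ptolemy hF

/-- The array entry at `(i + 1, i + 1)` becomes the chord cutting off vertex i, in agreement with
the use of `Vertex.outer i` for `a i`. -/
theorem chord_eq_quiddity {n : ℕ} {a : Fin n → ℕ} (h : F.HasQuidditySequence a) (i : Fin n) :
    F.chord ((i : ℤ) - 1) (i + 1) = a i := by
  have := h i 0
  rw [chord, show (i : ℤ) - 1 + 2 = i + 1 by ring]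
  simpa using this

end Frieze

/-! ### Paths in the disc with linked endpoints meet -/

namespace LinkedPaths

open Complex unitInterval

theorem re_one_sub_pos {w : ℂ} (hw : ‖w‖ ≤ 1) (h : w ≠ 1) : 0 < (1 - w).re := by
  have h1 : w.re ≤ 1 := (re_le_norm w).trans hw
  have h2 : w.re ≠ 1 := fun h2 => h <| by
    have h3 : w.re ^ 2 + w.im ^ 2 ≤ 1 := by
      have := Complex.sq_norm w
      rw [normSq_apply] at this
      nlinarith [norm_nonneg w]
    have h4 : w.im = 0 := by rw [h2] at h3; nlinarith
    exact Complex.ext (by simpa using h2) (by simpa using h4)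
  have := lt_of_le_of_ne h1 h2
  simp
  linarith

/-- Along a path that stays in the closed unit disc, away from the point `P` on its boundary, the
change of a continuous logarithm of the difference is that of a principal logarithm. -/
theorem log_change {P c : ℂ} (hP : ‖P‖ = 1) (hc : c ≠ 0) {h l : I → ℂ} (hh : Continuous h)
    (hl : Continuous l) (hle : ∀ t, ‖h t‖ ≤ 1) (hne : ∀ t, h t ≠ P)
    (hexp : ∀ t, exp (l t) = c * (P - h t)) :
    l 1 - l 0 = log (1 - h 1 / P) - log (1 - h 0 / P) := by
  have hP0 : P ≠ 0 := norm_ne_zero_iff.1 (by rw [hP]; exact one_ne_zero)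
  have hre : ∀ t, 0 < (1 - h t / P).re := fun t =>
    re_one_sub_pos (by rw [norm_div, hP, div_one]; exact hle t)
      fun H => hne t (by rwa [div_eq_one_iff_eq hP0] at H)
  have hD : Continuous fun t => l t - log (1 - h t / P) :=
    hl.sub (Continuous.clog (by fun_prop) fun t => Or.inl (hre t))
  have key : ∀ t, exp (l t - log (1 - h t / P)) = c * P := fun t => by
    have hz : 1 - h t / P ≠ 0 := fun H => by have := hre t; rw [H] at this; simp at this
    rw [exp_sub, hexp, exp_log hz, div_eq_iff hz]
    field_simp
  have := isCoveringMap_exp.const_of_comp hD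
    (fun a a' => Subtype.ext (by simp only [key])) 1 0
  linear_combination this

/-- On the unit circle inversion is complex conjugation. -/
theorem log_one_sub_inv {w : ℂ} (hw : ‖w‖ = 1) (h : w ≠ 1) :
    (log (1 - w⁻¹)).im = -(log (1 - w)).im := by
  have e : 1 - w⁻¹ = (starRingEnd ℂ) (1 - w) := by
    have : normSq w = 1 := by rw [normSq_eq_norm_sq, hw]; norm_num
    rw [map_sub, map_one, Complex.inv_def, this]
    simp
  rw [e, log_conj, conj_im]
  intro H
  have h1 := re_one_sub_pos hw.le h
  rw [arg_eq_pi_iff] at H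
  linarith [H.1]

/-- Clamping the coordinates extends the map to the plane, from which it lifts through `exp`. -/
theorem exists_log (F : C(I × I, ℂ)) (hF : ∀ z, F z ≠ 0) : ∃ l : C(I × I, ℂ), ∀ z, exp (l z) = F z := by
  let G : C(ℝ × ℝ, ℂ) := F.comp ⟨fun z => (Set.projIcc 0 1 zero_le_one z.1,
    Set.projIcc 0 1 zero_le_one z.2), by fun_prop⟩
  obtain ⟨l, ⟨-, hl⟩, -⟩ := isCoveringMapOn_exp.existsUnique_continuousMap_lifts G (a₀ := 0)
    (exp_log (x := G 0) (hF _)) (fun a => hF _)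
  refine ⟨l.comp ⟨fun z => ((z.1 : ℝ), (z.2 : ℝ)), by fun_prop⟩, fun z => ?_⟩
  have := congrFun hl ((z.1 : ℝ), (z.2 : ℝ))
  simpa [G] using this

/-- The negative product in `H` expresses algebraically that the endpoints are linked. If the paths
did not meet, `f x - g y` would have a continuous logarithm on the square, whose changes along the
two boundary routes from (0,0) to (1,1) agree. By `log_change` these changes are differences of
principal logarithms, and the comparison shows that the arguments of the four factors in `H` add up
to 0, so that their product would be positive. -/
theorem exists_meet {f g : C(I, ℂ)} (hf : ∀ t, ‖f t‖ ≤ 1) (hg : ∀ t, ‖g t‖ ≤ 1)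
    {p q r s : ℂ} (hp : ‖p‖ = 1) (hq : ‖q‖ = 1) (hr : ‖r‖ = 1) (hs : ‖s‖ = 1)
    (hf0 : f 0 = p) (hf1 : f 1 = q) (hg0 : g 0 = r) (hg1 : g 1 = s)
    {c : ℝ} (hc : c < 0) (H : (1 - s / p) * (1 - p / r) * (1 - r / q) * (1 - q / s) = c) :
    ∃ x y, f x = g y := by
  by_contra! hne
  obtain ⟨l, hl⟩ := exists_log ⟨fun z => f z.1 - g z.2, by fun_prop⟩ fun z =>
    sub_ne_zero.2 (hne z.1 z.2)
  simp only [ContinuousMap.coe_mk] at hl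
  have e1 := log_change hp one_ne_zero (h := g) (l := fun t => l (0, t)) (by fun_prop)
    (by fun_prop) hg (fun t => by rw [← hf0]; exact (hne 0 t).symm)
    (fun t => by rw [hl, ← hf0, one_mul])
  have e2 := log_change hq one_ne_zero (h := g) (l := fun t => l (1, t)) (by fun_prop)
    (by fun_prop) hg (fun t => by rw [← hf1]; exact (hne 1 t).symm)
    (fun t => by rw [hl, ← hf1, one_mul])
  have e3 := log_change hr (neg_ne_zero.2 one_ne_zero) (h := f) (l := fun t => l (t, 0))
    (by fun_prop) (by fun_prop) hf (fun t => by rw [← hg0]; exact hne t 0)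
    (fun t => by rw [hl, ← hg0]; ring)
  have e4 := log_change hs (neg_ne_zero.2 one_ne_zero) (h := f) (l := fun t => l (t, 1))
    (by fun_prop) (by fun_prop) hf (fun t => by rw [← hg1]; exact hne t 1)
    (fun t => by rw [hl, ← hg1]; ring)
  simp only [hf0, hf1, hg0, hg1] at e1 e2 e3 e4
  have ne0 : ∀ {z : ℂ}, ‖z‖ = 1 → z ≠ 0 := fun hz => norm_ne_zero_iff.1 (by rw [hz]; exact one_ne_zero)
  have flip : ∀ {z w : ℂ}, ‖z‖ = 1 → ‖w‖ = 1 → w ≠ z →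
      (log (1 - z / w)).im = -(log (1 - w / z)).im := fun {z w} hz hw hzw => by
    rw [← inv_div w z]
    exact log_one_sub_inv (by rw [norm_div, hz, hw, div_one])
      fun h => hzw ((div_eq_one_iff_eq (ne0 hz)).1 h)
  have hps : p ≠ s := hf0 ▸ hg1 ▸ hne 0 1
  have hpr : p ≠ r := hf0 ▸ hg0 ▸ hne 0 0
  have hqs : q ≠ s := hf1 ▸ hg1 ▸ hne 1 1
  have hqr : q ≠ r := hf1 ▸ hg0 ▸ hne 1 0
  have i1 := congrArg im e1
  have i2 := congrArg im e2
  have i3 := congrArg im e3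
  have i4 := congrArg im e4
  simp only [sub_im] at i1 i2 i3 i4
  have j1 := flip hp hs hps.symm
  have j2 := flip hr hp hpr
  have j3 := flip hq hr hqr.symm
  have j4 := flip hs hq hqs
  -- After the flips, the difference of the two routes is twice the sum of the four arguments.
  have hsum : (log (1 - s / p) + log (1 - p / r) + log (1 - r / q) + log (1 - q / s)).im = 0 := by
    simp only [add_im]
    linarith
  have nz : ∀ {z w : ℂ}, ‖w‖ = 1 → z ≠ w → 1 - z / w ≠ 0 := fun hw hzw h =>
    hzw ((div_eq_one_iff_eq (ne0 hw)).1 (sub_eq_zero.1 h).symm)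
  rw [← exp_log (nz hp hps.symm), ← exp_log (nz hr hpr), ← exp_log (nz hq hqr.symm),
    ← exp_log (nz hs hqs), ← exp_add, ← exp_add, ← exp_add] at H
  have h2 := congrArg re H
  rw [exp_re, hsum, ofReal_re, Real.cos_zero, mul_one] at h2
  linarith [Real.exp_pos (log (1 - s / p) + log (1 - p / r) + log (1 - r / q) + log (1 - q / s)).re]

end LinkedPaths

/-! ### The strip as the Klein disc -/

namespace AnnulusTriangulation

open Complex in
/-- The strip as a closed disc (the Klein model of the hyperbolic plane) without two boundary points,
which correspond to the two ends of the strip. -/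
noncomputable def disc (p : Strip) : ℂ :=
  ((Real.exp p.1 - Real.exp (-p.1) : ℝ) + (2 * (2 * (p.2 : ℝ) - 1) : ℝ) * I) /
    (Real.exp p.1 + Real.exp (-p.1) : ℝ)

theorem continuous_disc : Continuous disc := by
  unfold disc
  refine Continuous.div (by fun_prop) (by fun_prop) fun p => ?_
  have := Real.exp_pos p.1
  have := Real.exp_pos (-p.1)
  exact_mod_cast (by positivity : Real.exp p.1 + Real.exp (-p.1) ≠ 0)

theorem disc_re (p : Strip) :
    (disc p).re = (Real.exp p.1 - Real.exp (-p.1)) / (Real.exp p.1 + Real.exp (-p.1)) := by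
  rw [disc, Complex.div_ofReal_re, Complex.add_re, Complex.ofReal_re, Complex.re_ofReal_mul,
    Complex.I_re, mul_zero, add_zero]

theorem disc_im (p : Strip) :
    (disc p).im = 2 * (2 * (p.2 : ℝ) - 1) / (Real.exp p.1 + Real.exp (-p.1)) := by
  rw [disc, Complex.div_ofReal_im, Complex.add_im, Complex.ofReal_im, Complex.im_ofReal_mul,
    Complex.I_im, mul_one, zero_add]

/-- Heights 0 and 1 go to the unit circle, heights strictly between them to the open disc. -/
theorem normSq_disc (p : Strip) :
    Complex.normSq (disc p) =
      1 - 4 * (1 - (2 * (p.2 : ℝ) - 1) ^ 2) / (Real.exp p.1 + Real.exp (-p.1)) ^ 2 := by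
  have h : Real.exp p.1 * Real.exp (-p.1) = 1 := by rw [← Real.exp_add]; simp
  have := Real.exp_pos p.1
  have := Real.exp_pos (-p.1)
  rw [Complex.normSq_apply, disc_re, disc_im]
  field_simp
  linear_combination (-4) * h

theorem norm_disc_le (p : Strip) : ‖disc p‖ ≤ 1 := by
  have h := normSq_disc p
  rw [Complex.normSq_eq_norm_sq] at h
  have h1 : 0 ≤ 4 * (1 - (2 * (p.2 : ℝ) - 1) ^ 2) / (Real.exp p.1 + Real.exp (-p.1)) ^ 2 := by
    have := p.2.2.1
    have := p.2.2.2
    apply div_nonneg _ (by positivity)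
    nlinarith
  nlinarith [norm_nonneg (disc p)]

theorem norm_disc_lt {p : Strip} (hp : p.2 ∈ Set.Ioo (0 : unitInterval) 1) : ‖disc p‖ < 1 := by
  have h := normSq_disc p
  rw [Complex.normSq_eq_norm_sq] at h
  have h1 : 0 < 4 * (1 - (2 * (p.2 : ℝ) - 1) ^ 2) / (Real.exp p.1 + Real.exp (-p.1)) ^ 2 := by
    have h0 : (0 : ℝ) < p.2 := hp.1
    have h1 : (p.2 : ℝ) < 1 := hp.2
    have := Real.exp_pos p.1
    have := Real.exp_pos (-p.1)
    apply div_pos _ (by positivity)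
    nlinarith
  nlinarith [norm_nonneg (disc p)]

/-- A point of the strip is determined by its null coordinates up to scaling. -/
theorem strip_ext {p q : Strip} {c : ℝ} (hc : 0 < c) (h1 : Real.exp p.1 = c * Real.exp q.1)
    (h2 : Real.exp (-p.1) = c * Real.exp (-q.1))
    (h3 : 2 * (p.2 : ℝ) - 1 = c * (2 * (q.2 : ℝ) - 1)) : p = q := by
  have hp : Real.exp p.1 * Real.exp (-p.1) = 1 := by rw [← Real.exp_add]; simp
  have hq : Real.exp q.1 * Real.exp (-q.1) = 1 := by rw [← Real.exp_add]; simp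
  have hc1 : c = 1 := by
    rw [h1, h2] at hp
    have : c ^ 2 = 1 := by linear_combination hp - c ^ 2 * hq
    nlinarith
  subst hc1
  rw [one_mul] at h1 h3
  exact Prod.ext (Real.exp_injective h1) (Subtype.ext (by linarith))

theorem disc_injective : Function.Injective disc := by
  intro p q h
  have h1 := congrArg Complex.re h
  have h2 := congrArg Complex.im h
  rw [disc_re, disc_re] at h1
  rw [disc_im, disc_im] at h2
  have p1 := Real.exp_pos p.1
  have p2 := Real.exp_pos (-p.1)
  have q1 := Real.exp_pos q.1
  have q2 := Real.exp_pos (-q.1)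
  have hq : 0 < Real.exp q.1 + Real.exp (-q.1) := by positivity
  rw [div_eq_div_iff (by positivity) (by positivity)] at h1 h2
  refine strip_ext (c := (Real.exp p.1 + Real.exp (-p.1)) / (Real.exp q.1 + Real.exp (-q.1)))
    (by positivity) ?_ ?_ ?_ <;> rw [div_mul_eq_mul_div, eq_div_iff hq.ne']
  · linear_combination h1 / 2
  · linear_combination -h1 / 2
  · linear_combination h2 / 2

/-! ### Homogeneous coordinates of vertices -/

/-- Homogeneous coordinates of a vertex on the boundary of the hyperbolic plane. -/
noncomputable def homog (n m : ℕ) : Vertex → ℝ × ℝ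
  | .outer k => (Real.exp ((k : ℝ) / n / 2), Real.exp (-((k : ℝ) / n / 2)))
  | .inner k => (-Real.exp ((k : ℝ) / m / 2), Real.exp (-((k : ℝ) / m / 2)))
  | .limit .right => (1, 0)
  | .limit .left => (0, 1)

/-- The determinant of the coordinates of two vertices. -/
noncomputable def bracket (n m : ℕ) (u v : Vertex) : ℝ :=
  (homog n m u).1 * (homog n m v).2 - (homog n m u).2 * (homog n m v).1

/-- Inner vertices exist only if there are marked points on the inner boundary. -/
def Valid (m : ℕ) : Vertex → Prop
  | .inner _ => 0 < m
  | _ => True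

/-- An integer with the sign of the determinant of two vertices. -/
def order : Vertex → Vertex → ℤ
  | .outer k, .outer l => k - l
  | .outer _, .inner _ => 1
  | .outer _, .limit .right => -1
  | .outer _, .limit .left => 1
  | .inner _, .outer _ => -1
  | .inner k, .inner l => l - k
  | .inner _, .limit _ => -1
  | .limit .right, .outer _ => 1
  | .limit .left, .outer _ => -1
  | .limit _, .inner _ => 1
  | .limit .right, .limit .left => 1
  | .limit .left, .limit .right => -1
  | .limit .right, .limit .right => 0
  | .limit .left, .limit .left => 0

/-- The chords `u v` and `r s` cross. -/
def Crosses (u v r s : Vertex) : Prop := order u r * order v r * order u s * order v s < 0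

theorem sign_exp_sub (a b : ℤ) {n : ℕ} (hn : 0 < n) :
    SignType.sign (Real.exp ((a : ℝ) / n / 2) * Real.exp (-((b : ℝ) / n / 2)) -
      Real.exp (-((a : ℝ) / n / 2)) * Real.exp ((b : ℝ) / n / 2)) = SignType.sign (a - b) := by
  rw [← Real.exp_add, ← Real.exp_add]
  have hn' : (0 : ℝ) < n := by exact_mod_cast hn
  rcases lt_trichotomy a b with h | rfl | h
  · have : (a : ℝ) / n < b / n := by gcongr
    rw [sign_neg (sub_neg.2 h), sign_neg]
    rw [sub_neg, Real.exp_lt_exp]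
    linarith
  · simp [add_comm]
  · have : (b : ℝ) / n < a / n := by gcongr
    rw [sign_pos (sub_pos.2 h), sign_pos]
    rw [sub_pos, Real.exp_lt_exp]
    linarith

/-- This reduces the geometric question on which side of a chord a vertex lies to integer
inequalities. -/
theorem sign_bracket {n m : ℕ} (hn : 0 < n) {u v : Vertex} (hu : Valid m u) (hv : Valid m v) :
    SignType.sign (bracket n m u v) = SignType.sign (order u v) := by
  rcases u with k | k | (_ | _) <;> rcases v with l | l | (_ | _) <;>
    simp only [bracket, homog, order, mul_zero, mul_one, zero_sub, sub_zero, zero_mul, one_mul,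
      sub_self, Left.sign_neg, sign_one, sign_zero, neg_mul, mul_neg, sub_neg_eq_add]
  · exact sign_exp_sub k l hn
  · exact sign_pos (by positivity)
  · rw [sign_pos (by positivity)]
  · exact sign_pos (by positivity)
  · refine sign_neg ?_
    rw [← neg_add', Left.neg_neg_iff]
    positivity
  · rw [← sign_exp_sub l k hv]
    congr 1
    ring
  · rw [sign_pos (by positivity)]
  · rw [sign_pos (by positivity)]
  · exact sign_pos (by positivity)
  · exact sign_pos (by positivity)
  · rw [sign_pos (by positivity)]
  · exact sign_pos (by positivity)

theorem order_eq_zero {u v : Vertex} : order u v = 0 ↔ u = v := by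
  rcases u with k | k | (_ | _) <;> rcases v with l | l | (_ | _) <;>
    simp [order, sub_eq_zero, eq_comm]

theorem bracket_eq_zero {n m : ℕ} (hn : 0 < n) {u v : Vertex} (hu : Valid m u) (hv : Valid m v) :
    bracket n m u v = 0 ↔ u = v := by
  rw [← order_eq_zero, ← sign_eq_zero_iff, sign_bracket hn hu hv, sign_eq_zero_iff]

theorem crosses_iff {n m : ℕ} (hn : 0 < n) {u v r s : Vertex} (hu : Valid m u) (hv : Valid m v)
    (hr : Valid m r) (hs : Valid m s) :
    Crosses u v r s ↔
      bracket n m u r * bracket n m v r * bracket n m u s * bracket n m v s < 0 := by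
  rw [Crosses, ← sign_eq_neg_one_iff, ← sign_eq_neg_one_iff]
  simp only [sign_mul, sign_bracket hn hu hr, sign_bracket hn hv hr, sign_bracket hn hu hs,
    sign_bracket hn hv hs]

open Complex in
/-- The boundary point of the disc that corresponds to a vertex. -/
noncomputable def circlePoint (n m : ℕ) (u : Vertex) : ℂ :=
  ((homog n m u).1 - (homog n m u).2 * I) / ((homog n m u).1 + (homog n m u).2 * I)

theorem homog_norm_pos (n m : ℕ) (u : Vertex) :
    0 < (homog n m u).1 ^ 2 + (homog n m u).2 ^ 2 := by
  rcases u with k | k | (_ | _) <;> simp only [homog] <;> positivity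

theorem norm_circlePoint (n m : ℕ) (u : Vertex) : ‖circlePoint n m u‖ = 1 := by
  have h := homog_norm_pos n m u
  set a := (homog n m u).1 with ha
  set b := (homog n m u).2 with hb
  have e : (a - b * Complex.I : ℂ) = (starRingEnd ℂ) (a + b * Complex.I) := by simp [sub_eq_add_neg]
  rw [circlePoint, norm_div, ← ha, ← hb, e, Complex.norm_conj, div_self]
  rw [norm_ne_zero_iff]
  intro h0
  have h1 := congrArg Complex.re h0
  have h2 := congrArg Complex.im h0
  simp at h1 h2
  rw [h1, h2] at h
  simp at h

/-- Each factor is 2i times a bracket, divided by a product of complex coordinates; in the product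
of all four, these denominators combine to squared norms. This links `Crosses` to the hypothesis of
`exists_meet`. -/
theorem circlePoint_product (n m : ℕ) (u v r s : Vertex) :
    ∃ N : ℝ, 0 < N ∧
      (1 - circlePoint n m s / circlePoint n m u) * (1 - circlePoint n m u / circlePoint n m r) *
        (1 - circlePoint n m r / circlePoint n m v) * (1 - circlePoint n m v / circlePoint n m s) =
      ((bracket n m u r * bracket n m v r * bracket n m u s * bracket n m v s / N : ℝ) : ℂ) := by
  have key : ∀ w, ∃ z : ℂ, z ≠ 0 ∧ (starRingEnd ℂ) z ≠ 0 ∧ z.re = (homog n m w).1 ∧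
      z.im = (homog n m w).2 ∧ circlePoint n m w = (starRingEnd ℂ) z / z := by
    intro w
    have h := homog_norm_pos n m w
    have hz : ((homog n m w).1 + (homog n m w).2 * Complex.I : ℂ) ≠ 0 := fun h0 => by
      have h1 := congrArg Complex.re h0
      have h2 := congrArg Complex.im h0
      simp at h1 h2
      rw [h1, h2] at h
      simp at h
    refine ⟨_, hz, (map_ne_zero _).2 hz, by simp, by simp, ?_⟩
    rw [circlePoint]
    simp [sub_eq_add_neg]
  obtain ⟨a, a0, a1, ar, ai, ha⟩ := key u
  obtain ⟨b, b0, b1, br, bi, hb⟩ := key v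
  obtain ⟨c, c0, c1, cr, ci, hc⟩ := key r
  obtain ⟨d, d0, d1, dr, di, hd⟩ := key s
  have quot : ∀ {x y : ℂ}, x ≠ 0 → y ≠ 0 → (starRingEnd ℂ) x ≠ 0 → (starRingEnd ℂ) y ≠ 0 →
      1 - ((starRingEnd ℂ) x / x) / ((starRingEnd ℂ) y / y) =
        2 * Complex.I * ((y.re * x.im - y.im * x.re : ℝ) : ℂ) / (x * (starRingEnd ℂ) y) := by
    intro x y hx hy hx' hy'
    have e : x * (starRingEnd ℂ) y - (starRingEnd ℂ) x * y =
        2 * Complex.I * ((y.re * x.im - y.im * x.re : ℝ) : ℂ) := by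
      apply Complex.ext <;> simp <;> ring
    rw [← e]
    field_simp
  have hN : ∀ {x : ℂ}, x ≠ 0 → 0 < Complex.normSq x := fun h => Complex.normSq_pos.2 h
  refine ⟨Complex.normSq a * Complex.normSq b * Complex.normSq c * Complex.normSq d / 16,
    by have := hN a0; have := hN b0; have := hN c0; have := hN d0; positivity, ?_⟩
  rw [ha, hb, hc, hd, quot d0 a0 d1 a1, quot a0 c0 a1 c1, quot c0 b0 c1 b1, quot b0 d0 b1 d1]
  simp only [bracket, ← ar, ← ai, ← br, ← bi, ← cr, ← ci, ← dr, ← di]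
  push_cast
  rw [← Complex.mul_conj, ← Complex.mul_conj, ← Complex.mul_conj, ← Complex.mul_conj]
  field_simp
  ring_nf
  rw [show Complex.I ^ 4 = 1 from Complex.I_pow_four]
  ring

/-- The point of the strip at a vertex; for the limit points, the value carries no meaning. -/
noncomputable def position (n m : ℕ) : Vertex → Strip
  | .outer k => outerPoint n k
  | .inner k => innerPoint m k
  | .limit _ => (0, 0)

/-- The vertex is not a limit point. -/
def Vertex.IsFinite : Vertex → Prop
  | .limit _ => False
  | _ => True

/-- With homogeneous coordinates (a, b), the circle point is (a - bi)² / (a² + b²), and ab = ±1 at a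
marked point. -/
theorem disc_position (n m : ℕ) {u : Vertex} (hu : u.IsFinite) :
    disc (position n m u) = circlePoint n m u := by
  have e : ∀ x : ℝ, Real.exp x = Real.exp (x / 2) ^ 2 := fun x => by
    rw [← Real.exp_nat_mul]; congr 1; push_cast; ring
  have e' : ∀ x : ℝ, Real.exp (x / 2) * Real.exp (-(x / 2)) = 1 := fun x => by
    rw [← Real.exp_add]; simp
  have h := homog_norm_pos n m u
  have hz : ((homog n m u).1 + (homog n m u).2 * Complex.I : ℂ) ≠ 0 := fun h0 => by
    have h1 := congrArg Complex.re h0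
    have h2 := congrArg Complex.im h0
    simp at h1 h2
    rw [h1, h2] at h
    simp at h
  rcases u with k | k | k
  · have e1 := e ((k : ℝ) / n)
    have e2 := e (-((k : ℝ) / n))
    rw [neg_div] at e2
    have e3 : ((Real.exp ((k : ℝ) / n / 2) : ℝ) : ℂ) * (Real.exp (-((k : ℝ) / n / 2)) : ℝ) = 1 := by
      exact_mod_cast e' ((k : ℝ) / n)
    rw [circlePoint, eq_div_iff hz]
    simp only [disc, position, outerPoint, homog] at h ⊢
    rw [e1, e2]
    rw [div_mul_eq_mul_div, div_eq_iff (by exact_mod_cast h.ne')]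
    push_cast at e3 ⊢
    generalize Complex.exp ((k : ℂ) / n / 2) = A at *
    generalize Complex.exp (-((k : ℂ) / n / 2)) = B at *
    linear_combination (2 * A * Complex.I - 2 * B) * e3 - 2 * B * Complex.I_sq
  · have e1 := e ((k : ℝ) / m)
    have e2 := e (-((k : ℝ) / m))
    rw [neg_div] at e2
    have e3 : ((Real.exp ((k : ℝ) / m / 2) : ℝ) : ℂ) * (Real.exp (-((k : ℝ) / m / 2)) : ℝ) = 1 := by
      exact_mod_cast e' ((k : ℝ) / m)
    rw [circlePoint, eq_div_iff hz]
    simp only [disc, position, innerPoint, homog, neg_sq] at h ⊢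
    rw [e1, e2]
    rw [div_mul_eq_mul_div, div_eq_iff (by exact_mod_cast h.ne')]
    push_cast at e3 ⊢
    generalize Complex.exp ((k : ℂ) / m / 2) = A at *
    generalize Complex.exp (-((k : ℂ) / m / 2)) = B at *
    linear_combination (2 * A * Complex.I + 2 * B) * e3 + 2 * B * Complex.I_sq
  · exact hu.elim

/-- The set contains the image of a curve in the strip from `u` to `v`. -/
def Connects (n m : ℕ) (S : Set Annulus) (u v : Vertex) : Prop :=
  ∃ f : C(unitInterval, ℂ), f 0 = circlePoint n m u ∧ f 1 = circlePoint n m v ∧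
    ∀ t ∈ Set.Ioo (0 : unitInterval) 1,
      ∃ p : Strip, p.2 ∈ Set.Ioo (0 : unitInterval) 1 ∧ disc p = f t ∧ cover p ∈ S

theorem Connects.symm {n m : ℕ} {S : Set Annulus} {u v : Vertex} (h : Connects n m S u v) :
    Connects n m S v u := by
  obtain ⟨f, h0, h1, h⟩ := h
  refine ⟨⟨fun t => f (unitInterval.symm t), by fun_prop⟩, by simpa using h1, by simpa using h0,
    fun t ht => h _ ⟨?_, ?_⟩⟩
  · have := unitInterval.strictAnti_symm ht.2
    simpa using this
  · have := unitInterval.strictAnti_symm ht.1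
    simpa using this

theorem not_disjoint_of_crosses {n m : ℕ} (hn : 0 < n) {S S' : Set Annulus} {u v r s : Vertex}
    (hu : Valid m u) (hv : Valid m v) (hr : Valid m r) (hs : Valid m s) (hc : Crosses u v r s)
    (h : Connects n m S u v) (h' : Connects n m S' r s) : ¬ Disjoint S S' := by
  rw [crosses_iff hn hu hv hr hs] at hc
  obtain ⟨f, f0, f1, hf⟩ := h
  obtain ⟨g, g0, g1, hg⟩ := h'
  obtain ⟨N, hN, hprod⟩ := circlePoint_product n m u v r s
  have cases : ∀ t : unitInterval, t = 0 ∨ t = 1 ∨ t ∈ Set.Ioo (0 : unitInterval) 1 := fun t => by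
    rcases eq_or_lt_of_le (unitInterval.nonneg' (t := t)) with h | h
    · exact Or.inl h.symm
    rcases eq_or_lt_of_le (unitInterval.le_one' (t := t)) with h' | h'
    · exact Or.inr (Or.inl h')
    · exact Or.inr (Or.inr ⟨h, h'⟩)
  have fn : ∀ t, ‖f t‖ ≤ 1 := fun t => by
    rcases cases t with rfl | rfl | ht
    · rw [f0, norm_circlePoint]
    · rw [f1, norm_circlePoint]
    · obtain ⟨p, -, hp, -⟩ := hf t ht
      rw [← hp]; exact norm_disc_le p
  have gn : ∀ t, ‖g t‖ ≤ 1 := fun t => by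
    rcases cases t with rfl | rfl | ht
    · rw [g0, norm_circlePoint]
    · rw [g1, norm_circlePoint]
    · obtain ⟨p, -, hp, -⟩ := hg t ht
      rw [← hp]; exact norm_disc_le p
  have fi : ∀ t ∈ Set.Ioo (0 : unitInterval) 1, ‖f t‖ ≠ 1 := fun t ht => by
    obtain ⟨p, hp', hp, -⟩ := hf t ht
    rw [← hp]; exact (norm_disc_lt hp').ne
  have gi : ∀ t ∈ Set.Ioo (0 : unitInterval) 1, ‖g t‖ ≠ 1 := fun t ht => by
    obtain ⟨p, hp', hp, -⟩ := hg t ht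
    rw [← hp]; exact (norm_disc_lt hp').ne
  have nz : ∀ w, circlePoint n m w ≠ 0 := fun w => norm_ne_zero_iff.1 (by
    rw [norm_circlePoint]; exact one_ne_zero)
  have hneg : bracket n m u r * bracket n m v r * bracket n m u s * bracket n m v s / N < 0 :=
    div_neg_of_neg_of_pos hc hN
  have hne : ∀ z : ℂ, z = ((bracket n m u r * bracket n m v r * bracket n m u s *
      bracket n m v s / N : ℝ) : ℂ) → z ≠ 0 := fun z hz h0 => by
    rw [h0] at hz
    exact hneg.ne (by exact_mod_cast hz.symm)
  -- A common endpoint of the two chords would make one factor of the product vanish. With distinct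
  -- endpoints on the circle and all other points in the open disc, the curves can only meet in
  -- their interiors.
  have hp0 := hne _ hprod
  have us : circlePoint n m u ≠ circlePoint n m s := fun h => hp0 (by rw [h, div_self (nz _)]; simp)
  have ur : circlePoint n m u ≠ circlePoint n m r := fun h => hp0 (by rw [h, div_self (nz _)]; simp)
  have vr : circlePoint n m v ≠ circlePoint n m r := fun h => hp0 (by rw [h, div_self (nz _)]; simp)
  have vs : circlePoint n m v ≠ circlePoint n m s := fun h => hp0 (by rw [h, div_self (nz _)]; simp)
  obtain ⟨x, y, hxy⟩ := LinkedPaths.exists_meet fn gn (norm_circlePoint n m u)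
    (norm_circlePoint n m v) (norm_circlePoint n m r) (norm_circlePoint n m s) f0 f1 g0 g1 hneg hprod
  have hx : x ∈ Set.Ioo (0 : unitInterval) 1 := by
    rcases cases x with rfl | rfl | hx
    · rcases cases y with rfl | rfl | hy
      · exact (ur (by rw [← f0, ← g0, hxy])).elim
      · exact (us (by rw [← f0, ← g1, hxy])).elim
      · exact (gi y hy (by rw [← hxy, f0, norm_circlePoint])).elim
    · rcases cases y with rfl | rfl | hy
      · exact (vr (by rw [← f1, ← g0, hxy])).elim
      · exact (vs (by rw [← f1, ← g1, hxy])).elim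
      · exact (gi y hy (by rw [← hxy, f1, norm_circlePoint])).elim
    · exact hx
  have hy : y ∈ Set.Ioo (0 : unitInterval) 1 := by
    rcases cases y with rfl | rfl | hy
    · exact (fi x hx (by rw [hxy, g0, norm_circlePoint])).elim
    · exact (fi x hx (by rw [hxy, g1, norm_circlePoint])).elim
    · exact hy
  obtain ⟨p, -, hp, hpS⟩ := hf x hx
  obtain ⟨q, -, hq, hqS⟩ := hg y hy
  obtain rfl : p = q := disc_injective (by rw [hp, hq, hxy])
  exact Set.not_disjoint_iff.2 ⟨_, hpS, hqS⟩

end AnnulusTriangulation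

namespace AnnulusTriangulation

/-! ### Deck transformations -/

/-- The deck transformation of the strip which moves everything by `τ` periods. -/
noncomputable def shiftStrip (τ : ℤ) (p : Strip) : Strip := (p.1 + τ, p.2)

theorem cover_apply (p : Strip) : cover p = ((p.1 : UnitAddCircle), p.2) := rfl

theorem cover_eq_iff {p q : Strip} : cover p = cover q ↔ ∃ τ : ℤ, q = shiftStrip τ p := by
  simp only [cover_apply, Prod.mk.injEq, shiftStrip]
  rw [eq_comm (a := (p.1 : UnitAddCircle)), QuotientAddGroup.eq, AddSubgroup.mem_zmultiples_iff]
  constructor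
  · rintro ⟨⟨k, hk⟩, h2⟩
    refine ⟨-k, Prod.ext ?_ h2.symm⟩
    simp at hk ⊢
    linarith
  · rintro ⟨τ, rfl⟩
    exact ⟨⟨-τ, by simp⟩, rfl⟩

theorem cover_shiftStrip (τ : ℤ) (p : Strip) : cover (shiftStrip τ p) = cover p :=
  (cover_eq_iff.2 ⟨τ, rfl⟩).symm

theorem continuous_shiftStrip (τ : ℤ) : Continuous (shiftStrip τ) := by
  unfold shiftStrip
  fun_prop

/-- The action of the deck transformations on vertices. -/
def shift (n m : ℕ) (τ : ℤ) : Vertex → Vertex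
  | .outer k => .outer (k + τ * n)
  | .inner k => .inner (k + τ * m)
  | .limit d => .limit d

theorem valid_shift {n m : ℕ} (τ : ℤ) {u : Vertex} (hu : Valid m u) : Valid m (shift n m τ u) := by
  cases u <;> exact hu

theorem finite_shift {n m : ℕ} {τ : ℤ} {u : Vertex} : (shift n m τ u).IsFinite ↔ u.IsFinite := by
  cases u <;> exact Iff.rfl

theorem shift_zero (n m : ℕ) (u : Vertex) : shift n m 0 u = u := by
  cases u <;> simp [shift]

theorem shift_shift (n m : ℕ) (σ τ : ℤ) (u : Vertex) :
    shift n m σ (shift n m τ u) = shift n m (τ + σ) u := by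
  cases u <;> simp [shift] <;> ring

theorem shift_eq_self {n m : ℕ} (hn : 0 < n) {τ : ℤ} {u : Vertex} (hu : Valid m u)
    (hf : u.IsFinite) (h : shift n m τ u = u) : τ = 0 := by
  rcases u with k | k | k
  · simp [shift] at h; lia
  · simp [shift] at h
    have : 0 < m := hu
    lia
  · exact hf.elim

theorem position_shift {n m : ℕ} (hn : 0 < n) (τ : ℤ) {u : Vertex} (hu : Valid m u)
    (hf : u.IsFinite) : position n m (shift n m τ u) = shiftStrip τ (position n m u) := by
  have hn' : (n : ℝ) ≠ 0 := by exact_mod_cast hn.ne'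
  rcases u with k | k | k
  · simp only [position, shift, outerPoint, shiftStrip, Prod.mk.injEq, and_true]
    push_cast
    field_simp
  · have hm' : (m : ℝ) ≠ 0 := by exact_mod_cast (show 0 < m from hu).ne'
    simp only [position, shift, innerPoint, shiftStrip, Prod.mk.injEq, and_true]
    push_cast
    field_simp
  · exact hf.elim

/-! ### Geodesics -/

/-- The null coordinates of a vertex. -/
noncomputable def nullP (n m : ℕ) (u : Vertex) : ℝ := (homog n m u).1 ^ 2
-- In coordinates (P, Q, B) with the quadratic form PQ - B², vertices are null vectors. A point (x,
-- y) of the strip is represented by (eˣ, e⁻ˣ, 2y - 1), and a deck transformation acts by scaling P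
-- and Q inversely.
noncomputable def nullQ (n m : ℕ) (u : Vertex) : ℝ := (homog n m u).2 ^ 2
noncomputable def nullB (n m : ℕ) (u : Vertex) : ℝ := -((homog n m u).1 * (homog n m u).2)

/-- The geodesic between two vertices, without its endpoints. -/
def geodesic (n m : ℕ) (u v : Vertex) : Set Strip :=
  {p | ∃ s t : ℝ, 0 < s ∧ 0 < t ∧ Real.exp p.1 = s * nullP n m u + t * nullP n m v ∧
    Real.exp (-p.1) = s * nullQ n m u + t * nullQ n m v ∧
    2 * (p.2 : ℝ) - 1 = s * nullB n m u + t * nullB n m v}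

/-- The linear form vanishing along the chord `u v` has the value `bracket u w * bracket v w` at a
vertex w. At a common point, a positive combination of its values at r and s is 0. Not crossing
excludes opposite signs, so both values vanish, and r and s are among u and v. -/
theorem geodesic_disjoint {n m : ℕ} (hn : 0 < n) {u v r s : Vertex} (hu : Valid m u)
    (hv : Valid m v) (hr : Valid m r) (hs : Valid m s) (hrs : r ≠ s)
    (hc : ¬ Crosses u v r s) (hne : ¬ (r = u ∧ s = v)) (hne' : ¬ (r = v ∧ s = u)) :
    Disjoint (geodesic n m u v) (geodesic n m r s) := by
  rw [Set.disjoint_left]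
  rintro p ⟨a, b, ha, hb, h1, h2, h3⟩ ⟨c, d, hc', hd, k1, k2, k3⟩
  rw [crosses_iff hn hu hv hr hs, not_lt] at hc
  have key : c * (bracket n m u r * bracket n m v r) + d * (bracket n m u s * bracket n m v s) = 0 := by
    have e : c * (bracket n m u r * bracket n m v r) + d * (bracket n m u s * bracket n m v s) =
        Real.exp p.1 * ((homog n m u).2 * (homog n m v).2) +
        Real.exp (-p.1) * ((homog n m u).1 * (homog n m v).1) +
        (2 * (p.2 : ℝ) - 1) * ((homog n m u).1 * (homog n m v).2 +
          (homog n m u).2 * (homog n m v).1) := by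
      rw [k1, k2, k3]
      simp only [bracket, nullP, nullQ, nullB]
      ring
    rw [e, h1, h2, h3]
    simp only [nullP, nullQ, nullB]
    ring
  set X := bracket n m u r * bracket n m v r with hX
  set Y := bracket n m u s * bracket n m v s with hY
  have hXY : 0 ≤ X * Y := by rw [hX, hY]; linarith
  have hX0 : X = 0 := by
    by_contra h0
    have : 0 < X ^ 2 := by positivity
    have e : c * X ^ 2 + d * (X * Y) = 0 := by linear_combination X * key
    linarith [mul_pos hc' this, mul_nonneg hd.le hXY]
  have hY0 : Y = 0 := by
    rw [hX0, mul_zero, zero_add] at key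
    exact (mul_eq_zero.1 key).resolve_left hd.ne'
  rw [hX, mul_eq_zero, bracket_eq_zero hn hu hr, bracket_eq_zero hn hv hr] at hX0
  rw [hY, mul_eq_zero, bracket_eq_zero hn hu hs, bracket_eq_zero hn hv hs] at hY0
  rcases hX0 with rfl | rfl <;> rcases hY0 with rfl | rfl
  · exact hrs rfl
  · exact hne ⟨rfl, rfl⟩
  · exact hne' ⟨rfl, rfl⟩
  · exact hrs rfl

/-- Deck transformations act linearly on null coordinates, so they map geodesics to geodesics. The
factor c is needed because limit points are fixed only up to scale. -/
theorem null_shift {n m : ℕ} (hn : 0 < n) (τ : ℤ) {u : Vertex} (hu : Valid m u) :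
    ∃ c : ℝ, 0 < c ∧ Real.exp τ * nullP n m u = c * nullP n m (shift n m τ u) ∧
      Real.exp (-τ) * nullQ n m u = c * nullQ n m (shift n m τ u) ∧
      nullB n m u = c * nullB n m (shift n m τ u) := by
  have hn' : (n : ℝ) ≠ 0 := by exact_mod_cast hn.ne'
  have e : ∀ x : ℝ, Real.exp x = Real.exp (x / 2) ^ 2 := fun x => by
    rw [← Real.exp_nat_mul]; congr 1; push_cast; ring
  have e' : Real.exp ((τ : ℝ) / 2) * Real.exp (-((τ : ℝ) / 2)) = 1 := by
    rw [← Real.exp_add]; simp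
  have e1 := e τ
  have e2 := e (-τ)
  rw [neg_div] at e2
  rcases u with k | k | (_ | _)
  · have h1 : (((k + τ * n : ℤ) : ℝ)) / n / 2 = (k : ℝ) / n / 2 + τ / 2 := by
      push_cast; field_simp
    refine ⟨1, one_pos, ?_, ?_, ?_⟩ <;>
      simp only [nullP, nullQ, nullB, homog, shift, h1, neg_add, Real.exp_add, e1, e2]
    · ring
    · ring
    · linear_combination
        Real.exp ((k : ℝ) / n / 2) * Real.exp (-((k : ℝ) / n / 2)) * e'
  · have hm' : (m : ℝ) ≠ 0 := by exact_mod_cast (show 0 < m from hu).ne'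
    have h1 : (((k + τ * m : ℤ) : ℝ)) / m / 2 = (k : ℝ) / m / 2 + τ / 2 := by
      push_cast; field_simp
    refine ⟨1, one_pos, ?_, ?_, ?_⟩ <;>
      simp only [nullP, nullQ, nullB, homog, shift, h1, neg_add, Real.exp_add, e1, e2]
    · ring
    · ring
    · linear_combination
        -Real.exp ((k : ℝ) / m / 2) * Real.exp (-((k : ℝ) / m / 2)) * e'
  · exact ⟨Real.exp τ, Real.exp_pos _, by simp [nullP, homog, shift],
      by simp [nullQ, homog, shift], by simp [nullB, homog, shift]⟩
  · exact ⟨Real.exp (-τ), Real.exp_pos _, by simp [nullP, homog, shift],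
      by simp [nullQ, homog, shift], by simp [nullB, homog, shift]⟩

theorem shiftStrip_mem_geodesic {n m : ℕ} (hn : 0 < n) (τ : ℤ) {u v : Vertex} (hu : Valid m u)
    (hv : Valid m v) {p : Strip} (hp : p ∈ geodesic n m u v) :
    shiftStrip τ p ∈ geodesic n m (shift n m τ u) (shift n m τ v) := by
  obtain ⟨s, t, hs, ht, h1, h2, h3⟩ := hp
  obtain ⟨c, hc, c1, c2, c3⟩ := null_shift hn τ hu
  obtain ⟨d, hd, d1, d2, d3⟩ := null_shift hn τ hv
  refine ⟨s * c, t * d, by positivity, by positivity, ?_, ?_, ?_⟩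
  · simp only [shiftStrip, Real.exp_add, h1]
    linear_combination s * c1 + t * d1
  · simp only [shiftStrip, neg_add, Real.exp_add, h2]
    linear_combination s * c2 + t * d2
  · simp only [shiftStrip, h3]
    linear_combination s * c3 + t * d3

/-- The point of the strip with the given null coordinates. -/
noncomputable def ofNull (P Q B : ℝ) : Strip :=
  (Real.log (P / Q) / 2, Set.projIcc 0 1 zero_le_one ((1 + B / √(P * Q)) / 2))

/-- Dividing by √(PQ) makes the product of the first two coordinates 1; by `hB`, the clamping in
`ofNull` has no effect. -/
theorem ofNull_spec {P Q B : ℝ} (hP : 0 < P) (hQ : 0 < Q) (hB : B ^ 2 ≤ P * Q) :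
    Real.exp (ofNull P Q B).1 = (√(P * Q))⁻¹ * P ∧
    Real.exp (-(ofNull P Q B).1) = (√(P * Q))⁻¹ * Q ∧
    2 * ((ofNull P Q B).2 : ℝ) - 1 = (√(P * Q))⁻¹ * B := by
  have hR : 0 < √(P * Q) := Real.sqrt_pos.2 (by positivity)
  have hR2 : √(P * Q) ^ 2 = P * Q := Real.sq_sqrt (by positivity)
  have e1 : Real.exp (ofNull P Q B).1 = (√(P * Q))⁻¹ * P := by
    rw [← sq_eq_sq₀ (Real.exp_pos _).le (by positivity), ← Real.exp_nat_mul, mul_pow, inv_pow, hR2]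
    simp only [ofNull]
    rw [show ((2 : ℕ) : ℝ) * (Real.log (P / Q) / 2) = Real.log (P / Q) by push_cast; ring,
      Real.exp_log (by positivity)]
    field_simp
  refine ⟨e1, ?_, ?_⟩
  · rw [Real.exp_neg, e1]
    field_simp
    linarith
  · have hb : |B / √(P * Q)| ≤ 1 := by
      rw [abs_div, abs_of_pos hR, div_le_one hR]
      exact Real.abs_le_sqrt hB
    rw [abs_le] at hb
    simp only [ofNull]
    rw [Set.projIcc_of_mem zero_le_one ⟨by linarith, by linarith⟩]
    simp only
    ring

theorem continuous_ofNull {X : Type*} [TopologicalSpace X] {P Q B : X → ℝ} (hP : Continuous P)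
    (hQ : Continuous Q) (hB : Continuous B) (hP0 : ∀ x, 0 < P x) (hQ0 : ∀ x, 0 < Q x) :
    Continuous fun x => ofNull (P x) (Q x) (B x) := by
  unfold ofNull
  refine Continuous.prodMk ?_ (continuous_projIcc.comp ?_)
  · exact (Continuous.log (hP.div hQ fun x => (hQ0 x).ne')
      fun x => (div_pos (hP0 x) (hQ0 x)).ne').div_const 2
  · refine (continuous_const.add (hB.div (hP.mul hQ).sqrt fun x => ?_)).div_const 2
    exact (Real.sqrt_pos.2 (mul_pos (hP0 x) (hQ0 x))).ne'

/-- The difference of the two sides is `s * t * bracket ^ 2`, so a geodesic runs inside the null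
cone, that is, at heights strictly between 0 and 1. -/
theorem null_sq_lt {n m : ℕ} {u v : Vertex} (h : bracket n m u v ≠ 0) {s t : ℝ} (hs : 0 < s)
    (ht : 0 < t) : (s * nullB n m u + t * nullB n m v) ^ 2 <
      (s * nullP n m u + t * nullP n m v) * (s * nullQ n m u + t * nullQ n m v) := by
  have : 0 < s * t * bracket n m u v ^ 2 := by positivity
  simp only [bracket, nullP, nullQ, nullB] at *
  linarith

theorem null_sq_le {n m : ℕ} {u v : Vertex} {s t : ℝ} (hs : 0 ≤ s)
    (ht : 0 ≤ t) : (s * nullB n m u + t * nullB n m v) ^ 2 ≤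
      (s * nullP n m u + t * nullP n m v) * (s * nullQ n m u + t * nullQ n m v) := by
  have : 0 ≤ s * t * bracket n m u v ^ 2 := by positivity
  simp only [bracket, nullP, nullQ, nullB] at *
  linarith

theorem ofNull_mem_geodesic {n m : ℕ} {u v : Vertex} {s t : ℝ} (hs : 0 < s) (ht : 0 < t)
    (hP : 0 < s * nullP n m u + t * nullP n m v) (hQ : 0 < s * nullQ n m u + t * nullQ n m v) :
    ofNull (s * nullP n m u + t * nullP n m v) (s * nullQ n m u + t * nullQ n m v)
      (s * nullB n m u + t * nullB n m v) ∈ geodesic n m u v := by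
  obtain ⟨h1, h2, h3⟩ := ofNull_spec hP hQ (null_sq_le (n := n) (m := m) (u := u) (v := v) hs.le ht.le)
  have hR := inv_pos.2 (Real.sqrt_pos.2 (mul_pos hP hQ))
  set R := (√((s * nullP n m u + t * nullP n m v) * (s * nullQ n m u + t * nullQ n m v)))⁻¹
  refine ⟨R * s, R * t, by positivity, by positivity, ?_, ?_, ?_⟩
  · rw [h1]; ring
  · rw [h2]; ring
  · rw [h3]; ring

theorem mem_Ioo_of_geodesic {n m : ℕ} {u v : Vertex} (h : bracket n m u v ≠ 0) {p : Strip}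
    (hp : p ∈ geodesic n m u v) : p.2 ∈ Set.Ioo (0 : unitInterval) 1 := by
  obtain ⟨s, t, hs, ht, h1, h2, h3⟩ := hp
  have := null_sq_lt h hs ht
  rw [← h1, ← h2, ← h3, ← Real.exp_add] at this
  simp at this
  rw [abs_lt] at this
  exact ⟨show (0 : ℝ) < p.2 by linarith, show (p.2 : ℝ) < 1 by linarith⟩

/-- Points of a geodesic with the same image are given by proportional coefficients. -/
theorem ofNull_injective {n m : ℕ} {u v : Vertex} (h : bracket n m u v ≠ 0) {s t s' t' : ℝ}
    (hs : 0 ≤ s) (ht : 0 ≤ t) (hs' : 0 ≤ s') (ht' : 0 ≤ t')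
    (hP : 0 < s * nullP n m u + t * nullP n m v) (hQ : 0 < s * nullQ n m u + t * nullQ n m v)
    (hP' : 0 < s' * nullP n m u + t' * nullP n m v) (hQ' : 0 < s' * nullQ n m u + t' * nullQ n m v)
    (heq : ofNull (s * nullP n m u + t * nullP n m v) (s * nullQ n m u + t * nullQ n m v)
      (s * nullB n m u + t * nullB n m v) =
      ofNull (s' * nullP n m u + t' * nullP n m v) (s' * nullQ n m u + t' * nullQ n m v)
      (s' * nullB n m u + t' * nullB n m v)) : ∃ c : ℝ, s' = c * s ∧ t' = c * t := by
  obtain ⟨h1, h2, h3⟩ := ofNull_spec hP hQ (null_sq_le hs ht)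
  obtain ⟨k1, k2, k3⟩ := ofNull_spec hP' hQ' (null_sq_le hs' ht')
  have hR := inv_pos.2 (Real.sqrt_pos.2 (mul_pos hP hQ))
  have hR' := inv_pos.2 (Real.sqrt_pos.2 (mul_pos hP' hQ'))
  rw [← heq] at k1 k2 k3
  rw [h1] at k1
  rw [h2] at k2
  rw [h3] at k3
  set R := (√((s * nullP n m u + t * nullP n m v) * (s * nullQ n m u + t * nullQ n m v)))⁻¹
  set R' := (√((s' * nullP n m u + t' * nullP n m v) * (s' * nullQ n m u + t' * nullQ n m v)))⁻¹
  have hb : bracket n m u v ^ 2 ≠ 0 := pow_ne_zero 2 h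
  -- Pairing with the null vector of u kills the contribution of u and isolates the coefficient of
  -- v; `e2` is the reverse.
  have e1 : (R * t) * bracket n m u v ^ 2 = (R' * t') * bracket n m u v ^ 2 := by
    simp only [bracket, nullP, nullQ, nullB] at *
    linear_combination (homog n m u).2 ^ 2 * k1 + (homog n m u).1 ^ 2 * k2 +
      2 * (homog n m u).1 * (homog n m u).2 * k3
  have e2 : (R * s) * bracket n m u v ^ 2 = (R' * s') * bracket n m u v ^ 2 := by
    simp only [bracket, nullP, nullQ, nullB] at *
    linear_combination (homog n m v).2 ^ 2 * k1 + (homog n m v).1 ^ 2 * k2 +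
      2 * (homog n m v).1 * (homog n m v).2 * k3
  have e1 := mul_right_cancel₀ hb e1
  have e2 := mul_right_cancel₀ hb e2
  refine ⟨R / R', ?_, ?_⟩ <;> field_simp <;> linarith

end AnnulusTriangulation

namespace AnnulusTriangulation

open Filter Topology unitInterval

/-! ### Lifting curves to the strip -/

theorem exists_lift (γ : C(I, Annulus)) {p : Strip} (hp : γ 0 = cover p) :
    ∃ c : C(I, Strip), cover.comp c = γ ∧ c 0 = p := by
  have cov := AddCircle.isCoveringMap_coe (1 : ℝ)
  obtain ⟨l, hl, h0⟩ := cov.exists_path_lifts ⟨fun t => (γ t).1, by fun_prop⟩ p.1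
    (by simp [hp, cover_apply])
  refine ⟨⟨fun t => (l t, (γ t).2), by fun_prop⟩, ?_, ?_⟩
  · ext1 t
    exact Prod.ext (congrFun hl t) rfl
  · exact Prod.ext h0 (by simp [hp, cover_apply])

theorem lift_endpoint {c c' : C(I, Strip)} (h0 : c 0 = c' 0)
    (h : (cover.comp c).HomotopicRel (cover.comp c') {0, 1}) : c 1 = c' 1 := by
  have cov := AddCircle.isCoveringMap_coe (1 : ℝ)
  have h1 : (cover.comp c) 1 = (cover.comp c') 1 := by
    obtain ⟨H⟩ := h
    exact H.fst_eq_snd (by simp)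
  let π : C(Strip, ℝ) := ⟨Prod.fst, continuous_fst⟩
  let π' : C(Annulus, UnitAddCircle) := ⟨Prod.fst, continuous_fst⟩
  have h2 : (π.comp c).HomotopicRel (π.comp c') {0, 1} := by
    rw [cov.homotopicRel_iff_comp ⟨0, by simp, by simp [π, h0]⟩]
    exact h.comp_continuousMap π'
  obtain ⟨H⟩ := h2
  exact Prod.ext (H.fst_eq_snd (x := 1) (by simp)) (congrArg Prod.snd h1 :)

/-- The point that divides the segment from `p` to `q` in the ratio `s : 1 - s`. -/
noncomputable def mix (s : I) (p q : Strip) : Strip :=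
  ((1 - (s : ℝ)) * p.1 + s * q.1,
    ⟨(1 - (s : ℝ)) * p.2 + s * q.2, by
      have := s.2.1; have := s.2.2; have := p.2.2.1; have := p.2.2.2
      have := q.2.2.1; have := q.2.2.2
      constructor <;> nlinarith⟩)

theorem continuous_mix : Continuous fun z : I × Strip × Strip => mix z.1 z.2.1 z.2.2 := by
  unfold mix
  fun_prop

theorem mix_zero (p q : Strip) : mix 0 p q = p := by
  simp [mix]

theorem mix_one (p q : Strip) : mix 1 p q = q := by
  simp [mix]

theorem mix_self (s : I) (p : Strip) : mix s p p = p :=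
  Prod.ext (by simp [mix]; ring) (Subtype.ext (by simp [mix]; ring))

/-- The strip is convex, so lifts with equal endpoints are joined by a straight-line homotopy.
Homotopy classes are thus governed by endpoints of lifts. -/
theorem homotopicRel_of_lift {c c' : C(I, Strip)} (h0 : c 0 = c' 0) (h1 : c 1 = c' 1) :
    (cover.comp c).HomotopicRel (cover.comp c') {0, 1} := by
  refine ⟨⟨⟨⟨fun z => cover (mix z.1 (c z.2) (c' z.2)), ?_⟩, fun t => ?_, fun t => ?_⟩,
    fun s t ht => ?_⟩⟩
  · exact cover.continuous.comp (continuous_mix.comp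
      (continuous_fst.prodMk ((c.continuous.comp continuous_snd).prodMk
        (c'.continuous.comp continuous_snd))))
  · simp [mix_zero]
  · simp [mix_one]
  · rcases ht with rfl | rfl
    · simp [h0, mix_self]
    · simp [h1, mix_self]

/-- The reversed lift. -/
def reverseLift (c : C(I, Strip)) : C(I, Strip) := ⟨fun t => c (σ t), by fun_prop⟩

theorem reverse_cover (c : C(I, Strip)) : reverse (cover.comp c) = cover.comp (reverseLift c) := rfl

theorem reverseLift_zero (c : C(I, Strip)) : reverseLift c 0 = c 1 := by simp [reverseLift]

theorem reverseLift_one (c : C(I, Strip)) : reverseLift c 1 = c 0 := by simp [reverseLift]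

/-- The lift moved by a deck transformation. -/
noncomputable def shiftLift (τ : ℤ) {X : Type*} [TopologicalSpace X] (c : C(X, Strip)) :
    C(X, Strip) :=
  ⟨fun t => shiftStrip τ (c t), (continuous_shiftStrip τ).comp c.continuous⟩

theorem cover_shiftLift (τ : ℤ) {X : Type*} [TopologicalSpace X] (c : C(X, Strip)) :
    cover.comp (shiftLift τ c) = cover.comp c := by
  ext1 t
  exact cover_shiftStrip τ (c t)

theorem lift_ends_of_homotopicRel {c c' : C(I, Strip)}
    (h : (cover.comp c).HomotopicRel (cover.comp c') {0, 1}) :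
    ∃ τ : ℤ, c' 0 = shiftStrip τ (c 0) ∧ c' 1 = shiftStrip τ (c 1) := by
  have h0 : cover (c 0) = cover (c' 0) := by
    obtain ⟨H⟩ := id h
    exact H.fst_eq_snd (x := 0) (by simp)
  obtain ⟨τ, hτ⟩ := cover_eq_iff.1 h0
  rw [← cover_shiftLift τ c] at h
  exact ⟨τ, hτ, (lift_endpoint (c := shiftLift τ c) hτ.symm h).symm⟩

theorem lift_ends_of_sameClass {c c' : C(I, Strip)} (h : SameClass (cover.comp c) (cover.comp c')) :
    ∃ τ : ℤ, (c' 0 = shiftStrip τ (c 0) ∧ c' 1 = shiftStrip τ (c 1)) ∨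
      (c' 0 = shiftStrip τ (c 1) ∧ c' 1 = shiftStrip τ (c 0)) := by
  rcases h with h | h
  · obtain ⟨τ, h⟩ := lift_ends_of_homotopicRel h
    exact ⟨τ, Or.inl h⟩
  · rw [reverse_cover] at h
    obtain ⟨τ, h⟩ := lift_ends_of_homotopicRel h
    rw [reverseLift_zero, reverseLift_one] at h
    exact ⟨τ, Or.inr h⟩

/-! ### Vertices and marked points -/

theorem isMarked_position {n m : ℕ} (hn : 0 < n) {u : Vertex} (hu : u.IsFinite) (hv : Valid m u) :
    IsMarked n m (cover (position n m u)) := by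
  rcases u with k | k | k
  · exact Or.inl ⟨hn, k, rfl⟩
  · exact Or.inr ⟨hv, k, rfl⟩
  · exact hu.elim

theorem exists_position_of_isMarked {n m : ℕ} {p : Annulus} (h : IsMarked n m p) :
    ∃ u : Vertex, u.IsFinite ∧ Valid m u ∧ p = cover (position n m u) := by
  rcases h with ⟨_, k, rfl⟩ | ⟨hm, k, rfl⟩
  · exact ⟨.outer k, trivial, trivial, rfl⟩
  · exact ⟨.inner k, trivial, hm, rfl⟩

theorem position_injective {n m : ℕ} (hn : 0 < n) {u v : Vertex} (hu : u.IsFinite)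
    (hv : v.IsFinite) (hu' : Valid m u) (h : position n m u = position n m v) :
    u = v := by
  have hn' : (n : ℝ) ≠ 0 := by exact_mod_cast hn.ne'
  rcases u with k | k | k <;> rcases v with l | l | l <;>
    first
    | exact hu.elim
    | exact hv.elim
    | skip
  · have := congrArg Prod.fst h
    simp only [position, outerPoint] at this
    field_simp at this
    rw [Vertex.outer.injEq]
    exact_mod_cast this
  · simpa [position, outerPoint, innerPoint] using congrArg Prod.snd h
  · simpa [position, outerPoint, innerPoint] using congrArg Prod.snd h
  · have hm' : (m : ℝ) ≠ 0 := by exact_mod_cast (show 0 < m from hu').ne'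
    have := congrArg Prod.fst h
    simp only [position, innerPoint] at this
    field_simp at this
    rw [Vertex.inner.injEq]
    exact_mod_cast this

/-! ### Lifts of arcs -/

/-- The arc has a lift from `u` to `v`. -/
def HasLift {n m : ℕ} : Arc n m → Vertex → Vertex → Prop
  | .finite α, u, v => u.IsFinite ∧ v.IsFinite ∧ Valid m u ∧ Valid m v ∧
      ∃ (c : C(I, Strip)) (h : IsArcCurve n m (cover.comp c)),
        c 0 = position n m u ∧ c 1 = position n m v ∧
          Quotient.mk (finiteArcSetoid n m) ⟨cover.comp c, h⟩ = α
  | .asymptotic d α, u, v => u.IsFinite ∧ Valid m u ∧ v = .limit d ∧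
      ∃ (ρ : C(NNReal, Strip)) (h : IsAsymptoticCurve n m d (cover.comp ρ)),
        ρ 0 = position n m u ∧ Quotient.mk (asymptoticArcSetoid n m d) ⟨cover.comp ρ, h⟩ = α

variable {n m : ℕ}

theorem HasLift.valid_left {α : Arc n m} {u v : Vertex} (h : HasLift α u v) : Valid m u := by
  cases α with
  | finite α => exact h.2.2.1
  | asymptotic d α => exact h.2.1

theorem HasLift.valid_right {α : Arc n m} {u v : Vertex} (h : HasLift α u v) : Valid m v := by
  cases α with
  | finite α => exact h.2.2.2.1
  | asymptotic d α => rw [h.2.2.1]; trivial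

theorem HasLift.finite_left {α : Arc n m} {u v : Vertex} (h : HasLift α u v) : u.IsFinite := by
  cases α with
  | finite α => exact h.1
  | asymptotic d α => exact h.1

theorem exists_hasLift (hn : 0 < n) (α : Arc n m) : ∃ u v, HasLift α u v := by
  rcases α with α | ⟨d, α⟩
  · obtain ⟨⟨γ, h⟩, rfl⟩ := Quotient.exists_rep α
    obtain ⟨u, hu, hu', h0⟩ := exists_position_of_isMarked h.marked_zero
    obtain ⟨w, hw, hw', h1⟩ := exists_position_of_isMarked h.marked_one
    obtain ⟨c, rfl, hc⟩ := exists_lift γ h0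
    have h1' : cover (position n m w) = cover (c 1) := h1.symm
    obtain ⟨τ, hτ⟩ := cover_eq_iff.1 h1'
    exact ⟨u, shift n m τ w, hu, finite_shift.2 hw, hu', valid_shift τ hw', c, h, hc,
      by rw [position_shift hn τ hw' hw, hτ], rfl⟩
  · obtain ⟨⟨γ, h⟩, rfl⟩ := Quotient.exists_rep α
    obtain ⟨u, hu, hu', h0⟩ := exists_position_of_isMarked h.marked_zero
    obtain ⟨ρ, rfl, hρ⟩ := id h.spirals
    have h0' : cover (position n m u) = cover (ρ 0) := h0.symm
    obtain ⟨τ, hτ⟩ := cover_eq_iff.1 h0'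
    exact ⟨shift n m τ u, _, finite_shift.2 hu, valid_shift τ hu', rfl, ρ, h,
      by rw [position_shift hn τ hu' hu, hτ], rfl⟩

theorem HasLift.symm {α : FiniteArc n m} {u v : Vertex} (h : HasLift (.finite α) u v) :
    HasLift (.finite α) v u := by
  obtain ⟨hu, hv, hu', hv', c, hc, h0, h1, rfl⟩ := h
  have hs : ∀ t ∈ Set.Ioo (0 : I) 1, σ t ∈ Set.Ioo (0 : I) 1 := fun t ht =>
    ⟨by simpa using strictAnti_symm ht.2, by simpa using strictAnti_symm ht.1⟩
  have hsame : ∀ δ, SameClass (reverse (cover.comp c)) δ ↔ SameClass (cover.comp c) δ := fun δ => by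
    have e : SameClass (reverse (cover.comp c)) (cover.comp c) := Or.inr (by
      rw [reverse_reverse]; exact .refl _)
    exact ⟨fun h => sameClass_equivalence.trans (sameClass_equivalence.symm e) h,
      fun h => sameClass_equivalence.trans e h⟩
  have hr : IsArcCurve n m (cover.comp (reverseLift c)) := by
    rw [← reverse_cover]
    refine ⟨by simpa [reverse] using hc.marked_one, by simpa [reverse] using hc.marked_zero,
      fun t ht => hc.interior _ (hs t ht), fun s h1 t h2 h => ?_, fun h => ?_,
      fun k hk h => hc.not_outerSegment k hk ((hsame _).1 h),
      fun k hk h => hc.not_innerSegment k hk ((hsame _).1 h)⟩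
    · exact symm_bijective.injective (hc.simple (hs s h1) (hs t h2) h)
    · apply hc.not_contractible
      have h2 := reverse_homotopicRel h
      rw [reverse_reverse] at h2
      obtain ⟨H⟩ := id h2
      have e : (cover.comp c) 0 = (cover.comp c) 1 := by
        have := H.fst_eq_snd (x := 0) (by simp)
        simpa [reverse] using this
      have h3 : reverse (ContinuousMap.const I ((reverse (cover.comp c)) 0)) =
          ContinuousMap.const I ((cover.comp c) 1) := by
        ext1
        simp [reverse]
      rwa [e, ← h3]
  refine ⟨hv, hu, hv', hu', reverseLift c, hr, by rw [reverseLift_zero, h1],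
    by rw [reverseLift_one, h0], Quotient.sound (s := finiteArcSetoid n m) ?_⟩
  exact (hsame _).2 (sameClass_equivalence.refl _)

theorem asymptotic_start {d : Direction} {γ δ : C(NNReal, Annulus)}
    (h : γ.HomotopicWith δ (fun h => h 0 = γ 0 ∧ Spirals d h)) : δ 0 = γ 0 := by
  obtain ⟨H⟩ := h
  have := (H.prop 1).1
  rwa [ContinuousMap.Homotopy.curry_one] at this

/-- Lifts of the same arc differ by a deck transformation, up to orientation. -/
theorem HasLift.eq_shift (hn : 0 < n) {α : Arc n m} {u v u' v' : Vertex} (h : HasLift α u v)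
    (h' : HasLift α u' v') : ∃ τ : ℤ, (u' = shift n m τ u ∧ v' = shift n m τ v) ∨
      (u' = shift n m τ v ∧ v' = shift n m τ u) := by
  have pos_eq : ∀ {τ : ℤ} {a b : Vertex}, a.IsFinite → b.IsFinite → Valid m a → Valid m b →
      position n m a = shiftStrip τ (position n m b) → a = shift n m τ b := by
    intro τ a b ha hb ha' hb' h
    rw [← position_shift hn τ hb' hb] at h
    exact position_injective hn ha (finite_shift.2 hb) ha' h
  cases α with
  | finite α =>
    obtain ⟨hu, hv, hu', hv', c, hc, h0, h1, rfl⟩ := h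
    obtain ⟨ku, kv, ku', kv', e, he, k0, k1, k⟩ := h'
    have hs : SameClass (cover.comp c) (cover.comp e) := Quotient.exact k.symm
    obtain ⟨τ, h⟩ := lift_ends_of_sameClass hs
    rw [h0, h1, k0, k1] at h
    exact ⟨τ, h.imp (fun h => ⟨pos_eq ku hu ku' hu' h.1, pos_eq kv hv kv' hv' h.2⟩)
      (fun h => ⟨pos_eq ku hv ku' hv' h.1, pos_eq kv hu kv' hu' h.2⟩)⟩
  | asymptotic d α =>
    obtain ⟨hu, hu', rfl, ρ, hρ, h0, rfl⟩ := h
    obtain ⟨ku, ku', rfl, e, he, k0, k⟩ := h'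
    have hs := asymptotic_start (Quotient.exact k)
    have hs' : cover (position n m u) = cover (position n m u') := by
      rw [← h0, ← k0]; exact hs
    obtain ⟨τ, hτ⟩ := cover_eq_iff.1 hs'
    exact ⟨τ, Or.inl ⟨pos_eq ku hu ku' hu' hτ, rfl⟩⟩

theorem HasLift.shift (hn : 0 < n) {α : Arc n m} {u v : Vertex} (h : HasLift α u v) (τ : ℤ) :
    HasLift α (shift n m τ u) (shift n m τ v) := by
  cases α with
  | finite α =>
    obtain ⟨hu, hv, hu', hv', c, hc, h0, h1, rfl⟩ := h
    have e := cover_shiftLift τ c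
    refine ⟨finite_shift.2 hu, finite_shift.2 hv, valid_shift τ hu', valid_shift τ hv',
      shiftLift τ c, by rwa [e], ?_, ?_, ?_⟩
    · rw [position_shift hn τ hu' hu, ← h0]; rfl
    · rw [position_shift hn τ hv' hv, ← h1]; rfl
    · simp only [e]
  | asymptotic d α =>
    obtain ⟨hu, hu', rfl, ρ, hρ, h0, rfl⟩ := h
    have e := cover_shiftLift τ ρ
    refine ⟨finite_shift.2 hu, valid_shift τ hu', rfl, shiftLift τ ρ, by rwa [e], ?_, ?_⟩
    · rw [position_shift hn τ hu' hu, ← h0]; rfl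
    · simp only [e]

/-- Spiralling in a given direction is a convex condition on lifts, so straight-line homotopies stay
among spirals. -/
theorem stripSpirals_mix {d : Direction} {ρ ρ' : C(NNReal, Strip)} (s : I) (h : StripSpirals d ρ)
    (h' : StripSpirals d ρ') :
    StripSpirals d ⟨fun t => mix s (ρ t) (ρ' t), continuous_mix.comp
      (continuous_const.prodMk (ρ.continuous.prodMk ρ'.continuous))⟩ := by
  have s0 := s.2.1
  have s1 := s.2.2
  constructor
  · cases d with
    | right =>
      refine tendsto_atTop.2 fun B => ?_
      filter_upwards [h.1.eventually (eventually_ge_atTop B),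
        h'.1.eventually (eventually_ge_atTop B)] with t h1 h2
      simp only [ContinuousMap.coe_mk, mix]
      nlinarith
    | left =>
      refine tendsto_atBot.2 fun B => ?_
      filter_upwards [h.1.eventually (eventually_le_atBot B),
        h'.1.eventually (eventually_le_atBot B)] with t h1 h2
      simp only [ContinuousMap.coe_mk, mix]
      nlinarith
  · have h1 := tendsto_subtype_rng.1 h.2
    have h2 := tendsto_subtype_rng.1 h'.2
    refine tendsto_subtype_rng.2 ?_
    simp only [ContinuousMap.coe_mk, mix]
    have h3 := (h1.const_mul (1 - (s : ℝ))).add (h2.const_mul (s : ℝ))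
    rwa [show (1 - (s : ℝ)) * (meridian : ℝ) + s * (meridian : ℝ) = meridian by ring] at h3

/-- Lifts of one curve differ by a deck transformation, which moves the first coordinate by a
constant only. -/
theorem stripSpirals_of_cover {d : Direction} {ρ ρ' : C(NNReal, Strip)}
    (h : cover.comp ρ = cover.comp ρ') (hρ : StripSpirals d ρ) : StripSpirals d ρ' := by
  have cov := AddCircle.isCoveringMap_coe (1 : ℝ)
  have h0 : cover (ρ 0) = cover (ρ' 0) := DFunLike.congr_fun h 0
  obtain ⟨τ, hτ⟩ := cover_eq_iff.1 h0
  have e : ρ' = shiftLift τ ρ := by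
    have h1 : (fun t => (ρ' t).1) = fun t => (shiftLift τ ρ t).1 :=
      cov.eq_of_comp_eq (by fun_prop) (by fun_prop) (by
        ext t
        have := congrArg Prod.fst (DFunLike.congr_fun ((cover_shiftLift τ ρ).trans h) t)
        exact this.symm) 0 (congrArg Prod.fst hτ)
    ext1 t
    refine Prod.ext (congrFun h1 t) ?_
    exact (congrArg Prod.snd (DFunLike.congr_fun h t)).symm
  subst e
  refine ⟨?_, hρ.2⟩
  simp only [shiftLift, shiftStrip, ContinuousMap.coe_mk]
  cases d with
  | right => exact tendsto_atTop_add_const_right _ _ hρ.1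
  | left => exact tendsto_atBot_add_const_right _ _ hρ.1

/-- An arc is determined by the endpoints of a lift. -/
theorem HasLift.unique {α β : Arc n m} {u v : Vertex} (h : HasLift α u v) (h' : HasLift β u v) :
    α = β := by
  cases α with
  | finite α =>
    cases β with
    | finite β =>
      obtain ⟨hu, hv, hu', hv', c, hc, h0, h1, rfl⟩ := h
      obtain ⟨ku, kv, ku', kv', e, he, k0, k1, rfl⟩ := h'
      refine congrArg Arc.finite (Quotient.sound (s := finiteArcSetoid n m) (Or.inl ?_))
      exact homotopicRel_of_lift (h0.trans k0.symm) (h1.trans k1.symm)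
    | asymptotic d β =>
      have h1 := h.2.1
      rw [h'.2.2.1] at h1
      exact h1.elim
  | asymptotic d α =>
    cases β with
    | finite β =>
      have h1 := h'.2.1
      rw [h.2.2.1] at h1
      exact h1.elim
    | asymptotic d' β =>
      obtain ⟨hu, hu', rfl, ρ, hρ, h0, rfl⟩ := h
      obtain ⟨ku, ku', hd, e, he, k0, rfl⟩ := h'
      injection hd with hd
      subst hd
      have s1 : StripSpirals d ρ := by
        obtain ⟨ρ₁, h1, h2⟩ := hρ.spirals
        exact stripSpirals_of_cover h1 h2
      have s2 : StripSpirals d e := by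
        obtain ⟨ρ₁, h1, h2⟩ := he.spirals
        exact stripSpirals_of_cover h1 h2
      refine congrArg (Arc.asymptotic d) (Quotient.sound (s := asymptoticArcSetoid n m d) ?_)
      refine ⟨⟨⟨⟨fun z => cover (mix z.1 (ρ z.2) (e z.2)), ?_⟩, fun t => ?_, fun t => ?_⟩,
        fun s => ⟨?_, ?_⟩⟩⟩
      · exact cover.continuous.comp (continuous_mix.comp
          (continuous_fst.prodMk ((ρ.continuous.comp continuous_snd).prodMk
            (e.continuous.comp continuous_snd))))
      · simp [mix_zero]
      · simp [mix_one]
      · simp [h0, k0, mix_self]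
      · exact ⟨_, rfl, stripSpirals_mix s s1 s2⟩

end AnnulusTriangulation

namespace AnnulusTriangulation

open Filter Topology unitInterval

variable {n m : ℕ}

/-! ### Traces of arcs connect the endpoints of lifts -/

theorem connects_of_lift {u v : Vertex} (hu : u.IsFinite) (hv : v.IsFinite) {c : C(I, Strip)}
    (hc : IsArcCurve n m (cover.comp c)) (h0 : c 0 = position n m u) (h1 : c 1 = position n m v) :
    Connects n m (cover.comp c '' Set.Ioo 0 1) u v := by
  refine ⟨⟨fun t => disc (c t), continuous_disc.comp c.continuous⟩, ?_, ?_, fun t ht =>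
    ⟨c t, hc.interior t ht, rfl, Set.mem_image_of_mem _ ht⟩⟩
  · simp only [ContinuousMap.coe_mk, h0, disc_position n m hu]
  · simp only [ContinuousMap.coe_mk, h1, disc_position n m hv]

theorem norm_sub_ofReal_le (p : Strip) {x e : ℝ}
    (h : (disc p).re - e = x / (Real.exp p.1 + Real.exp (-p.1))) {B : ℝ}
    (hB : |x| + 2 ≤ B * (Real.exp p.1 + Real.exp (-p.1))) : ‖disc p - (e : ℂ)‖ ≤ B := by
  have hpos : 0 < Real.exp p.1 + Real.exp (-p.1) := by positivity
  have hy : |2 * (2 * (p.2 : ℝ) - 1)| ≤ 2 := by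
    have := p.2.2.1
    have := p.2.2.2
    rw [abs_le]
    constructor <;> linarith
  refine (Complex.norm_le_abs_re_add_abs_im _).trans ?_
  rw [Complex.sub_re, Complex.sub_im, Complex.ofReal_re, Complex.ofReal_im, h, sub_zero, disc_im,
    abs_div, abs_div, abs_of_pos hpos, ← add_div, div_le_iff₀ hpos]
  linarith

/-- In the disc the ends of the strip become the points ±1, so a spiral acquires a second endpoint.
-/
theorem tendsto_disc {d : Direction} {ρ : C(NNReal, Strip)} (h : StripSpirals d ρ) :
    Tendsto (fun t => disc (ρ t)) atTop (𝓝 (circlePoint n m (.limit d))) := by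
  have h1 := h.1
  cases d with
  | right =>
    have e : circlePoint n m (.limit .right) = ((1 : ℝ) : ℂ) := by simp [circlePoint, homog]
    rw [e, tendsto_iff_norm_sub_tendsto_zero]
    have h2 : Tendsto (fun t => 4 * Real.exp (-(ρ t).1)) atTop (𝓝 0) := by
      simpa using (Real.tendsto_exp_neg_atTop_nhds_zero.comp h1).const_mul 4
    refine squeeze_zero (fun _ => norm_nonneg _) (fun t => ?_) h2
    have p1 := Real.exp_pos (ρ t).1
    have p2 := Real.exp_pos (-(ρ t).1)
    have p3 : Real.exp (ρ t).1 * Real.exp (-(ρ t).1) = 1 := by rw [← Real.exp_add]; simp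
    refine norm_sub_ofReal_le (ρ t) (x := -(2 * Real.exp (-(ρ t).1))) ?_ ?_
    · rw [disc_re]; field_simp; ring
    · rw [abs_neg, abs_of_pos (by positivity)]
      nlinarith [sq_nonneg (Real.exp (-(ρ t).1) - 1), sq_nonneg (Real.exp (-(ρ t).1))]
  | left =>
    have e : circlePoint n m (.limit .left) = ((-1 : ℝ) : ℂ) := by
      simp [circlePoint, homog]
    rw [e, tendsto_iff_norm_sub_tendsto_zero]
    have h2 : Tendsto (fun t => 4 * Real.exp (ρ t).1) atTop (𝓝 0) := by
      simpa using (Real.tendsto_exp_atBot.comp h1).const_mul 4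
    refine squeeze_zero (fun _ => norm_nonneg _) (fun t => ?_) h2
    have p1 := Real.exp_pos (ρ t).1
    have p2 := Real.exp_pos (-(ρ t).1)
    have p3 : Real.exp (ρ t).1 * Real.exp (-(ρ t).1) = 1 := by rw [← Real.exp_add]; simp
    refine norm_sub_ofReal_le (ρ t) (x := 2 * Real.exp ((ρ t).1)) ?_ ?_
    · rw [disc_re]; field_simp; ring
    · rw [abs_of_pos (by positivity)]
      nlinarith [sq_nonneg (Real.exp ((ρ t).1) - 1), sq_nonneg (Real.exp ((ρ t).1))]

/-- A parametrization of the half line by the unit interval. -/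
noncomputable def halfLine (t : I) : NNReal := Real.toNNReal (t / (1 - t))

theorem halfLine_pos {t : I} (ht : t ∈ Set.Ioo (0 : I) 1) : 0 < halfLine t := by
  have h1 : (0 : ℝ) < t := ht.1
  have h2 : (t : ℝ) < 1 := ht.2
  exact Real.toNNReal_pos.2 (div_pos h1 (by linarith))

theorem continuousAt_halfLine {t : I} (ht : t ≠ 1) : ContinuousAt halfLine t := by
  have h : (1 : ℝ) - t ≠ 0 := fun h => ht (Subtype.ext (show (t : ℝ) = 1 by linarith))
  unfold halfLine
  fun_prop (disch := exact h)

theorem tendsto_halfLine : Tendsto halfLine (𝓝[≠] 1) atTop := by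
  unfold halfLine
  refine Real.tendsto_toNNReal_atTop.comp ?_
  have h1 : Tendsto (fun t : I => (t : ℝ)) (𝓝[≠] 1) (𝓝 1) :=
    (continuous_subtype_val.tendsto' (1 : I) 1 rfl).mono_left nhdsWithin_le_nhds
  have h2 : Tendsto (fun t : I => 1 - (t : ℝ)) (𝓝[≠] 1) (𝓝[>] 0) := by
    refine tendsto_nhdsWithin_iff.2 ⟨?_, ?_⟩
    · simpa using h1.const_sub 1
    · filter_upwards [self_mem_nhdsWithin] with t ht
      have : (t : ℝ) < 1 := lt_of_le_of_ne t.2.2 fun h => ht (Subtype.ext h)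
      simpa using this
  simpa [div_eq_mul_inv] using h1.pos_mul_atTop one_pos (tendsto_inv_nhdsGT_zero.comp h2)

theorem connects_of_spiral {u : Vertex} {d : Direction} (hu : u.IsFinite)
    {ρ : C(NNReal, Strip)} (hρ : IsAsymptoticCurve n m d (cover.comp ρ))
    (h0 : ρ 0 = position n m u) :
    Connects n m (cover.comp ρ '' Set.Ioi 0) u (.limit d) := by
  have hs : StripSpirals d ρ := by
    obtain ⟨ρ₁, h1, h2⟩ := hρ.spirals
    exact stripSpirals_of_cover h1 h2
  -- At t = 1 division by zero gives `halfLine 1 = 0`, hence the value there is replaced by the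
  -- limit.
  let f : I → ℂ := Function.update (fun t => disc (ρ (halfLine t))) 1 (circlePoint n m (.limit d))
  have hf : Continuous f := by
    rw [continuous_iff_continuousAt]
    intro t
    rcases eq_or_ne t 1 with rfl | ht
    · exact continuousAt_update_same.2 ((tendsto_disc hs).comp tendsto_halfLine)
    · rw [continuousAt_update_of_ne ht]
      exact (continuous_disc.comp ρ.continuous).continuousAt.comp (continuousAt_halfLine ht)
  refine ⟨⟨f, hf⟩, ?_, ?_, fun t ht => ⟨ρ (halfLine t), ?_, ?_,
    Set.mem_image_of_mem _ (halfLine_pos ht)⟩⟩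
  · simp [f, halfLine, h0, disc_position n m hu]
  · simp [f]
  · rcases hρ.interior _ (halfLine_pos ht) with ⟨-, h⟩ | ⟨-, h⟩
    · exact ⟨h.1, h.2.trans_le le_one'⟩
    · exact ⟨lt_of_le_of_lt nonneg' h.1, h.2⟩
  · simp [f, ht.2.ne]

/-- A trace may stem from another representative, possibly reversed; a deck transformation moves a
lift of it to the endpoints u and v. -/
theorem HasLift.connects {α : Arc n m} {u v : Vertex} (h : HasLift α u v)
    {S : Set Annulus} (hS : IsTrace α S) : Connects n m S u v := by
  cases α with
  | finite α =>
    obtain ⟨⟨γ, hγ⟩, hα, rfl⟩ := hS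
    obtain ⟨a, -, -, ha⟩ := exists_position_of_isMarked hγ.marked_zero
    obtain ⟨c, rfl, hc⟩ := exists_lift γ ha
    obtain ⟨hu, hv, hu', hv', e, he, h0, h1, rfl⟩ := h
    have hs : SameClass (cover.comp e) (cover.comp c) :=
      sameClass_equivalence.symm (Quotient.exact hα)
    obtain ⟨τ, ht⟩ := lift_ends_of_sameClass hs
    have hc' : cover.comp (shiftLift (-τ) c) = cover.comp c := cover_shiftLift _ _
    have cancel : ∀ p : Strip, shiftStrip (-τ) (shiftStrip τ p) = p := fun p => by
      simp [shiftStrip]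
    rw [h0, h1] at ht
    simp only [← hc'] at hγ ⊢
    rcases ht with ht | ht
    · exact connects_of_lift hu hv hγ (by simp [shiftLift, ht.1, cancel])
        (by simp [shiftLift, ht.2, cancel])
    · exact (connects_of_lift hv hu hγ (by simp [shiftLift, ht.1, cancel])
        (by simp [shiftLift, ht.2, cancel])).symm
  | asymptotic d α =>
    obtain ⟨⟨γ, hγ⟩, hα, rfl⟩ := hS
    obtain ⟨hu, hu', rfl, e, he, h0, rfl⟩ := h
    obtain ⟨ρ, rfl, hρ⟩ := id hγ.spirals
    have hs : cover (e 0) = cover (ρ 0) := asymptotic_start (Quotient.exact hα)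
    obtain ⟨τ, ht⟩ := cover_eq_iff.1 hs
    have hc' : cover.comp (shiftLift (-τ) ρ) = cover.comp ρ := cover_shiftLift _ _
    simp only [← hc'] at hγ ⊢
    exact connects_of_spiral hu hγ (by simp [shiftLift, ht, shiftStrip, h0])

/-- Compatible arcs do not have crossing lifts. -/
theorem not_crosses_of_compatible (hn : 0 < n) {α β : Arc n m} {u v r s : Vertex}
    (hα : HasLift α u v) (hβ : HasLift β r s) (h : Compatible α β) : ¬ Crosses u v r s := by
  intro hc
  obtain ⟨S, S', hS, hS', hd⟩ := h
  exact not_disjoint_of_crosses hn hα.valid_left hα.valid_right hβ.valid_left hβ.valid_right hc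
    (hα.connects hS) (hβ.connects hS') hd

/-! ### Essential pairs of vertices -/

/-- A boundary segment joins the two vertices. -/
def IsSegment (u v : Vertex) : Prop :=
  ∃ k, (u = .outer k ∧ v = .outer (k + 1)) ∨ (u = .inner k ∧ v = .inner (k + 1))

/-- Two vertices that are neither equal nor joined by a boundary segment. -/
def Essential (u v : Vertex) : Prop := u ≠ v ∧ ¬ IsSegment u v ∧ ¬ IsSegment v u

theorem exists_outerSegment_lift (hn : 0 < n) (k : ℤ) :
    ∃ c : C(I, Strip), cover.comp c = outerSegment n k ∧ c 0 = position n m (.outer k) ∧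
      c 1 = position n m (.outer (k + 1)) := by
  have hn' : (n : ℝ) ≠ 0 := by exact_mod_cast hn.ne'
  refine ⟨⟨fun t => (((k : ℝ) + (t : ℝ)) / n, 0), by fun_prop⟩, rfl, ?_, ?_⟩
  · simp [position, outerPoint]
  · simp [position, outerPoint]

theorem exists_innerSegment_lift (hm : 0 < m) (k : ℤ) :
    ∃ c : C(I, Strip), cover.comp c = innerSegment m k ∧ c 0 = position n m (.inner k) ∧
      c 1 = position n m (.inner (k + 1)) := by
  have hm' : (m : ℝ) ≠ 0 := by exact_mod_cast hm.ne'
  refine ⟨⟨fun t => (((k : ℝ) + (t : ℝ)) / m, 1), by fun_prop⟩, rfl, ?_, ?_⟩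
  · simp [position, innerPoint]
  · simp [position, innerPoint]

theorem not_isSegment_of_hasLift (hn : 0 < n) {α : FiniteArc n m} {u v : Vertex}
    (h : HasLift (.finite α) u v) : ¬ IsSegment u v := by
  obtain ⟨hu, hv, hu', hv', c, hc, h0, h1, rfl⟩ := h
  rintro ⟨k, ⟨rfl, rfl⟩ | ⟨rfl, rfl⟩⟩
  · obtain ⟨e, he, e0, e1⟩ := exists_outerSegment_lift (m := m) hn k
    apply hc.not_outerSegment k hn
    rw [← he]
    exact Or.inl (homotopicRel_of_lift (h0.trans e0.symm) (h1.trans e1.symm))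
  · obtain ⟨e, he, e0, e1⟩ := exists_innerSegment_lift (n := n) (m := m) hu' k
    apply hc.not_innerSegment k hu'
    rw [← he]
    exact Or.inl (homotopicRel_of_lift (h0.trans e0.symm) (h1.trans e1.symm))

theorem HasLift.essential (hn : 0 < n) {α : FiniteArc n m} {u v : Vertex}
    (h : HasLift (.finite α) u v) : Essential u v := by
  refine ⟨?_, not_isSegment_of_hasLift hn h, not_isSegment_of_hasLift hn h.symm⟩
  rintro rfl
  obtain ⟨hu, hv, hu', hv', c, hc, h0, h1, rfl⟩ := h
  apply hc.not_contractible
  have e : ContinuousMap.const I ((cover.comp c) 0) = cover.comp (ContinuousMap.const I (c 0)) := rfl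
  rw [e]
  exact homotopicRel_of_lift rfl (h1.trans h0.symm)

/-! ### Geodesic representatives -/

theorem nullP_pos {u : Vertex} (hu : u.IsFinite) : 0 < nullP n m u := by
  cases u with
  | outer k => simp only [nullP, homog]; positivity
  | inner k => simp only [nullP, homog, neg_sq]; positivity
  | limit d => exact hu.elim

theorem nullQ_pos {u : Vertex} (hu : u.IsFinite) : 0 < nullQ n m u := by
  cases u with
  | outer k => simp only [nullQ, homog]; positivity
  | inner k => simp only [nullQ, homog]; positivity
  | limit d => exact hu.elim

theorem position_null {u : Vertex} (hu : u.IsFinite) :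
    Real.exp (position n m u).1 = nullP n m u ∧ Real.exp (-(position n m u).1) = nullQ n m u ∧
      2 * ((position n m u).2 : ℝ) - 1 = nullB n m u := by
  cases u with
  | outer k =>
    simp only [position, outerPoint, nullP, nullQ, nullB, homog, ← Real.exp_nat_mul,
      ← Real.exp_add]
    refine ⟨?_, ?_, ?_⟩
    · congr 1; push_cast; ring
    · congr 1; push_cast; ring
    · simp
  | inner k =>
    simp only [position, innerPoint, nullP, nullQ, nullB, homog, neg_sq, ← Real.exp_nat_mul,
      neg_mul, ← Real.exp_add]
    refine ⟨?_, ?_, ?_⟩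
    · congr 1; push_cast; ring
    · congr 1; push_cast; ring
    · simp; norm_num
  | limit d => exact hu.elim

theorem ofNull_vertex {u : Vertex} (hu : u.IsFinite) :
    ofNull (nullP n m u) (nullQ n m u) (nullB n m u) = position n m u := by
  have hP := nullP_pos (n := n) (m := m) hu
  have hQ := nullQ_pos (n := n) (m := m) hu
  obtain ⟨h1, h2, h3⟩ := ofNull_spec hP hQ (B := nullB n m u)
    (by simp only [nullP, nullQ, nullB]; apply le_of_eq; ring)
  obtain ⟨k1, k2, k3⟩ := position_null (n := n) (m := m) hu
  refine strip_ext (c := (√(nullP n m u * nullQ n m u))⁻¹) (by positivity) ?_ ?_ ?_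
  · rw [k1]; exact h1
  · rw [k2]; exact h2
  · rw [k3]; exact h3

/-- No translate of the chord crosses it. -/
def SelfNoncrossing (n m : ℕ) (u v : Vertex) : Prop :=
  ∀ τ : ℤ, ¬ Crosses u v (shift n m τ u) (shift n m τ v)

/-- A nontrivial translate of the geodesic is disjoint from it, so the projection to the annulus is
simple. -/
theorem eq_of_cover_eq_of_geodesic (hn : 0 < n) {u v : Vertex} (hu : Valid m u) (hv : Valid m v)
    (hf : u.IsFinite) (huv : u ≠ v) (hc : SelfNoncrossing n m u v) {p q : Strip}
    (hp : p ∈ geodesic n m u v) (hq : q ∈ geodesic n m u v) (h : cover p = cover q) : p = q := by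
  obtain ⟨τ, rfl⟩ := cover_eq_iff.1 h
  rcases eq_or_ne τ 0 with rfl | hτ
  · simp [shiftStrip]
  refine (Set.disjoint_left.1 (geodesic_disjoint hn hu hv (valid_shift τ hu) (valid_shift τ hv) ?_
    (hc τ) (fun h => hτ (shift_eq_self hn hu hf h.1)) fun h => ?_) hq
    (shiftStrip_mem_geodesic hn τ hu hv hp)).elim
  · intro h
    apply huv
    have := congrArg (shift n m (-τ)) h
    rwa [shift_shift, shift_shift, add_neg_cancel, shift_zero, shift_zero] at this
  -- If the translation exchanged u and v, its square would fix u.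
  · have h1 := shift_shift n m τ τ u
    rw [h.1, h.2] at h1
    have := shift_eq_self hn hu hf h1.symm
    lia

/-- The projected geodesic represents the arc. It is neither contractible nor a boundary segment,
because homotopy would force its lifted endpoints to be equal or joined by a segment. -/
theorem exists_geodesic_finite (hn : 0 < n) {u v : Vertex} (hu : Valid m u) (hv : Valid m v)
    (hu' : u.IsFinite) (hv' : v.IsFinite) (he : Essential u v) (hc : SelfNoncrossing n m u v) :
    ∃ α : Arc n m, HasLift α u v ∧ ∃ S, IsTrace α S ∧ S ⊆ cover '' geodesic n m u v := by
  have hbr : bracket n m u v ≠ 0 := fun h => he.1 ((bracket_eq_zero hn hu hv).1 h)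
  have lin : ∀ {a b : ℝ} (t : I), 0 < a → 0 < b → 0 < (1 - (t : ℝ)) * a + t * b := by
    intro a b t ha hb
    have h0 := t.2.1
    rcases eq_or_lt_of_le t.2.2 with h1 | h1
    · rw [h1]; linarith
    · have := mul_pos (sub_pos.2 h1) ha
      have := mul_nonneg h0 hb.le
      linarith
  have hP : ∀ t : I, 0 < (1 - (t : ℝ)) * nullP n m u + t * nullP n m v :=
    fun t => lin t (nullP_pos hu') (nullP_pos hv')
  have hQ : ∀ t : I, 0 < (1 - (t : ℝ)) * nullQ n m u + t * nullQ n m v :=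
    fun t => lin t (nullQ_pos hu') (nullQ_pos hv')
  let c : C(I, Strip) := ⟨fun t => ofNull ((1 - (t : ℝ)) * nullP n m u + t * nullP n m v)
    ((1 - (t : ℝ)) * nullQ n m u + t * nullQ n m v) ((1 - (t : ℝ)) * nullB n m u + t * nullB n m v),
    continuous_ofNull (by fun_prop) (by fun_prop) (by fun_prop) hP hQ⟩
  have c0 : c 0 = position n m u := by simp [c, ofNull_vertex hu']
  have c1 : c 1 = position n m v := by simp [c, ofNull_vertex hv']
  have hgeo : ∀ t ∈ Set.Ioo (0 : I) 1, c t ∈ geodesic n m u v := fun t ht =>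
    ofNull_mem_geodesic (sub_pos.2 (show (t : ℝ) < 1 from ht.2)) (show (0 : ℝ) < t from ht.1)
      (hP t) (hQ t)
  have hne : c 0 ≠ c 1 := fun h => he.1 (position_injective hn hu' hv' hu (by rw [← c0, ← c1, h]))
  have pos_eq : ∀ {τ : ℤ} {a b : Vertex}, a.IsFinite → b.IsFinite → Valid m a → Valid m b →
      position n m a = shiftStrip τ (position n m b) → b = shift n m (-τ) a := by
    intro τ a b ha hb ha' hb' h
    rw [← position_shift hn τ hb' hb] at h
    have := position_injective hn ha (finite_shift.2 hb) ha' h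
    rw [this, shift_shift, add_neg_cancel, shift_zero]
  have hseg : ∀ {a b : Vertex}, a.IsFinite → b.IsFinite → Valid m a → Valid m b →
      (∀ τ, IsSegment (shift n m τ a) (shift n m τ b)) → ∀ e : C(I, Strip), e 0 = position n m a →
      e 1 = position n m b → ¬ SameClass (cover.comp c) (cover.comp e) := by
    intro a b ha hb ha' hb' hab e e0 e1 h
    obtain ⟨τ, h⟩ := lift_ends_of_sameClass h
    rw [c0, c1, e0, e1] at h
    rcases h with h | h
    · apply he.2.1
      rw [pos_eq ha hu' ha' hu h.1, pos_eq hb hv' hb' hv h.2]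
      exact hab _
    · apply he.2.2
      rw [pos_eq ha hv' ha' hv h.1, pos_eq hb hu' hb' hu h.2]
      exact hab _
  have hA : IsArcCurve n m (cover.comp c) := by
    refine ⟨?_, ?_, fun t ht => mem_Ioo_of_geodesic hbr (hgeo t ht), ?_, fun h => ?_,
      fun k _ h => ?_, fun k hm h => ?_⟩
    · rw [ContinuousMap.comp_apply, c0]; exact isMarked_position hn hu' hu
    · rw [ContinuousMap.comp_apply, c1]; exact isMarked_position hn hv' hv
    · intro s hs t ht hst
      have h1 := eq_of_cover_eq_of_geodesic hn hu hv hu' he.1 hc (hgeo s hs) (hgeo t ht) hst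
      have s0 := s.2.1
      have s1 := s.2.2
      have t0 := t.2.1
      have t1 := t.2.2
      obtain ⟨d, d1, d2⟩ := ofNull_injective hbr (by linarith) s0 (by linarith) t0 (hP s) (hQ s)
        (hP t) (hQ t) h1
      have : d = 1 := by linear_combination -d1 - d2
      rw [this, one_mul] at d2
      exact Subtype.ext d2.symm
    · have e : ContinuousMap.const I ((cover.comp c) 0) =
        cover.comp (ContinuousMap.const I (c 0)) := rfl
      rw [e] at h
      exact hne (lift_endpoint (c := c) (c' := ContinuousMap.const I (c 0)) rfl h).symm
    · obtain ⟨e, he, e0, e1⟩ := exists_outerSegment_lift (m := m) hn k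
      rw [← he] at h
      exact hseg (a := .outer k) (b := .outer (k + 1)) trivial trivial trivial trivial
        (fun τ => ⟨k + τ * n, Or.inl ⟨rfl, by simp [shift]; ring⟩⟩) e e0 e1 h
    · obtain ⟨e, he, e0, e1⟩ := exists_innerSegment_lift (n := n) hm k
      rw [← he] at h
      exact hseg (a := .inner k) (b := .inner (k + 1)) trivial trivial hm hm
        (fun τ => ⟨k + τ * m, Or.inr ⟨rfl, by simp [shift]; ring⟩⟩) e e0 e1 h
  refine ⟨.finite (Quotient.mk _ ⟨_, hA⟩), ⟨hu', hv', hu, hv, c, hA, c0, c1, rfl⟩,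
    _, ⟨⟨_, hA⟩, rfl, rfl⟩, ?_⟩
  rintro _ ⟨t, ht, rfl⟩
  exact ⟨c t, hgeo t ht, rfl⟩

theorem exists_geodesic_spiral (hn : 0 < n) (k : ℤ)
    (hc : SelfNoncrossing n m (.outer k) (.limit .right)) :
    ∃ α : Arc n m, HasLift α (.outer k) (.limit .right) ∧
      ∃ S, IsTrace α S ∧ S ⊆ cover '' geodesic n m (.outer k) (.limit .right) := by
  set u := Vertex.outer k with hu
  set v := Vertex.limit .right with hv
  have hu' : u.IsFinite := trivial
  have huV : Valid m u := trivial
  have hvV : Valid m v := trivial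
  have huv : u ≠ v := by simp [hu, hv]
  have hbr : bracket n m u v ≠ 0 := fun h => huv ((bracket_eq_zero hn huV hvV).1 h)
  have vP : nullP n m v = 1 := by simp [hv, nullP, homog]
  have vQ : nullQ n m v = 0 := by simp [hv, nullQ, homog]
  have vB : nullB n m v = 0 := by simp [hv, nullB, homog]
  have uP := nullP_pos (n := n) (m := m) hu'
  have uQ := nullQ_pos (n := n) (m := m) hu'
  have uB : nullB n m u < 0 := by
    simp only [hu, nullB, homog, Left.neg_neg_iff]
    positivity
  have hP : ∀ t : NNReal, 0 < 1 * nullP n m u + (t : ℝ) * nullP n m v := fun t => by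
    rw [vP]; have := t.2; positivity
  have hQ : ∀ t : NNReal, 0 < 1 * nullQ n m u + (t : ℝ) * nullQ n m v := fun t => by
    rw [vQ]; simpa using uQ
  -- Multiples of (1, 0, 0), the null vector of the right end, are added to that of u. Then P grows
  -- while Q and B < 0 stay fixed, so the curve runs to the right and approaches the meridian from
  -- below.
  let ρ : C(NNReal, Strip) := ⟨fun t => ofNull (1 * nullP n m u + (t : ℝ) * nullP n m v)
    (1 * nullQ n m u + (t : ℝ) * nullQ n m v) (1 * nullB n m u + (t : ℝ) * nullB n m v),
    continuous_ofNull (by fun_prop) (by fun_prop) (by fun_prop) hP hQ⟩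
  have r0 : ρ 0 = position n m u := by simp [ρ, ofNull_vertex hu']
  have hgeo : ∀ t : NNReal, 0 < t → ρ t ∈ geodesic n m u v := fun t ht =>
    ofNull_mem_geodesic one_pos ht (hP t) (hQ t)
  have hI : ∀ t : NNReal, 0 < t → (ρ t).2 ∈ Set.Ioo (0 : I) 1 := fun t ht =>
    mem_Ioo_of_geodesic hbr (hgeo t ht)
  have hs : StripSpirals .right ρ := by
    have hlim : Tendsto (fun t : NNReal => 1 * nullP n m u + (t : ℝ) * nullP n m v) atTop atTop := by
      rw [vP]
      simp only [mul_one]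
      exact tendsto_atTop_add_const_left _ _ (NNReal.tendsto_coe_atTop.2 tendsto_id)
    constructor
    · simp only [ρ, ofNull, ContinuousMap.coe_mk, Direction.toFilter, vQ, mul_zero, add_zero, one_mul]
      rw [one_mul] at hlim
      exact (Real.tendsto_log_atTop.comp (hlim.atTop_div_const uQ)).atTop_div_const two_pos
    · have e : meridian = Set.projIcc (0 : ℝ) 1 zero_le_one ((1 + 0) / 2) := by
        rw [Set.projIcc_of_mem zero_le_one ⟨by norm_num, by norm_num⟩]
        exact Subtype.ext (by simp [meridian])
      rw [e]
      simp only [ρ, ofNull, ContinuousMap.coe_mk]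
      refine (continuous_projIcc.tendsto _).comp (((Tendsto.div_atTop (a := nullB n m u) ?_ ?_).const_add 1).div_const 2)
      · simp [vB]
      · refine Real.tendsto_sqrt_atTop.comp ?_
        simp only [vQ, mul_zero, add_zero, one_mul] at hlim ⊢
        exact hlim.atTop_mul_const uQ
  have hA : IsAsymptoticCurve n m .right (cover.comp ρ) := by
    refine ⟨?_, fun t ht => Or.inl ⟨?_, (hI t ht).1, ?_⟩, ?_, ρ, rfl, hs⟩
    · rw [ContinuousMap.comp_apply, r0]; exact isMarked_position hn hu' huV
    · rw [ContinuousMap.comp_apply, r0]; rfl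
    · change ((ρ t).2 : ℝ) < 1 / 2
      have h3 := (ofNull_spec (hP t) (hQ t)
        (null_sq_le (n := n) (m := m) (u := u) (v := v) zero_le_one t.2)).2.2
      have hR := inv_pos.2 (Real.sqrt_pos.2 (mul_pos (hP t) (hQ t)))
      have h4 : 1 * nullB n m u + (t : ℝ) * nullB n m v < 0 := by rw [vB]; linarith
      have h5 := mul_neg_of_pos_of_neg hR h4
      rw [← h3] at h5
      change 2 * ((ρ t).2 : ℝ) - 1 < 0 at h5
      linarith
    · have zero : ∀ t : NNReal, cover (ρ 0) = cover (ρ t) → t = 0 := fun t h => by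
        by_contra ht
        have h1 := (hI t (pos_iff_ne_zero.2 ht)).1
        have h2 : (ρ 0).2 = (ρ t).2 := congrArg (Prod.snd : Annulus → I) h
        rw [← h2, r0] at h1
        exact lt_irrefl _ h1
      intro s t hst
      change cover (ρ s) = cover (ρ t) at hst
      rcases eq_or_ne s 0 with rfl | hs0
      · exact (zero t hst).symm
      rcases eq_or_ne t 0 with rfl | ht0
      · exact zero s hst.symm
      have h1 := eq_of_cover_eq_of_geodesic hn huV hvV hu' huv hc (hgeo s (pos_iff_ne_zero.2 hs0))
        (hgeo t (pos_iff_ne_zero.2 ht0)) hst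
      obtain ⟨d, d1, d2⟩ := ofNull_injective hbr zero_le_one s.2 zero_le_one t.2 (hP s) (hQ s)
        (hP t) (hQ t) h1
      rw [mul_one] at d1
      rw [← d1, one_mul] at d2
      exact NNReal.eq d2.symm
  refine ⟨.asymptotic .right (Quotient.mk _ ⟨_, hA⟩), ⟨hu', huV, rfl, ρ, hA, r0, rfl⟩,
    _, ⟨⟨_, hA⟩, rfl, rfl⟩, ?_⟩
  rintro _ ⟨t, ht, rfl⟩
  exact ⟨ρ t, hgeo t ht, rfl⟩

/-- Different arcs with geodesic representatives, no lifts of which cross, are compatible. -/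
theorem compatible_of_not_crosses (hn : 0 < n) {α β : Arc n m} {u v r s : Vertex}
    (hα : HasLift α u v) (hβ : HasLift β r s) (hαβ : α ≠ β) (huv : u ≠ v)
    (hc : ∀ τ, ¬ Crosses r s (shift n m τ u) (shift n m τ v)) {S S' : Set Annulus}
    (hS : IsTrace α S) (hS' : IsTrace β S') (hg : S ⊆ cover '' geodesic n m u v)
    (hg' : S' ⊆ cover '' geodesic n m r s) : Compatible α β := by
  refine ⟨S, S', hS, hS', Set.disjoint_left.2 fun x hx hx' => ?_⟩
  obtain ⟨p, hp, rfl⟩ := hg hx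
  obtain ⟨q, hq, hpq⟩ := hg' hx'
  obtain ⟨τ, rfl⟩ := cover_eq_iff.1 hpq.symm
  have h := hα.shift hn τ
  refine Set.disjoint_left.1 (geodesic_disjoint hn hβ.valid_left hβ.valid_right h.valid_left
    h.valid_right ?_ (hc τ) ?_ ?_) hq (shiftStrip_mem_geodesic hn τ hα.valid_left hα.valid_right hp)
  · intro h
    apply huv
    have := congrArg (shift n m (-τ)) h
    rwa [shift_shift, shift_shift, add_neg_cancel, shift_zero, shift_zero] at this
  · rintro ⟨h1, h2⟩
    rw [h1, h2] at h
    exact hαβ (h.unique hβ)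
  · rintro ⟨h1, h2⟩
    rw [h1, h2] at h
    cases α with
    | finite α => exact hαβ (h.symm.unique hβ)
    | asymptotic d α =>
      have h3 := hβ.finite_left
      rw [h.2.2.1] at h3
      exact h3

end AnnulusTriangulation

/-! ### The chords in the strip and their maximality -/

namespace PeriodicPattern

open AnnulusTriangulation

variable (P : PeriodicPattern)

theorem L_shift {i j : ℤ} (hij : i ≤ j) (τ : ℤ) : P.L (i + τ * P.n) (j + τ * P.n) = P.L i j := by
  have h : Function.Periodic (fun t => P.L (i + t) (j + t)) (P.n : ℤ) := fun t => by
    simp only [← add_assoc]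
    exact P.period _ _ (by lia)
  simpa using h.int_mul_eq τ

theorem skeletal_shift (k τ : ℤ) : P.Skeletal (k + τ * P.n) ↔ P.Skeletal k := by
  have h : Function.Periodic P.Skeletal (P.n : ℤ) := fun t =>
    propext ⟨P.skeletal_of_period', P.skeletal_of_period⟩
  have := h.int_mul τ k
  simp only [Int.cast_id] at this
  rw [this]

theorem height_shift (k τ : ℤ) : P.height (k + τ * P.n) = P.height k + τ * P.total := by
  rcases le_total 0 τ with h | h
  · obtain ⟨t, rfl⟩ := Int.eq_ofNat_of_zero_le h
    exact P.height_add_mul k t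
  · obtain ⟨t, ht⟩ := Int.eq_ofNat_of_zero_le (neg_nonneg.2 h)
    obtain rfl : τ = -t := by lia
    have := P.height_add_mul (k + -t * P.n) t
    rw [show k + -(t : ℤ) * P.n + t * P.n = k by ring] at this
    linarith

/-- The chords of the triangulation of the strip that belongs to a pattern. -/
def Chord : Vertex → Vertex → Prop
  | .outer i, .outer j => i + 2 ≤ j ∧ P.L i j = 1
  | .outer k, .inner l => 0 < P.total ∧ P.Skeletal k ∧ P.height k ≤ l ∧ l ≤ P.height (k + 1)
  | .outer k, .limit .right => P.total = 0 ∧ P.Skeletal k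
  | _, _ => False

variable {P}

theorem Chord.finite_left {u v : Vertex} (h : P.Chord u v) : u.IsFinite := by
  rcases u with i | i | i
  · trivial
  · trivial
  · exact h.elim

theorem Chord.valid_left {u v : Vertex} (h : P.Chord u v) : Valid P.total u := by
  rcases u with i | i | i
  · trivial
  · exact h.elim
  · trivial

theorem Chord.valid_right {u v : Vertex} (h : P.Chord u v) : Valid P.total v := by
  rcases u with i | i | i <;> rcases v with j | j | j
  case outer.inner => exact h.1
  all_goals trivial

theorem Chord.essential {u v : Vertex} (h : P.Chord u v) : Essential u v := by
  rcases u with i | i | i <;> rcases v with j | j | (_ | _)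
  all_goals first | exact h.elim | skip
  · have := h.1
    refine ⟨by simp; lia, ?_, ?_⟩ <;> rintro ⟨k, hk⟩ <;> simp at hk <;> lia
  · refine ⟨by simp, ?_, ?_⟩ <;> rintro ⟨k, hk⟩ <;> simp at hk
  · refine ⟨by simp, ?_, ?_⟩ <;> rintro ⟨k, hk⟩ <;> simp at hk

theorem Chord.shift {u v : Vertex} (h : P.Chord u v) (τ : ℤ) :
    P.Chord (shift P.n P.total τ u) (shift P.n P.total τ v) := by
  rcases u with i | i | i <;> rcases v with j | j | (_ | _)
  all_goals first | exact h.elim | skip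
  · obtain ⟨h1, h2⟩ := h
    exact ⟨by lia, by rw [P.L_shift (by lia), h2]⟩
  · obtain ⟨h1, h2, h3, h4⟩ := h
    refine ⟨h1, (P.skeletal_shift _ _).2 h2, ?_, ?_⟩
    · rw [P.height_shift]; lia
    · rw [show i + τ * P.n + 1 = i + 1 + τ * P.n by ring, P.height_shift]; lia
  · exact ⟨h.1, (P.skeletal_shift _ _).2 h.2⟩

theorem skeletal_not_between {i j k : ℤ} (hk : P.Skeletal k) (h : P.L i j = 1) :
    k ≤ i ∨ j ≤ k := by
  by_contra! hcon
  exact hk i j hcon.1 hcon.2 h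

/-- Chords with entry 1 do not cross each other and do not pass over skeletal vertices; the
intervals of inner points at different skeletal vertices are ordered because `height` is monotone;
spirals to the same end do not cross. -/
theorem Chord.not_crosses {u v r s : Vertex} (h : P.Chord u v) (h' : P.Chord r s) :
    ¬ Crosses u v r s := by
  intro hc
  rcases u with i | i | i <;> rcases v with j | j | (_ | _)
  all_goals first | exact h.elim | skip
  all_goals rcases r with k | k | k <;> rcases s with l | l | (_ | _)
  all_goals first | exact h'.elim | skip
  all_goals simp only [Crosses, order, mul_neg_iff, mul_pos_iff] at hc
  · obtain ⟨h1, h2⟩ := h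
    obtain ⟨h3, h4⟩ := h'
    have : (i < k ∧ k < j ∧ j < l) ∨ (k < i ∧ i < l ∧ l < j) := by lia
    rcases this with ⟨a, b, c⟩ | ⟨a, b, c⟩
    · exact P.noncrossing a b c h2 h4
    · exact P.noncrossing a b c h4 h2
  · have := skeletal_not_between h'.2.1 h.2
    have := h.1
    lia
  · have := skeletal_not_between h'.2 h.2
    have := h.1
    lia
  · have := skeletal_not_between h.2.1 h'.2
    have := h'.1
    lia
  · obtain ⟨-, -, h1, h2⟩ := h
    obtain ⟨-, -, h3, h4⟩ := h'
    have : (i < k ∧ l < j) ∨ (k < i ∧ j < l) := by lia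
    rcases this with ⟨a, b⟩ | ⟨a, b⟩
    · have := P.height_mono (show i + 1 ≤ k by lia)
      lia
    · have := P.height_mono (show k + 1 ≤ i by lia)
      lia
  · have := h.1
    have := h'.1
    lia
  · have := skeletal_not_between h.2 h'.2
    have := h'.1
    lia
  · have := h.1
    have := h'.1
    lia
  · lia

theorem crosses_swap (u v r s : Vertex) : Crosses u v r s ↔ Crosses v u r s := by
  unfold Crosses
  rw [show order u r * order v r * order u s * order v s =
    order v r * order u r * order v s * order u s by ring]

variable (P)

/-- Every skeletal vertex has a chord to a limit point or to the opposite boundary. -/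
theorem exists_chord_of_skeletal {k : ℤ} (hk : P.Skeletal k) :
    ∃ w, P.Chord (.outer k) w ∧ ∀ j, w ≠ .outer j := by
  rcases Nat.eq_zero_or_pos P.total with h | h
  · exact ⟨.limit .right, ⟨h, hk⟩, by simp⟩
  · exact ⟨.inner (P.height k), ⟨h, hk, le_rfl, P.height_mono (by lia)⟩, by simp⟩

/-- A skeletal vertex below the pair would have a chord to the opposite boundary or a limit point,
which crosses it; so `eq_one_of_noncrossing` applies. -/
theorem eq_one_of_not_crosses {i j : ℤ} (hij : i < j)
    (h : ∀ r s, P.Chord r s → ¬ Crosses (.outer i) (.outer j) r s) : P.L i j = 1 := by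
  refine P.eq_one_of_noncrossing hij (fun k h1 h2 hk => ?_) (fun k l h1 h2 h3 hkl => ?_)
    (fun k l h1 h2 h3 hkl => ?_)
  · obtain ⟨w, hw, hw'⟩ := P.exists_chord_of_skeletal hk
    apply h _ _ hw
    rcases w with j | j | (_ | _)
    · exact (hw' j rfl).elim
    all_goals simp only [Crosses, order, mul_neg_iff, mul_pos_iff]; lia
  · apply h (.outer k) (.outer l) ⟨by lia, hkl⟩
    simp only [Crosses, order, mul_neg_iff, mul_pos_iff]; lia
  · apply h (.outer k) (.outer l) ⟨by lia, hkl⟩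
    simp only [Crosses, order, mul_neg_iff, mul_pos_iff]; lia

theorem skeletal_of_not_crosses {k : ℤ} {v : Vertex} (hv : ∀ j, v ≠ .outer j)
    (h : ∀ r s, P.Chord r s → ¬ Crosses (.outer k) v r s) : P.Skeletal k := by
  intro i j h1 h2 hij
  apply h (.outer i) (.outer j) ⟨by lia, hij⟩
  rcases v with l | l | (_ | _)
  · exact (hv l rfl).elim
  all_goals simp only [Crosses, order, mul_neg_iff, mul_pos_iff]; lia

/-- If l is outside the interval belonging to k, some skeletal vertex on one side of k has a chord
to an inner point on the other side of l. -/
theorem chord_outer_inner_of_not_crosses (hm : 0 < P.total) {k l : ℤ}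
    (h : ∀ r s, P.Chord r s → ¬ Crosses (.outer k) (.inner l) r s) :
    P.Chord (.outer k) (.inner l) := by
  refine ⟨hm, P.skeletal_of_not_crosses (by simp) h, ?_, ?_⟩
  · by_contra! hcon
    obtain ⟨s, h1, h2, h3⟩ := P.exists_skeletal_of_lt_height hcon
    apply h (.outer s) (.inner (P.height (s + 1))) ⟨hm, h2, P.height_mono (by lia), le_rfl⟩
    simp only [Crosses, order, mul_neg_iff, mul_pos_iff]; lia
  · by_contra! hcon
    obtain ⟨s, h1, h2, h3⟩ := P.exists_skeletal_of_height_lt hcon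
    apply h (.outer s) (.inner (P.height s)) ⟨hm, h2, le_rfl, P.height_mono (by lia)⟩
    simp only [Crosses, order, mul_neg_iff, mul_pos_iff]; lia

/-- A pair of vertices that crosses no chord is a chord. -/
theorem chord_of_not_crosses {u v : Vertex} (hu : u.IsFinite) (hu' : Valid P.total u)
    (hv' : Valid P.total v) (he : v.IsFinite → Essential u v)
    (h : ∀ r s, P.Chord r s → ¬ Crosses u v r s) : P.Chord u v ∨ P.Chord v u := by
  rcases u with i | i | i <;> rcases v with j | j | (_ | _)
  all_goals first | exact hu.elim | skip
  · obtain ⟨h1, h2, h3⟩ := he trivial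
    have h1 : i ≠ j := fun hij => h1 (by rw [hij])
    rcases lt_or_gt_of_ne h1 with hij | hij
    · refine Or.inl ⟨?_, P.eq_one_of_not_crosses hij h⟩
      by_contra hcon
      obtain rfl : j = i + 1 := by lia
      exact h2 ⟨i, Or.inl ⟨rfl, rfl⟩⟩
    · refine Or.inr ⟨?_, P.eq_one_of_not_crosses hij fun r s hrs => ?_⟩
      · by_contra hcon
        obtain rfl : i = j + 1 := by lia
        exact h3 ⟨j, Or.inl ⟨rfl, rfl⟩⟩
      · rw [crosses_swap]
        exact h r s hrs
  · exact Or.inl (P.chord_outer_inner_of_not_crosses hv' h)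
  · have hk := P.skeletal_of_not_crosses (by simp) h
    refine Or.inl ⟨?_, hk⟩
    by_contra hcon
    have hm : 0 < P.total := Nat.pos_of_ne_zero hcon
    -- With inner points present, a spiral to the right crosses a chord to the inner boundary that
    -- starts further right.
    obtain ⟨s, hs, hs'⟩ := P.exists_skeletal_gt i
    apply (h (.outer s) (.inner (P.height s)) ⟨hm, hs', le_rfl, P.height_mono (by lia)⟩).elim
    simp only [Crosses, order, mul_neg_iff, mul_pos_iff]; lia
  -- A spiral to the left crosses the chord of a skeletal vertex further left, whether this goes to
  -- the inner boundary or spirals to the right.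
  · obtain ⟨s, hs, hs'⟩ := P.exists_skeletal_lt i
    obtain ⟨w, hw, hw'⟩ := P.exists_chord_of_skeletal hs'
    apply (h _ _ hw).elim
    rcases w with l | l | (_ | _)
    · exact (hw' l rfl).elim
    · simp only [Crosses, order, mul_neg_iff, mul_pos_iff]; lia
    · simp only [Crosses, order, mul_neg_iff, mul_pos_iff]; lia
    · exact hw.elim
  · right
    refine P.chord_outer_inner_of_not_crosses hu' fun r s hrs => ?_
    rw [crosses_swap]
    exact h r s hrs
  · obtain ⟨h1, h2, h3⟩ := he trivial
    have h1 : i ≠ j := fun hij => h1 (by rw [hij])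
    have h2 : j ≠ i + 1 := by rintro rfl; exact h2 ⟨i, Or.inr ⟨rfl, rfl⟩⟩
    have h3 : i ≠ j + 1 := by rintro rfl; exact h3 ⟨j, Or.inr ⟨rfl, rfl⟩⟩
    have hm : 0 < P.total := hu'
    -- This inner point lies strictly between i and j, and a chord from it to the outer boundary
    -- separates them.
    obtain ⟨k, hk, hk1, hk2⟩ := P.exists_skeletal_height hm (min i j + 1)
    apply (h (.outer k) (.inner (min i j + 1)) ⟨hm, hk, hk1, hk2⟩).elim
    simp only [Crosses, order, mul_neg_iff, mul_pos_iff]; lia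
  · have hm : 0 < P.total := hu'
    obtain ⟨k, hk, hk1, hk2⟩ := P.exists_skeletal_height hm (i + 1)
    apply (h (.outer k) (.inner (i + 1)) ⟨hm, hk, hk1, hk2⟩).elim
    simp only [Crosses, order, mul_neg_iff, mul_pos_iff]; lia
  · have hm : 0 < P.total := hu'
    obtain ⟨k, hk, hk1, hk2⟩ := P.exists_skeletal_height hm (i - 1)
    apply (h (.outer k) (.inner (i - 1)) ⟨hm, hk, hk1, hk2⟩).elim
    simp only [Crosses, order, mul_neg_iff, mul_pos_iff]; lia

end PeriodicPattern

/-! ### The triangulation of the annulus and the edges of its lift -/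

namespace PeriodicPattern

open AnnulusTriangulation

variable (P : PeriodicPattern)

/-- The arcs of the annulus with a lift along a chord of the pattern. -/
def arcs : Set (Arc P.n P.total) := {α | ∃ u v, P.Chord u v ∧ HasLift α u v}

variable {P}

theorem Chord.selfNoncrossing {u v : Vertex} (h : P.Chord u v) :
    SelfNoncrossing P.n P.total u v := fun τ => h.not_crosses (h.shift τ)

theorem Chord.exists_geodesic {u v : Vertex} (h : P.Chord u v) :
    ∃ α : Arc P.n P.total, HasLift α u v ∧
      ∃ S, IsTrace α S ∧ S ⊆ cover '' geodesic P.n P.total u v := by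
  by_cases hv : v.IsFinite
  · exact exists_geodesic_finite P.n_pos h.valid_left h.valid_right h.finite_left hv h.essential
      h.selfNoncrossing
  · rcases u with i | i | i <;> rcases v with j | j | (_ | _)
    case outer.limit.right => exact exists_geodesic_spiral P.n_pos i h.selfNoncrossing
    all_goals first | exact h.elim | exact (hv trivial).elim

variable (P)

theorem arcs_pairwise : P.arcs.Pairwise Compatible := by
  rintro α ⟨u, v, huv, hα⟩ β ⟨r, s, hrs, hβ⟩ hne
  obtain ⟨α', hα', S, hS, hSg⟩ := huv.exists_geodesic
  obtain ⟨β', hβ', S', hS', hSg'⟩ := hrs.exists_geodesic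
  obtain rfl := hα.unique hα'
  obtain rfl := hβ.unique hβ'
  exact compatible_of_not_crosses P.n_pos hα hβ hne huv.essential.1
    (fun τ => hrs.not_crosses (huv.shift τ)) hS hS' hSg hSg'

theorem mem_arcs_of_hasLift {α : Arc P.n P.total} {u v : Vertex} (hα : HasLift α u v)
    (h : P.Chord u v ∨ P.Chord v u) : α ∈ P.arcs := by
  rcases h with h | h
  · exact ⟨u, v, h, hα⟩
  · cases α with
    | finite α => exact ⟨v, u, h, hα.symm⟩
    | asymptotic d α =>
      have := h.finite_left
      rw [hα.2.2.1] at this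
      exact this.elim

/-- A lift of an arc compatible with all of `arcs` crosses no chord, so it runs along a chord. -/
theorem isTriangulation_arcs : IsTriangulation P.arcs := by
  refine ⟨P.arcs_pairwise, fun S hS hle α hα => ?_⟩
  obtain ⟨u, v, hl⟩ := exists_hasLift P.n_pos α
  by_contra hcon
  refine hcon (P.mem_arcs_of_hasLift hl (P.chord_of_not_crosses hl.finite_left hl.valid_left
    hl.valid_right (fun hv => ?_) fun r s hrs => ?_))
  · cases α with
    | finite α => exact hl.essential P.n_pos
    | asymptotic d α =>
      rw [hl.2.2.1] at hv
      exact hv.elim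
  · obtain ⟨β, hβ, -⟩ := hrs.exists_geodesic
    have hmem : β ∈ P.arcs := ⟨r, s, hrs, hβ⟩
    exact not_crosses_of_compatible P.n_pos hl hβ
      (hS hα (hle hmem) fun h => hcon (h ▸ hmem))

/-- Membership provides one lift along a chord; any other lift is a translate of it up to
orientation, and the chord system is invariant under translation. -/
theorem chord_of_mem_arcs {α : Arc P.n P.total} (hα : α ∈ P.arcs) {u v : Vertex}
    (h : HasLift α u v) : P.Chord u v ∨ P.Chord v u := by
  obtain ⟨r, s, hrs, hl⟩ := hα
  obtain ⟨τ, ⟨rfl, rfl⟩ | ⟨rfl, rfl⟩⟩ := hl.eq_shift P.n_pos h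
  · exact Or.inl (hrs.shift τ)
  · exact Or.inr (hrs.shift τ)

theorem liftJoins_arcs {u v : Vertex} (hu : u.IsFinite) (hv : v.IsFinite) (hu' : Valid P.total u)
    (hv' : Valid P.total v) :
    LiftJoins P.arcs (position P.n P.total u) (position P.n P.total v) ↔
      P.Chord u v ∨ P.Chord v u := by
  constructor
  · rintro ⟨c, hc, h0, h1, hmem⟩
    exact P.chord_of_mem_arcs hmem ⟨hu, hv, hu', hv', c, hc, h0, h1, rfl⟩
  · intro h
    obtain ⟨α, hα⟩ : ∃ α : FiniteArc P.n P.total, HasLift (.finite α) u v := by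
      rcases h with h | h
      · obtain ⟨α, hα, -⟩ := h.exists_geodesic
        cases α with
        | finite α => exact ⟨α, hα⟩
        | asymptotic d α =>
          rw [hα.2.2.1] at hv
          exact hv.elim
      · obtain ⟨α, hα, -⟩ := h.exists_geodesic
        cases α with
        | finite α => exact ⟨α, hα.symm⟩
        | asymptotic d α =>
          rw [hα.2.2.1] at hu
          exact hu.elim
    have hmem := P.mem_arcs_of_hasLift hα h
    obtain ⟨-, -, -, -, c, hc, h0, h1, rfl⟩ := hα
    exact ⟨c, hc, h0, h1, hmem⟩

theorem liftEscapes_arcs {u : Vertex} (hu : u.IsFinite) (hu' : Valid P.total u) (d : Direction) :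
    LiftEscapes P.arcs (position P.n P.total u) d ↔ P.Chord u (.limit d) := by
  constructor
  · rintro ⟨ρ, hρ, h0, hmem⟩
    rcases P.chord_of_mem_arcs hmem (v := .limit d) ⟨hu, hu', rfl, ρ, hρ, h0, rfl⟩ with h | h
    · exact h
    · exact h.finite_left.elim
  · intro h
    obtain ⟨α, hα, -⟩ := h.exists_geodesic
    have hmem := P.mem_arcs_of_hasLift hα (Or.inl h)
    cases α with
    | finite α => exact hα.2.1.elim
    | asymptotic d' α =>
      obtain ⟨-, -, hd, ρ, hρ, h0, rfl⟩ := hα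
      injection hd with hd
      subst hd
      exact ⟨ρ, hρ, h0, hmem⟩

/-- The edges of the induced triangulation of the strip, each with one orientation. -/
def Link : Vertex → Vertex → Prop
  | .outer i, .outer j => i < j ∧ P.L i j = 1
  | .outer k, .inner l => 0 < P.total ∧ P.Skeletal k ∧ P.height k ≤ l ∧ l ≤ P.height (k + 1)
  | .outer k, .limit .right => P.total = 0 ∧ P.Skeletal k
  | .inner k, .inner l => 0 < P.total ∧ l = k + 1
  | _, _ => False

/-- Adjacency in the induced triangulation of the strip. -/
def Adj (u v : Vertex) : Prop := P.Link u v ∨ P.Link v u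

variable {P} in
theorem Chord.link {u v : Vertex} (h : P.Chord u v) : P.Link u v := by
  rcases u with i | i | i <;> rcases v with j | j | (_ | _)
  all_goals first | exact h.elim | skip
  · exact ⟨by have := h.1; lia, h.2⟩
  · exact h
  · exact h

theorem adj_of_edge {u v : Vertex} (h : Edge P.arcs u v) : P.Adj u v := by
  cases h with
  | outer_outer k l h =>
    exact ((P.liftJoins_arcs (u := .outer k) (v := .outer l) trivial trivial trivial trivial).1
      h).imp Chord.link Chord.link
  | inner_inner k l hm h =>
    exact ((P.liftJoins_arcs (u := .inner k) (v := .inner l) trivial trivial hm hm).1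
      h).imp Chord.link Chord.link
  | outer_inner k l hm h =>
    exact ((P.liftJoins_arcs (u := .outer k) (v := .inner l) trivial trivial trivial hm).1
      h).imp Chord.link Chord.link
  | outer_limit k d h =>
    exact Or.inl ((P.liftEscapes_arcs (u := .outer k) trivial trivial d).1 h).link
  | inner_limit k d hm h =>
    exact Or.inl ((P.liftEscapes_arcs (u := .inner k) trivial hm d).1 h).link
  | outer_segment k => exact Or.inl ⟨by lia, P.succ k⟩
  | inner_segment k hm => exact Or.inl ⟨hm, rfl⟩

theorem edge_of_link {u v : Vertex} (h : P.Link u v) : Edge P.arcs u v := by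
  rcases u with i | i | i <;> rcases v with j | j | (_ | _)
  all_goals first | exact h.elim | skip
  · obtain ⟨h1, h2⟩ := h
    rcases eq_or_lt_of_le (show i + 1 ≤ j by lia) with rfl | h3
    · exact .outer_segment i
    · exact .outer_outer _ _ ((P.liftJoins_arcs (u := .outer i) (v := .outer j) trivial trivial
        trivial trivial).2 (Or.inl ⟨by lia, h2⟩))
  · exact .outer_inner _ _ h.1 ((P.liftJoins_arcs (u := .outer i) (v := .inner j) trivial trivial
      trivial h.1).2 (Or.inl h))
  · exact .outer_limit _ _ ((P.liftEscapes_arcs (u := .outer i) trivial trivial _).2 h)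
  · obtain ⟨h1, rfl⟩ := h
    exact .inner_segment _ h1

theorem edge_iff_adj (u v : Vertex) : Edge P.arcs u v ∨ Edge P.arcs v u ↔ P.Adj u v := by
  constructor
  · rintro (h | h)
    · exact P.adj_of_edge h
    · exact (P.adj_of_edge h).symm
  · exact Or.imp P.edge_of_link P.edge_of_link

end PeriodicPattern

/-! ### Labels of neighbours and the number of triangles at a vertex -/

/-- Counting the triangles at a vertex `v` whose neighbours are labelled by `0, …, A` such that two
of them are adjacent if and only if their labels are consecutive. -/
theorem encard_triangles_of_label {V : Type*} {Adj : V → V → Prop}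
    (symm : ∀ u w, Adj u w → Adj w u) {v : V} (hv : ¬ Adj v v) (label : V → ℤ) (A : ℕ)
    (hrange : ∀ w, Adj v w → 0 ≤ label w ∧ label w ≤ A)
    (hsurj : ∀ t : ℤ, 0 ≤ t → t ≤ A → ∃ w, Adj v w ∧ label w = t)
    (hinj : ∀ w w', Adj v w → Adj v w' → label w = label w' → w = w')
    (hadj : ∀ w w', Adj v w → Adj v w' → (Adj w w' ↔ label w' = label w + 1 ∨ label w = label w' + 1)) :
    Set.encard {Δ : Finset V | (Δ.card = 3 ∧ ∀ u ∈ Δ, ∀ w ∈ Δ, u ≠ w → Adj u w) ∧ v ∈ Δ} = A := by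
  classical
  have hsurj' : ∀ t : ℕ, ∃ w, t ≤ A → Adj v w ∧ label w = t := fun t => by
    by_cases ht : t ≤ A
    · obtain ⟨w, hw⟩ := hsurj t (by lia) (by exact_mod_cast ht)
      exact ⟨w, fun _ => hw⟩
    · exact ⟨v, fun h => (ht h).elim⟩
  choose ψ hψ using hsurj'
  have hne : ∀ w, Adj v w → w ≠ v := fun w hw h => hv (h ▸ hw)
  have himage : {Δ : Finset V | (Δ.card = 3 ∧ ∀ u ∈ Δ, ∀ w ∈ Δ, u ≠ w → Adj u w) ∧ v ∈ Δ} =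
      (fun t => ({v, ψ t, ψ (t + 1)} : Finset V)) '' (Finset.range A : Set ℕ) := by
    ext Δ
    simp only [Set.mem_ofPred_eq, Set.mem_image, Finset.coe_range, Set.mem_Iio]
    constructor
    · rintro ⟨⟨hcard, hΔ⟩, hvΔ⟩
      -- The other two corners are adjacent neighbours of v, hence have consecutive labels; the
      -- smaller label parametrizes the triangle.
      have h2 : (Δ.erase v).card = 2 := by rw [Finset.card_erase_of_mem hvΔ, hcard]
      obtain ⟨a, b, hab, he⟩ := Finset.card_eq_two.1 h2
      have hΔe : Δ = insert v {a, b} := by rw [← he, Finset.insert_erase hvΔ]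
      have haΔ : a ∈ Δ.erase v := by rw [he]; simp
      have hbΔ : b ∈ Δ.erase v := by rw [he]; simp
      rw [Finset.mem_erase] at haΔ hbΔ
      have ha := hΔ v hvΔ a haΔ.2 haΔ.1.symm
      have hb := hΔ v hvΔ b hbΔ.2 hbΔ.1.symm
      have key : ∀ x y, Adj v x → Adj v y → label y = label x + 1 →
          ∃ t < A, ({v, ψ t, ψ (t + 1)} : Finset V) = {v, x, y} := by
        intro x y hx hy hxy
        have h1 := hrange x hx
        have h3 := hrange y hy
        obtain ⟨t, ht⟩ := Int.eq_ofNat_of_zero_le h1.1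
        have e1 : ψ t = x :=
          hinj _ _ (hψ t (by lia)).1 hx (by rw [(hψ t (by lia)).2, ht])
        have e2 : ψ (t + 1) = y :=
          hinj _ _ (hψ (t + 1) (by lia)).1 hy (by rw [(hψ (t + 1) (by lia)).2, hxy, ht]; simp)
        exact ⟨t, by lia, by rw [e1, e2]⟩
      rcases (hadj a b ha hb).1 (hΔ a haΔ.2 b hbΔ.2 hab) with h | h
      · rw [hΔe]
        exact key a b ha hb h
      · rw [hΔe, Finset.pair_comm a b]
        exact key b a hb ha h
    · rintro ⟨t, ht, rfl⟩
      obtain ⟨h1, l1⟩ := hψ t (by lia)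
      obtain ⟨h2, l2⟩ := hψ (t + 1) (by lia)
      have h3 : Adj (ψ t) (ψ (t + 1)) := (hadj _ _ h1 h2).2 (Or.inl (by rw [l1, l2]; simp))
      have h4 : ψ t ≠ ψ (t + 1) := fun h => by rw [h, l2] at l1; simp at l1
      refine ⟨⟨Finset.card_eq_three.2 ⟨_, _, _, (hne _ h1).symm, (hne _ h2).symm, h4, rfl⟩, ?_⟩,
        by simp⟩
      intro u hu w hw huw
      simp only [Finset.mem_insert, Finset.mem_singleton] at hu hw
      rcases hu with rfl | rfl | rfl <;> rcases hw with rfl | rfl | rfl <;>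
        first | exact (huw rfl).elim | assumption | exact symm _ _ ‹_›
  rw [himage, Set.InjOn.encard_image, Set.encard_coe_eq_coe_finsetCard, Finset.card_range]
  intro s hs t ht hst
  simp only [Finset.coe_range, Set.mem_Iio] at hs ht
  -- For injectivity, equal triangles give {s, s + 1} ⊆ {t, t + 1} on labels, which forces s = t.
  have mem : ∀ x ∈ ({v, ψ s, ψ (s + 1)} : Finset V), Adj v x → label x = t ∨ label x = t + 1 := by
    intro x hx hvx
    simp only at hst
    rw [hst] at hx
    simp only [Finset.mem_insert, Finset.mem_singleton] at hx
    rcases hx with rfl | rfl | rfl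
    · exact (hv hvx).elim
    · exact Or.inl (hψ t (by lia)).2
    · exact Or.inr (by rw [(hψ (t + 1) (by lia)).2]; simp)
  have h1 := mem (ψ s) (by simp) (hψ s (by lia)).1
  have h2 := mem (ψ (s + 1)) (by simp) (hψ (s + 1) (by lia)).1
  rw [(hψ s (by lia)).2] at h1
  rw [(hψ (s + 1) (by lia)).2] at h2
  push_cast at h2
  lia

namespace PeriodicPattern

open AnnulusTriangulation

variable (P : PeriodicPattern)

theorem nonneg {i j : ℤ} (h : i ≤ j) : 0 ≤ P.L i j := by
  rcases eq_or_lt_of_le h with rfl | h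
  · rw [P.diag]
  · exact (P.pos _ _ h).le

/-- The label of a neighbour of the `k`-th vertex of the lower boundary. -/
noncomputable def label (k : ℤ) : Vertex → ℤ
  | .outer j => if k < j then P.L (k + 1) j else P.L j (k + 1)
  | .inner l => P.L (k + 1) (P.last k) + 1 + (P.height (k + 1) - l)
  | .limit _ => P.L (k + 1) (P.last k) + 1

theorem label_right {k j : ℤ} (h : k < j) : P.label k (.outer j) = P.L (k + 1) j := if_pos h

theorem label_left {k i : ℤ} (h : i < k) : P.label k (.outer i) = P.L i (k + 1) :=
  if_neg (by lia)

theorem adj_comm (u v : Vertex) : P.Adj u v ↔ P.Adj v u := or_comm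

theorem not_adj_self (k : ℤ) : ¬ P.Adj (.outer k) (.outer k) := by
  rintro (h | h) <;> exact absurd h.1 (lt_irrefl k)

theorem adj_outer {i j : ℤ} (h : i < j) : P.Adj (.outer i) (.outer j) ↔ P.L i j = 1 :=
  ⟨fun h' => h'.elim (fun h => h.2) fun h' => absurd h'.1 (by lia), fun h' => Or.inl ⟨h, h'⟩⟩

/-- The neighbours of a vertex of the lower boundary: on the same boundary to the right or to the
left, on the opposite boundary, or a limit point. -/
theorem adj_cases {k : ℤ} {w : Vertex} (h : P.Adj (.outer k) w) :
    (∃ j, w = .outer j ∧ k < j ∧ P.L k j = 1) ∨ (∃ i, w = .outer i ∧ i < k ∧ P.L i k = 1) ∨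
    (∃ l, w = .inner l ∧ 0 < P.total ∧ P.Skeletal k ∧ P.height k ≤ l ∧ l ≤ P.height (k + 1)) ∨
    (w = .limit .right ∧ P.total = 0 ∧ P.Skeletal k) := by
  rcases w with j | j | (_ | _) <;> rcases h with h | h
  · exact Or.inl ⟨j, rfl, h⟩
  · exact Or.inr (Or.inl ⟨j, rfl, h⟩)
  · exact Or.inr (Or.inr (Or.inl ⟨j, rfl, h⟩))
  · exact h.elim
  · exact Or.inr (Or.inr (Or.inr ⟨rfl, h⟩))
  all_goals exact h.elim

theorem right_label_le {k j : ℤ} (hj : k < j) (h : P.L k j = 1) :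
    0 ≤ P.L (k + 1) j ∧ P.L (k + 1) j ≤ P.L (k + 1) (P.last k) := by
  have h1 := P.le_last hj h
  have h2 := P.right_right hj h1 h (P.L_last k)
  have h3 := P.nonneg h1
  exact ⟨P.nonneg (by lia), by lia⟩

theorem right_label_eq {k j : ℤ} (hj : k < j) (h : P.L k j = 1) :
    P.L (k + 1) j = P.L (k + 1) (P.last k) ↔ j = P.last k := by
  refine ⟨fun he => ?_, fun he => by rw [he]⟩
  have h1 := P.le_last hj h
  have h2 := P.right_right hj h1 h (P.L_last k)
  by_contra hne
  have := P.pos j (P.last k) (lt_of_le_of_ne h1 hne)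
  lia

theorem left_label_le {k i : ℤ} (hi : i < k) (h : P.L i k = 1) :
    P.L (P.first k) (k + 1) ≤ P.L i (k + 1) ∧ P.L i (k + 1) ≤ P.L (k - 1) (k + 1) := by
  have h1 := P.first_le hi h
  have h2 := P.left_left hi h1 (P.L_first k) h
  have h3 := P.nonneg h1
  have h4 := P.left_left (show k - 1 < k by lia) (show i ≤ k - 1 by lia) h
    (by simpa using P.succ (k - 1))
  have h5 := P.nonneg (show i ≤ k - 1 by lia)
  exact ⟨by lia, by lia⟩

theorem left_label_eq {k i : ℤ} (hi : i < k) (h : P.L i k = 1) :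
    P.L i (k + 1) = P.L (P.first k) (k + 1) ↔ i = P.first k := by
  refine ⟨fun he => ?_, fun he => by rw [he]⟩
  have h1 := P.first_le hi h
  have h2 := P.left_left hi h1 (P.L_first k) h
  by_contra hne
  have := P.pos (P.first k) i (lt_of_le_of_ne h1 (Ne.symm hne))
  lia

/-- No vertex strictly between k and `last k` is skeletal. So for skeletal k, the inner points of
`last k` start with the final one of k, and this common point closes a triangle. -/
theorem height_last (k : ℤ) : P.height (P.last k) = P.height (k + 1) :=
  P.height_eq_of_not_skeletal (by have := P.lt_last k; lia) fun _ h1 h2 =>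
    P.not_skeletal_of_lt_last (by lia) h2

theorem height_first (k : ℤ) : P.height k = P.height (P.first k + 1) :=
  P.height_eq_of_not_skeletal (by have := P.first_lt k; lia) fun _ h1 h2 =>
    P.not_skeletal_of_first_lt h2 (by lia)

theorem height_succ_of_skeletal {k : ℤ} (hk : P.Skeletal k) :
    P.height (k + 1) - P.height k + 2 = P.L (P.first k) (k + 1) - P.L (k + 1) (P.last k) := by
  rw [height_succ, weight, if_pos hk, ← P.gap_eq]
  ring

theorem height_eq_of_total (h : P.total = 0) (k : ℤ) : P.height (k + 1) = P.height k := by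
  rw [height_succ, P.weight_eq_zero h, add_zero]

theorem skeletal_right_iff {k j : ℤ} (hk : P.Skeletal k) (hj : k < j) (h : P.L k j = 1) :
    P.Skeletal j ↔ j = P.last k := by
  refine ⟨fun h' => ?_, fun h' => h' ▸ P.skeletal_last hk⟩
  by_contra hne
  exact P.not_skeletal_of_lt_last hj (lt_of_le_of_ne (P.le_last hj h) hne) h'

theorem skeletal_left_iff {k i : ℤ} (hk : P.Skeletal k) (hi : i < k) (h : P.L i k = 1) :
    P.Skeletal i ↔ i = P.first k := by
  refine ⟨fun h' => ?_, fun h' => h' ▸ P.skeletal_first hk⟩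
  by_contra hne
  exact P.not_skeletal_of_first_lt hi (lt_of_le_of_ne (P.first_le hi h) (Ne.symm hne)) h'

/-- Labels increase from k + 1 to `last k`, then through the inner points from right to left (or the
limit point), then from `first k` to k - 1. -/
theorem label_range {k : ℤ} {w : Vertex} (h : P.Adj (.outer k) w) :
    0 ≤ P.label k w ∧ P.label k w ≤ P.L (k - 1) (k + 1) := by
  have hg := P.gap_pos k
  rw [P.gap_eq] at hg
  have hr := P.right_label_le (P.lt_last k) (P.L_last k)
  have hl := P.left_label_le (P.first_lt k) (P.L_first k)
  rcases P.adj_cases h with ⟨j, rfl, hj, h1⟩ | ⟨i, rfl, hi, h1⟩ | ⟨l, rfl, h1, h2, h3, h4⟩ |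
    ⟨rfl, h1, h2⟩
  · rw [P.label_right hj]
    have := P.right_label_le hj h1
    lia
  · rw [P.label_left hi]
    have := P.left_label_le hi h1
    lia
  · have := P.height_succ_of_skeletal h2
    simp only [label]
    lia
  · have := P.height_succ_of_skeletal h2
    have := P.height_eq_of_total h1 k
    simp only [label]
    lia

/-- Outer neighbours realize the labels up to that of `last k` and from that of `first k` on. A
label in between forces k to be skeletal, and then `height` has been chosen to supply it. -/
theorem exists_label {k t : ℤ} (ht : 0 ≤ t) (ht' : t ≤ P.L (k - 1) (k + 1)) :
    ∃ w, P.Adj (.outer k) w ∧ P.label k w = t := by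
  rcases le_or_gt t (P.L (k + 1) (P.last k)) with h | h
  · obtain ⟨j, h1, h2, h3⟩ := P.exists_right_label (P.lt_last k) (P.L_last k) ht h
    exact ⟨.outer j, Or.inl ⟨h1, h2⟩, by rw [P.label_right h1, h3]⟩
  rcases le_or_gt (P.L (P.first k) (k + 1)) t with h' | h'
  · obtain ⟨i, h1, h2, h3⟩ := P.exists_left_label (P.first_lt k) (P.L_first k) ht' h'
    exact ⟨.outer i, Or.inr ⟨h1, h2⟩, by rw [P.label_left h1, h3]⟩
  have hk : P.Skeletal k := by
    by_contra hcon
    have := P.gap_eq_one hcon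
    rw [P.gap_eq] at this
    lia
  have hs := P.height_succ_of_skeletal hk
  rcases Nat.eq_zero_or_pos P.total with hm | hm
  · have := P.height_eq_of_total hm k
    exact ⟨.limit .right, Or.inl ⟨hm, hk⟩, by simp only [label]; lia⟩
  · exact ⟨.inner (P.height (k + 1) - (t - P.L (k + 1) (P.last k) - 1)),
      Or.inl ⟨hm, hk, by lia, by lia⟩, by simp only [label]; lia⟩

theorem adj_right_right {k j j' : ℤ} (hj : k < j) (h : P.L k j = 1) (hj' : k < j')
    (h' : P.L k j' = 1) : P.Adj (.outer j) (.outer j') ↔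
      P.L (k + 1) j' = P.L (k + 1) j + 1 ∨ P.L (k + 1) j = P.L (k + 1) j' + 1 := by
  rcases lt_trichotomy j j' with hlt | rfl | hlt
  · have h1 := P.right_right hj hlt.le h h'
    have h2 := P.pos _ _ hlt
    rw [P.adj_outer hlt]
    lia
  · simp [P.not_adj_self]
  · have h1 := P.right_right hj' hlt.le h' h
    have h2 := P.pos _ _ hlt
    rw [P.adj_comm, P.adj_outer hlt]
    lia

theorem adj_left_left {k i i' : ℤ} (hi : i < k) (h : P.L i k = 1) (hi' : i' < k)
    (h' : P.L i' k = 1) : P.Adj (.outer i) (.outer i') ↔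
      P.L i' (k + 1) = P.L i (k + 1) + 1 ∨ P.L i (k + 1) = P.L i' (k + 1) + 1 := by
  rcases lt_trichotomy i i' with hlt | rfl | hlt
  · have h1 := P.left_left hi' hlt.le h h'
    have h2 := P.pos _ _ hlt
    rw [P.adj_outer hlt]
    lia
  · simp [P.not_adj_self]
  · have h1 := P.left_left hi hlt.le h' h
    have h2 := P.pos _ _ hlt
    rw [P.adj_comm, P.adj_outer hlt]
    lia

/-- Neighbours of a vertex are adjacent if and only if their labels are consecutive. -/
theorem adj_iff_label {k : ℤ} {w w' : Vertex} (h : P.Adj (.outer k) w) (h' : P.Adj (.outer k) w') :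
    P.Adj w w' ↔ P.label k w' = P.label k w + 1 ∨ P.label k w = P.label k w' + 1 := by
  have left_right : ∀ {i j : ℤ}, i < k → P.L i k = 1 → k < j → P.L k j = 1 →
      (P.Adj (.outer i) (.outer j) ↔
        P.label k (.outer j) = P.label k (.outer i) + 1 ∨
        P.label k (.outer i) = P.label k (.outer j) + 1) := by
    intro i j hi h1 hj h2
    have h3 := P.left_right hi hj h1 h2
    have h4 := P.pos i j (by lia)
    rw [P.label_right hj, P.label_left hi, P.adj_outer (by lia)]
    lia
  -- Among the right neighbours only `last k` is skeletal and can have inner neighbours; by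
  -- `height_last`, the only one shared with k is `height (k + 1)`.
  have right_inner : ∀ {j l : ℤ}, k < j → P.L k j = 1 → 0 < P.total → P.Skeletal k →
      P.height k ≤ l → l ≤ P.height (k + 1) → (P.Adj (.outer j) (.inner l) ↔
        P.label k (.inner l) = P.label k (.outer j) + 1 ∨
        P.label k (.outer j) = P.label k (.inner l) + 1) := by
    intro j l hj h1 hm hk h2 h3
    have h4 := P.right_label_le hj h1
    have h5 := P.right_label_eq hj h1
    have h6 := P.skeletal_right_iff hk hj h1
    have h7 := P.height_last k
    rw [P.label_right hj]
    simp only [label]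
    constructor
    · rintro (⟨-, h8, h9, h10⟩ | h)
      · obtain rfl := h6.1 h8
        lia
      · exact h.elim
    · intro h
      have h8 : j = P.last k := h5.1 (by lia)
      refine Or.inl ⟨hm, h6.2 h8, ?_, ?_⟩
      · rw [h8]; lia
      · have := P.height_mono (show j ≤ j + 1 by lia)
        rw [h8] at this ⊢
        lia
  have left_inner : ∀ {i l : ℤ}, i < k → P.L i k = 1 → 0 < P.total → P.Skeletal k →
      P.height k ≤ l → l ≤ P.height (k + 1) → (P.Adj (.outer i) (.inner l) ↔
        P.label k (.inner l) = P.label k (.outer i) + 1 ∨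
        P.label k (.outer i) = P.label k (.inner l) + 1) := by
    intro i l hi h1 hm hk h2 h3
    have h4 := P.left_label_le hi h1
    have h5 := P.left_label_eq hi h1
    have h6 := P.skeletal_left_iff hk hi h1
    have h7 := P.height_first k
    have h8 := P.height_succ_of_skeletal hk
    rw [P.label_left hi]
    simp only [label]
    constructor
    · rintro (⟨-, h8, h9, h10⟩ | h)
      · obtain rfl := h6.1 h8
        lia
      · exact h.elim
    · intro h
      have h9 : i = P.first k := h5.1 (by lia)
      refine Or.inl ⟨hm, h6.2 h9, ?_, ?_⟩
      · have := P.height_mono (show i ≤ i + 1 by lia)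
        rw [h9] at this ⊢
        lia
      · rw [h9]; lia
  have right_limit : ∀ {j : ℤ}, k < j → P.L k j = 1 → P.total = 0 → P.Skeletal k →
      (P.Adj (.outer j) (.limit .right) ↔
        P.label k (.limit .right) = P.label k (.outer j) + 1 ∨
        P.label k (.outer j) = P.label k (.limit .right) + 1) := by
    intro j hj h1 hm hk
    have h4 := P.right_label_le hj h1
    have h5 := P.right_label_eq hj h1
    have h6 := P.skeletal_right_iff hk hj h1
    rw [P.label_right hj]
    simp only [label]
    constructor
    · rintro (⟨-, h8⟩ | h)
      · have := h5.2 (h6.1 h8)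
        lia
      · exact h.elim
    · intro h
      exact Or.inl ⟨hm, h6.2 (h5.1 (by lia))⟩
  have left_limit : ∀ {i : ℤ}, i < k → P.L i k = 1 → P.total = 0 → P.Skeletal k →
      (P.Adj (.outer i) (.limit .right) ↔
        P.label k (.limit .right) = P.label k (.outer i) + 1 ∨
        P.label k (.outer i) = P.label k (.limit .right) + 1) := by
    intro i hi h1 hm hk
    have h4 := P.left_label_le hi h1
    have h5 := P.left_label_eq hi h1
    have h6 := P.skeletal_left_iff hk hi h1
    have h8 := P.height_succ_of_skeletal hk
    have h9 := P.height_eq_of_total hm k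
    rw [P.label_left hi]
    simp only [label]
    constructor
    · rintro (⟨-, h8⟩ | h)
      · have := h5.2 (h6.1 h8)
        lia
      · exact h.elim
    · intro h
      exact Or.inl ⟨hm, h6.2 (h5.1 (by lia))⟩
  rcases P.adj_cases h with ⟨j, rfl, hj, h1⟩ | ⟨j, rfl, hj, h1⟩ | ⟨l, rfl, hm, hk, h2, h3⟩ |
      ⟨rfl, hm, hk⟩ <;>
    rcases P.adj_cases h' with ⟨j', rfl, hj', h1'⟩ | ⟨j', rfl, hj', h1'⟩ |
      ⟨l', rfl, hm', hk', h2', h3'⟩ | ⟨rfl, hm', hk'⟩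
  · rw [P.label_right hj, P.label_right hj']
    exact P.adj_right_right hj h1 hj' h1'
  · rw [P.adj_comm, or_comm]
    exact left_right hj' h1' hj h1
  · exact right_inner hj h1 hm' hk' h2' h3'
  · exact right_limit hj h1 hm' hk'
  · exact left_right hj h1 hj' h1'
  · rw [P.label_left hj, P.label_left hj']
    exact P.adj_left_left hj h1 hj' h1'
  · exact left_inner hj h1 hm' hk' h2' h3'
  · exact left_limit hj h1 hm' hk'
  · rw [P.adj_comm, or_comm]
    exact right_inner hj' h1' hm hk h2 h3
  · rw [P.adj_comm, or_comm]
    exact left_inner hj' h1' hm hk h2 h3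
  · simp only [Adj, Link, label, hm, true_and]
    lia
  · lia
  · rw [P.adj_comm, or_comm]
    exact right_limit hj' h1' hm hk
  · rw [P.adj_comm, or_comm]
    exact left_limit hj' h1' hm hk
  · lia
  · simp [Adj, Link]

theorem label_injective {k : ℤ} {w w' : Vertex} (h : P.Adj (.outer k) w)
    (h' : P.Adj (.outer k) w') (he : P.label k w = P.label k w') : w = w' := by
  have hg := P.gap_pos k
  rw [P.gap_eq] at hg
  rcases P.adj_cases h with ⟨j, rfl, hj, h1⟩ | ⟨j, rfl, hj, h1⟩ | ⟨l, rfl, hm, hk, h2, h3⟩ |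
      ⟨rfl, hm, hk⟩ <;>
    rcases P.adj_cases h' with ⟨j', rfl, hj', h1'⟩ | ⟨j', rfl, hj', h1'⟩ |
      ⟨l', rfl, hm', hk', h2', h3'⟩ | ⟨rfl, hm', hk'⟩
  -- The label ranges of right neighbours, left neighbours and opposite vertices are disjoint, which
  -- disposes of the mixed cases.
  all_goals
    try have a1 := P.right_label_le hj h1
    try have a2 := P.left_label_le hj h1
    try have a3 := P.right_label_le hj' h1'
    try have a4 := P.left_label_le hj' h1'
    try have a5 := P.height_succ_of_skeletal hk
    try have a6 := P.height_succ_of_skeletal hk'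
    try have a7 := P.height_eq_of_total hm k
    try have a8 := P.height_eq_of_total hm' k
    try rw [P.label_right hj] at he
    try rw [P.label_left hj] at he
    try rw [P.label_right hj'] at he
    try rw [P.label_left hj'] at he
    try simp only [label] at he
    try (exfalso; lia)
  · rcases lt_trichotomy j j' with hlt | rfl | hlt
    · have := P.right_right hj hlt.le h1 h1'
      have := P.pos _ _ hlt
      lia
    · rfl
    · have := P.right_right hj' hlt.le h1' h1
      have := P.pos _ _ hlt
      lia
  · rcases lt_trichotomy j j' with hlt | rfl | hlt
    · have := P.left_left hj' hlt.le h1 h1'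
      have := P.pos _ _ hlt
      lia
    · rfl
    · have := P.left_left hj hlt.le h1' h1
      have := P.pos _ _ hlt
      lia
  · rw [show l = l' by lia]
  · rfl

theorem encard_triangles (k : ℤ) {A : ℕ} (hA : P.L (k - 1) (k + 1) = A) :
    Set.encard {Δ : Finset Vertex | IsTriangle P.arcs Δ ∧ Vertex.outer k ∈ Δ} = A := by
  simp only [IsTriangle, P.edge_iff_adj]
  refine encard_triangles_of_label (Adj := P.Adj) (fun _ _ => Or.symm) (P.not_adj_self k) (P.label k) A
    (fun w hw => ?_) (fun t h1 h2 => ?_) (fun _ _ => P.label_injective) fun _ _ => P.adj_iff_label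
  · rw [← hA]
    exact P.label_range hw
  · exact P.exists_label h1 (by rwa [hA])

end PeriodicPattern

theorem theorem4p6 (n : ℕ) (hn : 0 < n) (a : Fin n → ℕ) (F : Frieze)
    (hF : F.HasQuidditySequence a) :
    F.IsFinite ∨ ∃ m : ℕ, AnnulusTriangulation.RealizableIn a m := by
  by_cases h : F.width = ⊤
  · let P := F.pattern h hn hF
    exact Or.inr ⟨P.total, P.arcs, P.isTriangulation_arcs, fun i =>
      P.encard_triangles i (Frieze.chord_eq_quiddity hF i)⟩
  · exact Or.inl h
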